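/- **Setting.** Let $\mathbb F$ be a field of characteristic $0$ and let $\mathcal V$ be an algebra of differential functions in $u_1,\dots,u_\ell$ which is a domain: a commutative differential $\mathbb F$-algebra $(\mathcal V,\partial)$ containing the differential polynomials $R_\ell=\mathbb F[u_i^{(n)}]$, with commuting derivations $\partial/\partial u_i^{(n)}$ that extend the usual ones, such that only finitely many $\partial f/\partial u_i^{(n)}$ are nonzero for each $f$, and $[\partial/\partial u_i^{(n)},\partial]=\partial/\partial u_i^{(n-1)}$ ($0$ for $n=0$). An element of $\mathcal V((\partial^{-1}))$ is *rational* if it is $A(\partial)B(\partial)^{-1}$ with $A,B\in\mathcal V[\partial]$, $B\ne0$; a matrix is rational if its entries are. For $H\in\mathrm{Mat}_{\ell\times\ell}\mathcal V((\partial^{-1}))$ put $$\{f_\lambda g\}_H=\sum_{i,j,m,n}\frac{\partial g}{\partial u_j^{(n)}}(\lambda+\partial)^nH_{ji}(\lambda+\partial)(-\lambda-\partial)^m\frac{\partial f}{\partial u_i^{(m)}}.$$ A *Poisson structure* on $\mathcal V$ is a skewadjoint rational $H$ with $\{u_{i\,\lambda}\{u_{j\,\mu}u_k\}_H\}_H-\{u_{j\,\mu}\{u_{i\,\lambda}u_k\}_H\}_H=\{\{u_{i\,\lambda}u_j\}_H{}_{\,\lambda+\mu}u_k\}_H$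 for all $i,j,k$, as elements of $\mathcal V_{\lambda,\mu}=\mathcal V[[\lambda^{-1},\mu^{-1},(\lambda+\mu)^{-1}]][\lambda,\mu]$. Poisson structures $H_0,H_1$ are *compatible*, and $(H_0,H_1)$ is a *bi-Poisson structure*, if $H_0+H_1$ is also a Poisson structure. For $\theta=(\theta_1,\dots,\theta_m)\in\mathcal V^m$ let $(D_\theta)_{\alpha i}=\sum_n\frac{\partial\theta_\alpha}{\partial u_i^{(n)}}\partial^n$; $\theta_\alpha$ is *central* for $H$ if $D_{\theta_\alpha}\circ H=0$. If $C=D_\theta\circ H\circ D_\theta^*$ is invertible in $\mathrm{Mat}_{m\times m}\mathcal V((\partial^{-1}))$, the *Dirac modification* of $H$ by $\theta$ is $\widetilde H^D=H-H\circ D_\theta^*\circ C^{-1}\circ D_\theta\circ H$. **Proposition.** Let $(H_0,H_1)$ be a bi-Poisson structure on $\mathcal V$, let $\theta_1,\dots,\theta_m\in\mathcal V$ be central for $H_0$, let $\mathcal I$ be the differential ideal they generate, and assume that $C=D_\theta\circ H_1\circ D_\theta^*$ is invertible in $\mathrm{Mat}_{m\times m}\mathcal V((\partial^{-1}))$. (a)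 The matrix $D_\theta\circ(H_0+H_1)\circ D_\theta^*$ is also invertible and $\widetilde{(H_0+H_1)}^D=H_0+\widetilde{H_1}^D$. Moreover, $H_0$ and $\widetilde{H_1}^D$ are compatible Poisson structures on $\mathcal V$. Suppose in addition that $m\le\ell$ and $\theta_\alpha=u_{\ell-m+\alpha}+p_\alpha$, where $p_\alpha\in\mathcal V$ and $\partial p_\alpha/\partial u_{\ell-m+\beta}^{(n)}=0$ for all $\alpha,\beta=1,\dots,m$ and $n\ge0$. Let $D_p=\big(\sum_n\frac{\partial p_\alpha}{\partial u_i^{(n)}}\partial^n\big)_{\alpha\le m,\,i\le\ell-m}$. Then one can write $$H_0=\begin{pmatrix}\mathbb 1_{\ell-m}\\-D_p\end{pmatrix}\circ A_0\circ\begin{pmatrix}\mathbb 1_{\ell-m}&-D_p^*\end{pmatrix},\qquad H_1=\begin{pmatrix}A_1&B_1\\-B_1^*&D_1\end{pmatrix}$$ with $A_0,A_1$ of size $(\ell-m)\times(\ell-m)$. Put $A_1^D=A_1+(B_1+A_1\circ D_p^*)\circ C^{-1}\circ(B_1^*-D_p\circ A_1)$. (b) $A_0$ and $A_1^D$ are compatible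 Poisson structures on $\widetilde{\mathcal V}$, which is the differential algebra $\mathcal V$ regarded as an algebra of differential functions in $u_1,\dots,u_{\ell-m}$ with the modified partial derivatives $$\frac{\widetilde\partial}{\widetilde\partial u_i^{(s)}}=\frac{\partial}{\partial u_i^{(s)}}-\sum_{\alpha=1}^m\sum_{n\ge0}\frac{\partial(\partial^np_\alpha)}{\partial u_i^{(s)}}\frac{\partial}{\partial u_{\ell-m+\alpha}^{(n)}}.$$ (c) Assume that $\mathcal I\cap R_{\ell-m}=0$, where $R_{\ell-m}=\mathbb F[u_i^{(n)}\mid i\le\ell-m]$, so that $\mathcal V/\mathcal I$ is an algebra of differential functions in $u_1,\dots,u_{\ell-m}$ with the partial derivatives induced by the modified ones. Assume also that $\mathcal V/\mathcal I$ is a domain, and that the matrices $\overline{A_0}$, $\overline{A_1^D}$ over $(\mathcal V/\mathcal I)((\partial^{-1}))$, obtained by taking cosets of all coefficients, are rational. Then the central reduction $H_0^C=\overline{A_0}$ and the Dirac reduction $H_1^D=\overline{A_1^D}$ are compatible Poisson structures on $\mathcal V/\mathcal I$. -/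

import Mathlib

/-! ### Pseudodifferential operators `V((∂⁻¹))` -/

/-- Formal Laurent series in an inverse variable: coefficient families `ℤ → V` that vanish
in all large enough degrees. -/
def boundedAbove (V : Type*) [AddCommGroup V] : AddSubgroup (ℤ → V) where
  carrier := {a | ∃ N : ℤ, ∀ n, N < n → a n = 0}
  zero_mem' := ⟨0, fun _ _ => rfl⟩
  add_mem' := by
    rintro a b ⟨N, hN⟩ ⟨M, hM⟩
    refine ⟨max N M, fun n hn => ?_⟩
    simp [hN n (lt_of_le_of_lt (le_max_left _ _) hn), hM n (lt_of_le_of_lt (le_max_right _ _) hn)]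
  neg_mem' := by
    rintro a ⟨N, hN⟩
    exact ⟨N, fun n hn => by simp [hN n hn]⟩

/-- The pseudodifferential operators `∑_{n ≤ N} aₙ ∂ⁿ` with coefficients in the differential
algebra `(V, D)`, where `∂` acts on `V` as `D`.  The same family of coefficients is the symbol
`∑ aₙ λⁿ` in `V((λ⁻¹))`. -/
def PDO {F V : Type*} [CommRing F] [CommRing V] [Algebra F V] (_D : Derivation F V V) : Type _ :=
  boundedAbove V

namespace PDO

variable {F V : Type*} [CommRing F] [CommRing V] [Algebra F V] {D : Derivation F V V}

noncomputable instance : AddCommGroup (PDO D) := inferInstanceAs (AddCommGroup (boundedAbove V))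

/-- The coefficient of `∂ⁿ`. -/
def coeff (a : PDO D) (n : ℤ) : V := a.1 n

/-- Composition, determined by `∂ⁿ ∘ f = ∑_{k ≥ 0} (n choose k) f⁽ᵏ⁾ ∂ⁿ⁻ᵏ` for all `n : ℤ`.
Each coefficient is a sum with finitely many nonzero terms. -/
noncomputable instance : Mul (PDO D) where
  mul a b := ⟨fun n => ∑ᶠ q : ℤ × ℕ,
      (Ring.choose q.1 q.2 : ℤ) • (a.coeff q.1 * (⇑D)^[q.2] (b.coeff (n - q.1 + q.2))), by
    obtain ⟨N, hN⟩ := a.2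
    obtain ⟨M, hM⟩ := b.2
    refine ⟨N + M, fun n hn => ?_⟩
    refine (finsum_congr fun q => ?_).trans finsum_zero
    rcases lt_or_ge N q.1 with h | h
    · have : a.coeff q.1 = 0 := hN _ h
      simp [this]
    · have : b.coeff (n - q.1 + q.2) = 0 := hM _ (by omega)
      simp [this, iterate_map_zero]⟩

/-- The operator of multiplication by `1`. -/
instance : One (PDO D) where
  one := ⟨fun n => if n = 0 then 1 else 0, 0, fun n hn => by simp [hn.ne']⟩

/-- The formal adjoint `(∑ aₙ ∂ⁿ)* = ∑ (-∂)ⁿ ∘ aₙ`. -/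
noncomputable def adjoint (a : PDO D) : PDO D :=
  ⟨fun n => ∑ᶠ k : ℕ, ((Int.negOnePow (n + k) : ℤ) * Ring.choose (n + k) k) •
      (⇑D)^[k] (a.coeff (n + k)), by
    obtain ⟨N, hN⟩ := a.2
    refine ⟨N, fun n hn => ?_⟩
    refine (finsum_congr fun k => ?_).trans finsum_zero
    have : a.coeff (n + k) = 0 := hN _ (by omega)
    simp [this, iterate_map_zero]⟩

/-- Differential operators, the elements of `V[∂]`. -/
def IsDifferential (a : PDO D) : Prop := ∀ n < 0, a.coeff n = 0

/-- `L` is rational: `L = A ∘ B⁻¹` with differential operators `A` and `B ≠ 0` with coefficients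
in `V`.  (For a domain `V` a nonzero `B` is invertible over the field of fractions of `V`,
so that `L = A ∘ B⁻¹` there means `L ∘ B = A`.) -/
def IsRational (L : PDO D) : Prop :=
  ∃ A B : PDO D, A.IsDifferential ∧ B.IsDifferential ∧ B ≠ 0 ∧ L * B = A

/-- Matrices all of whose entries are rational. -/
def IsRationalMatrix {ι κ : Type*} (H : Matrix ι κ (PDO D)) : Prop :=
  ∀ i j, (H i j).IsRational

/-- The adjoint of a matrix pseudodifferential operator: `(H*)ᵢⱼ = (Hⱼᵢ)*`. -/
noncomputable def adjointMatrix {ι κ : Type*} (H : Matrix ι κ (PDO D)) : Matrix κ ι (PDO D) :=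
  Matrix.of fun i j => (H j i).adjoint

/-- Two-sided invertibility of a square matrix pseudodifferential operator, over `V((∂⁻¹))`. -/
def IsInvertible {ι : Type*} [Fintype ι] [DecidableEq ι] (C : Matrix ι ι (PDO D)) : Prop :=
  ∃ X : Matrix ι ι (PDO D), C * X = 1 ∧ X * C = 1

open Classical in
/-- The inverse of an invertible matrix pseudodifferential operator
(zero if there is no inverse). -/
noncomputable def inverse {ι : Type*} [Fintype ι] [DecidableEq ι] (C : Matrix ι ι (PDO D)) :
    Matrix ι ι (PDO D) :=
  if h : IsInvertible C then h.choose else 0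

end PDO

/-! ### The space `V_{λ,μ}` -/

/-- `V[[λ⁻¹, μ⁻¹, ν⁻¹]][λ, μ, ν]`: families of coefficients `X a b c` of `λᵃ μᵇ νᶜ` that vanish
as soon as one of the three exponents is large enough. -/
def ThreeVar (V : Type*) [AddCommGroup V] : AddSubgroup (ℤ → ℤ → ℤ → V) where
  carrier := {X | ∃ N : ℤ, ∀ a b c, (N < a ∨ N < b ∨ N < c) → X a b c = 0}
  zero_mem' := ⟨0, fun _ _ _ _ => rfl⟩
  add_mem' := by
    rintro X Y ⟨N, hN⟩ ⟨M, hM⟩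
    refine ⟨max N M, fun a b c h => ?_⟩
    simp only [max_lt_iff] at h
    simp [hN a b c (by tauto), hM a b c (by tauto)]
  neg_mem' := by
    rintro X ⟨N, hN⟩
    exact ⟨N, fun a b c h => by simp [hN a b c h]⟩

namespace ThreeVar

variable {V : Type*} [AddCommGroup V]

/-- Multiplication by `ν - λ - μ`. -/
def mulRel : ThreeVar V →+ ThreeVar V where
  toFun X := ⟨fun a b c => X.1 a b (c - 1) - X.1 (a - 1) b c - X.1 a (b - 1) c, by
    obtain ⟨N, hN⟩ := X.2
    refine ⟨N + 1, fun a b c h => ?_⟩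
    beta_reduce
    rw [hN a b (c - 1) (by omega), hN (a - 1) b c (by omega), hN a (b - 1) c (by omega)]
    simp⟩
  map_zero' := by
    ext a b c
    simp
  map_add' X Y := by
    ext a b c
    simp
    abel

/-- The coefficient of `λⁱ μʲ` after expanding the powers of `ν = λ + μ` in the domain
`|μ| > |λ|`, as `νᶜ = ∑_{k ≥ 0} (c choose k) λᵏ μᶜ⁻ᵏ`.  The sum has finitely many nonzero terms.
This is the embedding of `V_{λ,μ}` in `V((λ⁻¹))((μ⁻¹))`. -/
noncomputable def expandMuLambda (X : ThreeVar V) (i j : ℤ) : V :=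
  ∑ᶠ q : ℕ × ℤ, (Ring.choose q.2 q.1 : ℤ) • X.1 (i - q.1) (j - q.2 + q.1) q.2

/-- The coefficient of `λⁱ μʲ` after expanding the powers of `ν = λ + μ` in the domain
`|λ| > |μ|`, as `νᶜ = ∑_{k ≥ 0} (c choose k) λᶜ⁻ᵏ μᵏ`.  This is the embedding of `V_{λ,μ}` in
`V((μ⁻¹))((λ⁻¹))`. -/
noncomputable def expandLambdaMu (X : ThreeVar V) (i j : ℤ) : V :=
  ∑ᶠ q : ℕ × ℤ, (Ring.choose q.2 q.1 : ℤ) • X.1 (i - q.2 + q.1) (j - q.1) q.2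

/-- The coefficient of `λⁱ νʲ` after expanding the powers of `μ = -λ + ν` in the domain
`|λ| > |ν|`, as `μᵇ = ∑_{k ≥ 0} (b choose k) (-λ)ᵇ⁻ᵏ νᵏ`.  This is the embedding of `V_{λ,μ}` in
`V((ν⁻¹))((λ⁻¹))`, `ν = λ + μ`. -/
noncomputable def expandLambdaNu (X : ThreeVar V) (i j : ℤ) : V :=
  ∑ᶠ q : ℕ × ℤ, ((Int.negOnePow (q.2 - q.1) : ℤ) * Ring.choose q.2 q.1) •
    X.1 (i - q.2 + q.1) q.2 (j - q.1)

end ThreeVar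

/-- `V_{λ,μ}`: the quotient of `V[[λ⁻¹, μ⁻¹, ν⁻¹]][λ, μ, ν]` by the multiples of `ν - λ - μ`. -/
abbrev TwoVar (V : Type*) [AddCommGroup V] : Type _ :=
  ThreeVar V ⧸ (ThreeVar.mulRel (V := V)).range

/-! ### Algebras of differential functions -/

/-- The structure of an algebra of differential functions in the variables `uᵢ`, `i : ι`, on the
differential algebra `(V, D)` over `F`: an extension of the algebra of differential polynomials
(the `uᵢ⁽ⁿ⁾ = Dⁿ uᵢ` are algebraically independent), with commuting derivations `∂/∂uᵢ⁽ⁿ⁾` that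
extend the usual partial derivatives, only finitely many of which are nonzero on a given element,
and which satisfy `[∂/∂uᵢ⁽ⁿ⁾, D] = ∂/∂uᵢ⁽ⁿ⁻¹⁾` (zero for `n = 0`). -/
structure DiffFunAlg {F V : Type*} [CommRing F] [CommRing V] [Algebra F V] (D : Derivation F V V)
    (ι : Type*) where
  u : ι → V
  algInd : AlgebraicIndependent F fun q : ι × ℕ => (⇑D)^[q.2] (u q.1)
  pd : ι → ℕ → Derivation F V V
  pd_self : ∀ i n, pd i n ((⇑D)^[n] (u i)) = 1
  pd_other : ∀ i n j k, (i, n) ≠ (j, k) → pd i n ((⇑D)^[k] (u j)) = 0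
  pd_pd : ∀ i n j k f, pd i n (pd j k f) = pd j k (pd i n f)
  pd_finite : ∀ f, {q : ι × ℕ | pd q.1 q.2 f ≠ 0}.Finite
  pd_zero_D : ∀ i f, pd i 0 (D f) = D (pd i 0 f)
  pd_succ_D : ∀ i n f, pd i (n + 1) (D f) = D (pd i (n + 1) f) + pd i n f

namespace DiffFunAlg

variable {F V : Type*} [CommRing F] [CommRing V] [Algebra F V] {D : Derivation F V V}
  {ι : Type*} (S : DiffFunAlg D ι)

/-- The Frechet derivative `∑ₙ (∂f/∂uᵢ⁽ⁿ⁾) ∂ⁿ` of `f` in the direction of `uᵢ`. -/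
def frechet (f : V) (i : ι) : PDO D :=
  ⟨fun n => match n with
    | Int.ofNat k => S.pd i k f
    | Int.negSucc _ => 0, by
    obtain ⟨N, hN⟩ := ((S.pd_finite f).image Prod.snd).bddAbove
    refine ⟨N, fun n hn => ?_⟩
    match n, hn with
    | Int.ofNat k, hn =>
      by_contra h
      have := hN ⟨(i, k), h, rfl⟩
      simp at hn this
      omega
    | Int.negSucc _, _ => rfl⟩

/-- The matrix of Frechet derivatives `(D_θ)_{αi} = ∑ₙ (∂θ_α/∂uᵢ⁽ⁿ⁾) ∂ⁿ`. -/
def frechetMatrix {μ : Type*} (θ : μ → V) : Matrix μ ι (PDO D) :=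
  Matrix.of fun α i => S.frechet (θ α) i

section
variable [Fintype ι]

/-- The `λ`-bracket `{f_λ g}_H` of the master formula, as the family of its coefficients of `λⁿ`.
As the symbol of `P ∘ Q` is `P(λ + ∂) Q(λ)`, the sum
`∑ (∂g/∂uⱼ⁽ⁿ⁾) (λ + ∂)ⁿ Hⱼᵢ(λ + ∂) (-λ - ∂)ᵐ (∂f/∂uᵢ⁽ᵐ⁾)` is the symbol of
`∑ᵢⱼ (D_g)ⱼ ∘ Hⱼᵢ ∘ (D_f)ᵢ*`. -/
noncomputable def bracket (H : Matrix ι ι (PDO D)) (f g : V) : PDO D :=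
  ∑ i, ∑ j, S.frechet g j * H j i * (S.frechet f i).adjoint

/-- The Jacobi identity for `a`, `b`, `c`:
`{a_λ {b_μ c}} - {b_μ {a_λ c}} = {{a_λ b}_{λ+μ} c}`.  The three terms are read as elements of
`V_{λ,μ}`, through its embeddings in `V((λ⁻¹))((μ⁻¹))`, `V((μ⁻¹))((λ⁻¹))` and
`V(((λ+μ)⁻¹))((λ⁻¹))`, and the equality holds in `V_{λ,μ}`. -/
def JacobiAt (H : Matrix ι ι (PDO D)) (a b c : V) : Prop :=
  ∃ X Y Z : ThreeVar V,
    (∀ i j, ThreeVar.expandMuLambda X i j = (S.bracket H a ((S.bracket H b c).coeff j)).coeff i) ∧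
    (∀ i j, ThreeVar.expandLambdaMu Y i j = (S.bracket H b ((S.bracket H a c).coeff i)).coeff j) ∧
    (∀ i j, ThreeVar.expandLambdaNu Z i j = (S.bracket H ((S.bracket H a b).coeff i) c).coeff j) ∧
    (X : TwoVar V) - (Y : TwoVar V) = (Z : TwoVar V)

/-- A (non-local) Poisson structure: a skewadjoint rational matrix pseudodifferential operator
that satisfies the Jacobi identity on the generators. -/
structure IsPoisson (H : Matrix ι ι (PDO D)) : Prop where
  skewadjoint : PDO.adjointMatrix H = -H
  rational : PDO.IsRationalMatrix H
  jacobi : ∀ i j k, S.JacobiAt H (S.u i) (S.u j) (S.u k)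

/-- `(H₀, H₁)` is a bi-Poisson structure, that is, `H₀` and `H₁` are compatible Poisson
structures. -/
structure IsBiPoisson (H₀ H₁ : Matrix ι ι (PDO D)) : Prop where
  left : S.IsPoisson H₀
  right : S.IsPoisson H₁
  add : S.IsPoisson (H₀ + H₁)

/-- `θ` is central for `H`: `D_θ ∘ H = 0`. -/
def IsCentral (H : Matrix ι ι (PDO D)) (θ : V) : Prop :=
  S.frechetMatrix (fun _ : Unit => θ) * H = 0

variable {μ : Type*} [Fintype μ] [DecidableEq μ]

/-- The matrix `C = D_θ ∘ H ∘ D_θ*` of the constraints `θ`. -/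
noncomputable def constraintMatrix (H : Matrix ι ι (PDO D)) (θ : μ → V) : Matrix μ μ (PDO D) :=
  S.frechetMatrix θ * H * PDO.adjointMatrix (S.frechetMatrix θ)

/-- The Dirac modification `H - H ∘ D_θ* ∘ C⁻¹ ∘ D_θ ∘ H` of `H` by the constraints `θ`
(meaningful if `C` is invertible). -/
noncomputable def dirac (H : Matrix ι ι (PDO D)) (θ : μ → V) : Matrix ι ι (PDO D) :=
  H - H * PDO.adjointMatrix (S.frechetMatrix θ) * PDO.inverse (S.constraintMatrix H θ) *
    S.frechetMatrix θ * H

end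

/-! ### Constraints of the special form, and the modified partial derivatives -/

variable {κ μ : Type*}

/-- With the variables split by `e` into those indexed by `κ` and those indexed by `μ`:
`θ_α = u_α + p_α`, `α : μ`, where no `p_α` depends on the variables indexed by `μ`. -/
structure SpecialForm (e : κ ⊕ μ ≃ ι) (θ p : μ → V) : Prop where
  eq : ∀ α, θ α = S.u (e (Sum.inr α)) + p α
  indep : ∀ α β n, S.pd (e (Sum.inr β)) n (p α) = 0

/-- The matrix `(D_p)_{αi} = ∑ₙ (∂p_α/∂uᵢ⁽ⁿ⁾) ∂ⁿ`, with `i : κ` only. -/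
def frechetLeft (e : κ ⊕ μ ≃ ι) (p : μ → V) : Matrix μ κ (PDO D) :=
  Matrix.of fun α i => S.frechet (p α) (e (Sum.inl i))

theorem finite_right (e : κ ⊕ μ ≃ ι) (f : V) :
    {q : μ × ℕ | S.pd (e (Sum.inr q.1)) q.2 f ≠ 0}.Finite := by
  have hinj : Function.Injective fun q : μ × ℕ => (e (Sum.inr q.1), q.2) := by
    rintro ⟨α, n⟩ ⟨β, k⟩ h
    simpa using h
  exact (S.pd_finite f).preimage hinj.injOn

theorem finite_support (e : κ ⊕ μ ≃ ι) (g : μ × ℕ → V) (f : V) :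
    (Function.support fun q : μ × ℕ => g q * S.pd (e (Sum.inr q.1)) q.2 f).Finite :=
  (S.finite_right e f).subset fun q hq h => hq (by simp [h])

/-- The modified partial derivative
`∂/∂uᵢ⁽ˢ⁾ - ∑_{α,n} (∂(∂ⁿ p_α)/∂uᵢ⁽ˢ⁾) ∂/∂u_α⁽ⁿ⁾`, for `i : κ`. -/
noncomputable def tildePd (e : κ ⊕ μ ≃ ι) (p : μ → V) (i : κ) (s : ℕ) : Derivation F V V where
  toFun f := S.pd (e (Sum.inl i)) s f -
    ∑ᶠ q : μ × ℕ, S.pd (e (Sum.inl i)) s ((⇑D)^[q.2] (p q.1)) * S.pd (e (Sum.inr q.1)) q.2 f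
  map_add' f g := by
    simp only [map_add, mul_add]
    rw [finsum_add_distrib (S.finite_support e _ f) (S.finite_support e _ g)]
    ring
  map_smul' c f := by
    simp only [Derivation.map_smul, mul_smul_comm, RingHom.id_apply, smul_sub]
    rw [smul_finsum' c (S.finite_support e _ f)]
  map_one_eq_zero' := by simp
  leibniz' f g := by
    change S.pd (e (Sum.inl i)) s (f * g) - _ = f • (_ - _) + g • (_ - _)
    simp only [Derivation.leibniz, smul_eq_mul, mul_sub]
    rw [mul_finsum' _ _ (S.finite_support e _ g), mul_finsum' _ _ (S.finite_support e _ f)]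
    have h : ∀ (x y : V), (Function.support fun q : μ × ℕ =>
        x * (S.pd (e (Sum.inl i)) s ((⇑D)^[q.2] (p q.1)) * S.pd (e (Sum.inr q.1)) q.2 y)).Finite :=
      fun x y => (S.finite_right e y).subset fun q hq h => hq (by simp [h])
    have := finsum_add_distrib (h f g) (h g f)
    rw [show (∑ᶠ q : μ × ℕ, S.pd (e (Sum.inl i)) s ((⇑D)^[q.2] (p q.1)) *
        (f * S.pd (e (Sum.inr q.1)) q.2 g + g * S.pd (e (Sum.inr q.1)) q.2 f)) = _ from
        (finsum_congr fun q => by ring).trans this]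
    ring

theorem tildePd_apply (e : κ ⊕ μ ≃ ι) (p : μ → V) (i : κ) (s : ℕ) (f : V) :
    S.tildePd e p i s f = S.pd (e (Sum.inl i)) s f -
      ∑ᶠ q : μ × ℕ, S.pd (e (Sum.inl i)) s ((⇑D)^[q.2] (p q.1)) *
        S.pd (e (Sum.inr q.1)) q.2 f := rfl

variable {S} {e : κ ⊕ μ ≃ ι} {θ p : μ → V}

theorem SpecialForm.indep_iterate (h : S.SpecialForm e θ p) (α β : μ) (k n : ℕ) :
    S.pd (e (Sum.inr β)) n ((⇑D)^[k] (p α)) = 0 := by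
  induction k generalizing n with
  | zero => exact h.indep α β n
  | succ k ih =>
    rw [Function.iterate_succ_apply']
    cases n with
    | zero => rw [S.pd_zero_D, ih, map_zero]
    | succ n => rw [S.pd_succ_D, ih, ih, map_zero, add_zero]

theorem tildePd_eq_sum (p : μ → V) (i : κ) (s : ℕ) (f : V) (t : Finset (μ × ℕ))
    (ht : ∀ q ∉ t, S.pd (e (Sum.inr q.1)) q.2 f = 0) :
    S.tildePd e p i s f = S.pd (e (Sum.inl i)) s f -
      ∑ q ∈ t, S.pd (e (Sum.inl i)) s ((⇑D)^[q.2] (p q.1)) * S.pd (e (Sum.inr q.1)) q.2 f := by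
  rw [tildePd_apply, finsum_eq_sum_of_support_subset]
  intro q hq
  by_contra h
  exact hq (by simp [ht q (by simpa using h)])

theorem tildePd_u (p : μ → V) (i : κ) (s : ℕ) (j : κ) (k : ℕ) :
    S.tildePd e p i s ((⇑D)^[k] (S.u (e (Sum.inl j)))) =
      S.pd (e (Sum.inl i)) s ((⇑D)^[k] (S.u (e (Sum.inl j)))) := by
  rw [tildePd_eq_sum p i s _ ∅ fun q _ => S.pd_other _ _ _ _ (by simp)]
  simp

theorem SpecialForm.tildePd_comm (h : S.SpecialForm e θ p) (i : κ) (n : ℕ) (j : κ) (k : ℕ)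
    (f : V) : S.tildePd e p i n (S.tildePd e p j k f) =
      S.tildePd e p j k (S.tildePd e p i n f) := by
  set t := (S.finite_right e f).toFinset with htdef
  have ht : ∀ q ∉ t, S.pd (e (Sum.inr q.1)) q.2 f = 0 := by
    intro q hq
    simpa [htdef] using hq
  have hz : ∀ (q r : μ × ℕ) (i : κ) (n : ℕ), S.pd (e (Sum.inr q.1)) q.2
      (S.pd (e (Sum.inl i)) n ((⇑D)^[r.2] (p r.1))) = 0 := by
    intro q r i n
    rw [S.pd_pd, h.indep_iterate, map_zero]
  have hexp : ∀ (q : μ × ℕ) (j : κ) (k : ℕ), S.pd (e (Sum.inr q.1)) q.2 (S.tildePd e p j k f) =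
      S.pd (e (Sum.inl j)) k (S.pd (e (Sum.inr q.1)) q.2 f) -
      ∑ r ∈ t, S.pd (e (Sum.inl j)) k ((⇑D)^[r.2] (p r.1)) *
        S.pd (e (Sum.inr q.1)) q.2 (S.pd (e (Sum.inr r.1)) r.2 f) := by
    intro q j k
    rw [tildePd_eq_sum p j k f t ht, map_sub, map_sum, S.pd_pd]
    simp only [Derivation.leibniz, hz, smul_eq_mul, mul_zero, add_zero]
  have hz' : ∀ (j : κ) (k : ℕ), ∀ q ∉ t,
      S.pd (e (Sum.inr q.1)) q.2 (S.tildePd e p j k f) = 0 := by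
    intro j k q hq
    rw [hexp, ht q hq, map_zero, zero_sub, neg_eq_zero]
    refine Finset.sum_eq_zero fun r _ => ?_
    rw [S.pd_pd, ht q hq, map_zero, mul_zero]
  rw [tildePd_eq_sum p i n _ t (hz' j k), tildePd_eq_sum p j k _ t (hz' i n)]
  simp only [hexp]
  rw [tildePd_eq_sum p j k f t ht, tildePd_eq_sum p i n f t ht]
  simp only [map_sub, map_sum, Derivation.leibniz, smul_eq_mul, mul_sub, Finset.sum_sub_distrib,
    Finset.sum_add_distrib, Finset.mul_sum]
  rw [S.pd_pd (e (Sum.inl i)) n (e (Sum.inl j)) k f]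
  have h1 : ∀ q : μ × ℕ, S.pd (e (Sum.inl i)) n (S.pd (e (Sum.inl j)) k ((⇑D)^[q.2] (p q.1))) =
      S.pd (e (Sum.inl j)) k (S.pd (e (Sum.inl i)) n ((⇑D)^[q.2] (p q.1))) :=
    fun q => S.pd_pd _ _ _ _ _
  simp only [h1]
  rw [Finset.sum_comm (s := t) (t := t) (f := fun x y =>
    S.pd (e (Sum.inl j)) k ((⇑D)^[x.2] (p x.1)) * (S.pd (e (Sum.inl i)) n ((⇑D)^[y.2] (p y.1)) *
      S.pd (e (Sum.inr x.1)) x.2 (S.pd (e (Sum.inr y.1)) y.2 f)))]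
  have h2 : ∀ x y : μ × ℕ,
      S.pd (e (Sum.inl j)) k ((⇑D)^[x.2] (p x.1)) * (S.pd (e (Sum.inl i)) n ((⇑D)^[y.2] (p y.1)) *
        S.pd (e (Sum.inr x.1)) x.2 (S.pd (e (Sum.inr y.1)) y.2 f)) =
      S.pd (e (Sum.inl i)) n ((⇑D)^[y.2] (p y.1)) * (S.pd (e (Sum.inl j)) k ((⇑D)^[x.2] (p x.1)) *
        S.pd (e (Sum.inr y.1)) y.2 (S.pd (e (Sum.inr x.1)) x.2 f)) := by
    intro x y
    rw [S.pd_pd (e (Sum.inr x.1))]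
    ring
  simp only [h2]
  ring

theorem tildePd_finite (p : μ → V) (f : V) :
    {q : κ × ℕ | S.tildePd e p q.1 q.2 f ≠ 0}.Finite := by
  set t := (S.finite_right e f).toFinset with htdef
  have ht : ∀ q ∉ t, S.pd (e (Sum.inr q.1)) q.2 f = 0 := by
    intro q hq
    simpa [htdef] using hq
  have hfin : ∀ g : V, {q : κ × ℕ | S.pd (e (Sum.inl q.1)) q.2 g ≠ 0}.Finite := by
    intro g
    have hinj : Function.Injective fun q : κ × ℕ => (e (Sum.inl q.1), q.2) := by
      rintro ⟨α, n⟩ ⟨β, k⟩ h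
      simpa using h
    exact (S.pd_finite g).preimage hinj.injOn
  refine ((hfin f).union (t.finite_toSet.biUnion
    fun r _ => hfin ((⇑D)^[r.2] (p r.1)))).subset fun q hq => ?_
  by_contra hn
  simp only [Set.mem_union, Set.mem_iUnion, Set.mem_ofPred_eq, not_or, not_exists, not_not] at hn
  apply hq
  rw [tildePd_eq_sum p _ _ f t ht, hn.1, zero_sub, neg_eq_zero]
  refine Finset.sum_eq_zero fun r hr => ?_
  rw [hn.2 r hr, zero_mul]

theorem exists_bound (S : DiffFunAlg D ι) (f : V) : ∃ N : ℕ, ∀ i n, N ≤ n → S.pd i n f = 0 := by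
  obtain ⟨N, hN⟩ := ((S.pd_finite f).image Prod.snd).bddAbove
  refine ⟨N + 1, fun i n hn => ?_⟩
  by_contra h
  have : n ≤ N := hN ⟨(i, n), h, rfl⟩
  omega

theorem tildePd_eq_range [Fintype μ] (p : μ → V) (i : κ) (s : ℕ) (f : V) (N : ℕ)
    (hN : ∀ i n, N ≤ n → S.pd i n f = 0) :
    S.tildePd e p i s f = S.pd (e (Sum.inl i)) s f -
      ∑ α, ∑ n ∈ Finset.range N, S.pd (e (Sum.inl i)) s ((⇑D)^[n] (p α)) *
        S.pd (e (Sum.inr α)) n f := by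
  rw [tildePd_eq_sum p i s f (Finset.univ ×ˢ Finset.range N), Finset.sum_product]
  intro q hq
  exact hN _ _ (by simpa using hq)

theorem sum_pd_D [Fintype μ] (S : DiffFunAlg D ι) (e : κ ⊕ μ ≃ ι) (g : μ → ℕ → V) (f : V) (N : ℕ)
    (hN : ∀ i n, N ≤ n → S.pd i n f = 0) :
    ∑ α, ∑ n ∈ Finset.range (N + 1), g α n * S.pd (e (Sum.inr α)) n (D f) =
      ∑ α, ∑ n ∈ Finset.range N, (g α n * D (S.pd (e (Sum.inr α)) n f) +
        g α (n + 1) * S.pd (e (Sum.inr α)) n f) := by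
  refine Finset.sum_congr rfl fun α _ => ?_
  rw [Finset.sum_range_succ', Finset.sum_add_distrib, S.pd_zero_D]
  simp only [S.pd_succ_D, mul_add, Finset.sum_add_distrib]
  have h : ∑ n ∈ Finset.range (N + 1), g α n * D (S.pd (e (Sum.inr α)) n f) =
      ∑ n ∈ Finset.range N, g α n * D (S.pd (e (Sum.inr α)) n f) := by
    rw [Finset.sum_range_succ, hN _ _ le_rfl, map_zero, mul_zero, add_zero]
  rw [← h, Finset.sum_range_succ' (fun n => g α n * D (S.pd (e (Sum.inr α)) n f))]
  ring

theorem bound_D (S : DiffFunAlg D ι) {f : V} {N : ℕ} (hN : ∀ i n, N ≤ n → S.pd i n f = 0)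
    (i : ι) (n : ℕ) (hn : N + 1 ≤ n) : S.pd i n (D f) = 0 := by
  obtain ⟨k, rfl⟩ : ∃ k, n = k + 1 := ⟨n - 1, by omega⟩
  rw [S.pd_succ_D, hN _ _ (by omega), hN _ _ (by omega), map_zero, add_zero]

theorem tildePd_zero_D [Fintype μ] (p : μ → V) (i : κ) (f : V) :
    S.tildePd e p i 0 (D f) = D (S.tildePd e p i 0 f) := by
  obtain ⟨N, hN⟩ := S.exists_bound f
  rw [tildePd_eq_range p i 0 f N hN, tildePd_eq_range p i 0 (D f) (N + 1) (S.bound_D hN),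
    sum_pd_D S e (fun α n => S.pd (e (Sum.inl i)) 0 ((⇑D)^[n] (p α))) f N hN, S.pd_zero_D]
  simp only [map_sub, map_sum, Derivation.leibniz, smul_eq_mul, Function.iterate_succ_apply',
    S.pd_zero_D, mul_comm]

theorem tildePd_succ_D [Fintype μ] (p : μ → V) (i : κ) (s : ℕ) (f : V) :
    S.tildePd e p i (s + 1) (D f) = D (S.tildePd e p i (s + 1) f) + S.tildePd e p i s f := by
  obtain ⟨N, hN⟩ := S.exists_bound f
  rw [tildePd_eq_range p i _ f N hN, tildePd_eq_range p i _ f N hN,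
    tildePd_eq_range p i _ (D f) (N + 1) (S.bound_D hN),
    sum_pd_D S e (fun α n => S.pd (e (Sum.inl i)) (s + 1) ((⇑D)^[n] (p α))) f N hN, S.pd_succ_D]
  simp only [map_sub, map_sum, Derivation.leibniz, smul_eq_mul, Function.iterate_succ_apply',
    S.pd_succ_D, Finset.sum_add_distrib, add_mul]
  simp only [mul_comm]
  ring

/-- The algebra of differential functions `Ṽ` in the variables indexed by `κ`: the differential
algebra `V` with the modified partial derivatives. -/
noncomputable def tilde [Fintype μ] (S : DiffFunAlg D ι) (e : κ ⊕ μ ≃ ι) (θ p : μ → V)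
    (h : S.SpecialForm e θ p) : DiffFunAlg D κ where
  u i := S.u (e (Sum.inl i))
  algInd := S.algInd.comp (fun q : κ × ℕ => (e (Sum.inl q.1), q.2)) (by
    rintro ⟨α, n⟩ ⟨β, k⟩ h
    simpa using h)
  pd := S.tildePd e p
  pd_self i n := by rw [tildePd_u, S.pd_self]
  pd_other i n j k hne := by
    rw [tildePd_u, S.pd_other]
    simpa using hne
  pd_pd := h.tildePd_comm
  pd_finite := tildePd_finite p
  pd_zero_D := tildePd_zero_D p
  pd_succ_D := tildePd_succ_D p

theorem SpecialForm.tildePd_theta [Fintype μ] (h : S.SpecialForm e θ p) (i : κ) (s : ℕ) (α : μ)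
    (k : ℕ) : S.tildePd e p i s ((⇑D)^[k] (θ α)) = 0 := by
  classical
  induction k generalizing s with
  | zero =>
    have h1 : ∀ (β : μ) (n : ℕ), S.pd (e (Sum.inr β)) n (θ α) =
        if (β, n) = (α, 0) then 1 else 0 := by
      intro β n
      rw [h.eq, map_add, h.indep, add_zero]
      split_ifs with hq
      · obtain ⟨rfl, rfl⟩ := Prod.mk.inj hq
        exact S.pd_self _ 0
      · exact S.pd_other _ n _ 0 (by simpa using hq)
    have h2 : S.pd (e (Sum.inl i)) s (θ α) = S.pd (e (Sum.inl i)) s (p α) := by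
      have h3 : S.pd (e (Sum.inl i)) s (S.u (e (Sum.inr α))) = 0 :=
        S.pd_other (e (Sum.inl i)) s (e (Sum.inr α)) 0 (by simp)
      rw [h.eq, map_add, h3, zero_add]
    rw [Function.iterate_zero_apply, tildePd_eq_sum p i s (θ α) {(α, 0)}
      (fun q hq => by rw [h1, if_neg (by simpa using hq)])]
    simp [h1, h2]
  | succ k ih =>
    rw [Function.iterate_succ_apply']
    cases s with
    | zero => rw [tildePd_zero_D, ih, map_zero]
    | succ s => rw [tildePd_succ_D, ih, ih, map_zero, add_zero]

end DiffFunAlg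

/-! ### The quotient by the differential ideal of the constraints -/

section Quotient

variable {F V : Type*} [CommRing F] [CommRing V] [Algebra F V] (D : Derivation F V V)
  {μ : Type*} (θ : μ → V)

/-- The differential ideal generated by the `θ_α`, that is, the ideal generated by all `Dⁿ θ_α`. -/
def diffIdeal : Ideal V := Ideal.span (Set.range fun q : μ × ℕ => (⇑D)^[q.2] (θ q.1))

variable {D θ} in
theorem map_mem_diffIdeal (d : Derivation F V V)
    (hd : ∀ α n, d ((⇑D)^[n] (θ α)) ∈ diffIdeal D θ) {f : V} (hf : f ∈ diffIdeal D θ) :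
    d f ∈ diffIdeal D θ := by
  induction hf using Submodule.span_induction with
  | mem x hx =>
    obtain ⟨q, rfl⟩ := hx
    exact hd q.1 q.2
  | zero => simp
  | add x y _ _ hx hy => simpa using add_mem hx hy
  | smul a x hx h =>
    rw [smul_eq_mul, Derivation.leibniz]
    exact add_mem (Ideal.mul_mem_left _ _ h) (Ideal.mul_mem_right _ _ hx)

theorem D_mem_diffIdeal {f : V} (hf : f ∈ diffIdeal D θ) : D f ∈ diffIdeal D θ := by
  refine map_mem_diffIdeal D (fun α n => Ideal.subset_span ⟨(α, n + 1), ?_⟩) hf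
  exact Function.iterate_succ_apply' _ _ _

variable {D θ} in
/-- The derivation of the quotient algebra induced by a derivation that preserves the ideal. -/
noncomputable def quotDerivation (d : Derivation F V V)
    (hd : ∀ f ∈ diffIdeal D θ, d f ∈ diffIdeal D θ) :
    Derivation F (V ⧸ diffIdeal D θ) (V ⧸ diffIdeal D θ) :=
  Derivation.liftOfSurjective (f := Ideal.Quotient.mkₐ F (diffIdeal D θ))
    (Ideal.Quotient.mkₐ_surjective F _) (d := d) (by
      intro x hx
      exact Ideal.Quotient.eq_zero_iff_mem.2 (hd x (Ideal.Quotient.eq_zero_iff_mem.1 hx)))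

variable {D θ} in
theorem quotDerivation_mk (d : Derivation F V V)
    (hd : ∀ f ∈ diffIdeal D θ, d f ∈ diffIdeal D θ) (f : V) :
    quotDerivation d hd (Ideal.Quotient.mk _ f) = Ideal.Quotient.mk _ (d f) :=
  Derivation.liftOfSurjective_apply (f := Ideal.Quotient.mkₐ F (diffIdeal D θ))
    (Ideal.Quotient.mkₐ_surjective F _) (d := d) (fun x hx =>
      Ideal.Quotient.eq_zero_iff_mem.2 (hd x (Ideal.Quotient.eq_zero_iff_mem.1 hx))) f

/-- The derivation of the quotient differential algebra. -/
noncomputable def quotD : Derivation F (V ⧸ diffIdeal D θ) (V ⧸ diffIdeal D θ) :=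
  quotDerivation D fun _ => D_mem_diffIdeal D θ

theorem quotD_iterate_mk (n : ℕ) (f : V) :
    (⇑(quotD D θ))^[n] (Ideal.Quotient.mk _ f) = Ideal.Quotient.mk _ ((⇑D)^[n] f) := by
  induction n with
  | zero => rfl
  | succ n ih => rw [Function.iterate_succ_apply', ih, Function.iterate_succ_apply', quotD,
      quotDerivation_mk]

variable {D} in
/-- The pseudodifferential operator over the quotient obtained by taking the cosets of all
coefficients. -/
noncomputable def PDO.reduce (a : PDO D) : PDO (quotD D θ) :=
  ⟨fun n => Ideal.Quotient.mk _ (a.coeff n), by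
    obtain ⟨N, hN⟩ := a.2
    refine ⟨N, fun n hn => ?_⟩
    have : a.coeff n = 0 := hN n hn
    simp [this]⟩

end Quotient

namespace DiffFunAlg

variable {F V : Type*} [CommRing F] [CommRing V] [Algebra F V] {D : Derivation F V V}
  {ι κ μ : Type*} (S : DiffFunAlg D ι) (e : κ ⊕ μ ≃ ι)

/-- The algebra of differential polynomials in the variables indexed by `κ`, inside `V`. -/
def leftPolynomials : Subalgebra F V :=
  Algebra.adjoin F (Set.range fun q : κ × ℕ => (⇑D)^[q.2] (S.u (e (Sum.inl q.1))))

/-- The algebra of differential functions on the quotient of `V` by the differential ideal of the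
constraints, in the variables indexed by `κ`, with the partial derivatives induced by the modified
ones, if the ideal contains no nonzero differential polynomial in these variables. -/
noncomputable def quotient [Fintype μ] (θ p : μ → V) (h : S.SpecialForm e θ p)
    (hI : ∀ f ∈ diffIdeal D θ, f ∈ S.leftPolynomials e → f = 0) :
    DiffFunAlg (quotD D θ) κ where
  u i := Ideal.Quotient.mk _ (S.u (e (Sum.inl i)))
  algInd := by
    rw [algebraicIndependent_iff]
    intro P hP
    simp only [quotD_iterate_mk] at hP
    have h1 : MvPolynomial.aeval (fun q : κ × ℕ => Ideal.Quotient.mk (diffIdeal D θ)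
        ((⇑D)^[q.2] (S.u (e (Sum.inl q.1))))) P = Ideal.Quotient.mkₐ F (diffIdeal D θ)
        (MvPolynomial.aeval (fun q : κ × ℕ => (⇑D)^[q.2] (S.u (e (Sum.inl q.1)))) P) := by
      rw [← AlgHom.comp_apply, MvPolynomial.comp_aeval]
      rfl
    rw [h1] at hP
    refine (algebraicIndependent_iff.1 (S.tilde e θ p h).algInd) P ?_
    refine hI _ (Ideal.Quotient.eq_zero_iff_mem.1 hP) ?_
    rw [leftPolynomials, Algebra.adjoin_range_eq_range_aeval]
    exact ⟨P, rfl⟩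
  pd i n := quotDerivation (S.tildePd e p i n) fun f hf => map_mem_diffIdeal _
    (fun α k => by rw [h.tildePd_theta]; exact zero_mem _) hf
  pd_self i n := by
    rw [quotD_iterate_mk, quotDerivation_mk]
    exact congrArg _ ((S.tilde e θ p h).pd_self i n)
  pd_other i n j k hne := by
    rw [quotD_iterate_mk, quotDerivation_mk]
    exact (congrArg _ ((S.tilde e θ p h).pd_other i n j k hne)).trans (map_zero _)
  pd_pd i n j k f := by
    obtain ⟨f, rfl⟩ := Ideal.Quotient.mk_surjective f
    simp only [quotDerivation_mk]
    exact congrArg _ ((S.tilde e θ p h).pd_pd i n j k f)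
  pd_finite f := by
    obtain ⟨f, rfl⟩ := Ideal.Quotient.mk_surjective f
    refine ((S.tilde e θ p h).pd_finite f).subset fun q hq h0 => hq ?_
    rw [quotDerivation_mk]
    exact (congrArg _ h0).trans (map_zero _)
  pd_zero_D i f := by
    obtain ⟨f, rfl⟩ := Ideal.Quotient.mk_surjective f
    simp only [quotDerivation_mk, quotD]
    exact congrArg _ ((S.tilde e θ p h).pd_zero_D i f)
  pd_succ_D i n f := by
    obtain ⟨f, rfl⟩ := Ideal.Quotient.mk_surjective f
    simp only [quotDerivation_mk, quotD, ← map_add]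
    exact congrArg _ ((S.tilde e θ p h).pd_succ_D i n f)

end DiffFunAlg

/-- The matrix `A^D = A + (B + A ∘ D_p*) ∘ C⁻¹ ∘ (B* - D_p ∘ A)`. -/
noncomputable def diracBlock {F V : Type*} [CommRing F] [CommRing V] [Algebra F V]
    {D : Derivation F V V} {κ μ : Type*} [Fintype κ] [Fintype μ] [DecidableEq μ]
    (A : Matrix κ κ (PDO D)) (B : Matrix κ μ (PDO D)) (C : Matrix μ μ (PDO D))
    (Dp : Matrix μ κ (PDO D)) : Matrix κ κ (PDO D) :=
  A + (B + A * PDO.adjointMatrix Dp) * PDO.inverse C * (PDO.adjointMatrix B - Dp * A)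

/-- The splitting of `ℓ` variables into the first `ℓ - m` and the last `m`. -/
def splitLast {ℓ m : ℕ} (h : m ≤ ℓ) : Fin (ℓ - m) ⊕ Fin m ≃ Fin ℓ :=
  finSumFinEquiv.trans (finCongr (Nat.sub_add_cancel h))

/-! Centrality gives `D_θ ∘ H₀ = 0`, and taking adjoints `H₀ ∘ D_θ* = 0`. Every occurrence of `H₀`
in the Dirac correction of `H₀ + H₁` stands next to `D_θ` or `D_θ*`, so the constraint matrix is
that of `H₁` and the modification is `H₀` plus that of `H₁`. Part (a) thus reduces to one theorem,
`IsPoisson.dirac`, used for `H₁` and for `H₀ + H₁`: the Dirac modification of a Poisson structure is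
Poisson. Skewadjointness is formal, and rationality holds because the inverse of a rational matrix
is rational (`IsRationalMatrix.of_mul_eq_one`, by counting coefficients of differential operators).

The Jacobi identity is the main point. Its terms live in three different expansions of `V_{λ,μ}`, so
it is recast as membership of a triple of series in the subgroup `good` (`jacobiAt_iff`). These
series form bimodules over the pseudodifferential operators. The expansions intertwine left
composition with `P(ν + ∂)` and right compositions with `Q(λ)` and `Q(μ)` with operations on
triples, so `good` is stable under these operations.

With `T = D_θ`, `T' = D_θ*`, `X = C⁻¹`, the matrix `K = H - H T' X T H` is differentiated as in any
ring, with `δX = -X (δC) X`. The result is `P' (δH) P - K (δT') X T H - H T' X (δT) K`, where `P = 1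
- T' X T H` and `P' = 1 - H T' X T`. Accordingly the Jacobi triple of `K` is a combination of
transformed Jacobi triples of `H` and of triples built from second derivatives of the `θ_α`. The
latter are good because partial derivatives commute (`mem_good_one`, `mem_good_two`,
`mem_good_three`); this gives `jacobiTriple_dirac_mem`.

For (b), `D_θ` annihilates both `H₀` and the modification of `H₁`. Since `D_θ` has blocks `D_p` and
`1`, a skewadjoint `K` with `D_θ ∘ K = 0` is determined by its first block `A`. The modified Frechet
derivatives are `D_f` composed with the column `(1, -D_p)`, so `A` and `K` define the same bracket
on `V` (`SpecialForm.bracket_tilde`), and the Jacobi identity carries over.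

For (c), the modified partial derivatives kill all `∂ᵏ θ_α`, so taking cosets commutes with brackets
and expansions, and the witnesses of the Jacobi identity can be reduced coefficientwise. -/

/-! ### Binomial coefficients with integer arguments -/

/-- The binomial coefficient `n choose k` for integers `n` and `k`, zero for negative `k`. -/
def intChoose (n k : ℤ) : ℤ := if 0 ≤ k then Ring.choose n k.toNat else 0

theorem intChoose_natCast (n : ℤ) (k : ℕ) : intChoose n k = Ring.choose n k := by
  simp [intChoose]

theorem intChoose_of_neg (n : ℤ) {k : ℤ} (hk : k < 0) : intChoose n k = 0 := by
  simp [intChoose, hk]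

theorem intChoose_zero (n : ℤ) : intChoose n 0 = 1 := by
  simp [intChoose]

theorem intChoose_zero_left (k : ℤ) : intChoose 0 k = if k = 0 then 1 else 0 := by
  rcases lt_or_ge k 0 with h | h
  · rw [intChoose_of_neg _ h, if_neg h.ne]
  · lift k to ℕ using h
    rw [intChoose_natCast, Ring.choose_zero_ite]
    simp

theorem intChoose_succ (n k : ℤ) :
    intChoose (n + 1) k = intChoose n (k - 1) + intChoose n k := by
  rcases lt_or_ge k 0 with h | h
  · rw [intChoose_of_neg _ h, intChoose_of_neg _ h, intChoose_of_neg _ (by omega), add_zero]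
  · lift k to ℕ using h
    cases k with
    | zero => simp [intChoose_zero, intChoose_of_neg]
    | succ k =>
      rw [show ((k + 1 : ℕ) : ℤ) - 1 = (k : ℕ) by push_cast; ring]
      simp only [intChoose_natCast]
      exact Ring.choose_succ_succ n k

/-- Trinomial revision. When `k ≥ 0` and `l < 0` the right side vanishes too, because `k + l` is
either negative or a natural number below `k`. -/
theorem intChoose_mul (n k l : ℤ) :
    intChoose n k * intChoose (n - k) l = intChoose n (k + l) * intChoose (k + l) k := by
  rcases lt_or_ge k 0 with h | h
  · simp [intChoose_of_neg _ h]
  lift k to ℕ using h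
  rcases lt_or_ge l 0 with h | h
  · rw [intChoose_of_neg _ h, mul_zero]
    rcases lt_or_ge ((k : ℤ) + l) 0 with h' | h'
    · rw [intChoose_of_neg _ h', zero_mul]
    · obtain ⟨j, hj⟩ := Int.eq_ofNat_of_zero_le h'
      rw [hj, intChoose_natCast (j : ℤ) k, Ring.choose_natCast, Nat.choose_eq_zero_of_lt (by omega)]
      simp
  · lift l to ℕ using h
    have h1 := Ring.choose_smul_choose n (Nat.le_add_right k l)
    rw [← Nat.cast_add]
    simp only [intChoose_natCast, Ring.choose_natCast]
    rw [Nat.add_sub_cancel_left, nsmul_eq_mul] at h1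
    rw [← h1]
    ring

theorem sum_intChoose_mul (a b : ℤ) (m : ℕ) :
    ∑ x ∈ Finset.HasAntidiagonal.antidiagonal m, intChoose a x.1 * intChoose b x.2 =
      intChoose (a + b) m := by
  simp only [intChoose_natCast]
  exact (Ring.add_choose_eq m (Commute.all a b)).symm

/-- The integer sign `(-1)ⁿ`. -/
theorem negOnePow_succ_coe (n : ℤ) :
    ((Int.negOnePow (n + 1) : ℤˣ) : ℤ) = -((Int.negOnePow n : ℤˣ) : ℤ) := by
  rw [Int.negOnePow_succ]
  simp

theorem finsum_eq_sum_antidiagonal {E : Type*} [AddCommMonoid E] (f : ℕ → E) (t : ℕ)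
    (h : ∀ k, t < k → f k = 0) :
    ∑ᶠ k, f k = ∑ x ∈ Finset.HasAntidiagonal.antidiagonal t, f x.1 := by
  rw [finsum_eq_sum_of_support_subset (s := Finset.range (t + 1)),
    Finset.Nat.sum_antidiagonal_eq_sum_range_succ_mk]
  intro k hk
  simp only [Finset.coe_range, Set.mem_Iio]
  by_contra hn
  exact hk (h k (by omega))

/-- Both sides run over the triples of natural numbers with sum `t`. -/
theorem sum_antidiagonal_antidiagonal {E : Type*} [AddCommMonoid E] (t : ℕ) (f : ℕ → ℕ → ℕ → E) :
    ∑ x ∈ Finset.HasAntidiagonal.antidiagonal t,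
        ∑ y ∈ Finset.HasAntidiagonal.antidiagonal x.1, f y.1 y.2 x.2 =
      ∑ x ∈ Finset.HasAntidiagonal.antidiagonal t,
        ∑ y ∈ Finset.HasAntidiagonal.antidiagonal x.2, f x.1 y.1 y.2 := by
  rw [Finset.sum_sigma', Finset.sum_sigma']
  refine Finset.sum_nbij' (fun q => ⟨(q.2.1, q.2.2 + q.1.2), (q.2.2, q.1.2)⟩)
    (fun q => ⟨(q.1.1 + q.2.1, q.2.2), (q.1.1, q.2.1)⟩) ?_ ?_ ?_ ?_ ?_
  · rintro ⟨⟨a, b⟩, c, d⟩ h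
    simp at h ⊢
    omega
  · rintro ⟨⟨a, b⟩, c, d⟩ h
    simp at h ⊢
    omega
  · rintro ⟨⟨a, b⟩, c, d⟩ h
    simp at h ⊢
    omega
  · rintro ⟨⟨a, b⟩, c, d⟩ h
    simp at h ⊢
    omega
  · rintro ⟨⟨a, b⟩, c, d⟩ h
    rfl

/-! ### Families of coefficients -/

namespace boundedAbove

variable {A B C E : Type*} [AddCommGroup A] [AddCommGroup B] [AddCommGroup C] [AddCommGroup E]

@[ext]
theorem ext {a b : boundedAbove A} (h : ∀ n, a.1 n = b.1 n) : a = b := Subtype.ext (funext h)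

@[simp] theorem add_apply (a b : boundedAbove A) (n : ℤ) : (a + b).1 n = a.1 n + b.1 n := rfl
@[simp] theorem sub_apply (a b : boundedAbove A) (n : ℤ) : (a - b).1 n = a.1 n - b.1 n := rfl
@[simp] theorem neg_apply (a : boundedAbove A) (n : ℤ) : (-a).1 n = -a.1 n := rfl
@[simp] theorem zero_apply (n : ℤ) : (0 : boundedAbove A).1 n = 0 := rfl

/-- The coefficient of degree `n` as an additive map. -/
def coeffHom (n : ℤ) : boundedAbove A →+ A where
  toFun a := a.1 n
  map_zero' := rfl
  map_add' _ _ := rfl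

@[simp] theorem coeffHom_apply (n : ℤ) (a : boundedAbove A) : coeffHom n a = a.1 n := rfl

@[simp] theorem sum_apply {κ : Type*} (s : Finset κ) (f : κ → boundedAbove A) (n : ℤ) :
    (∑ i ∈ s, f i).1 n = ∑ i ∈ s, (f i).1 n := map_sum (coeffHom n) f s

/-- The coefficients of `a` in degrees above `N` vanish. -/
def DegLE (a : boundedAbove A) (N : ℤ) : Prop := ∀ n, N < n → a.1 n = 0

theorem exists_degLE (a : boundedAbove A) : ∃ N, DegLE a N := a.2

theorem DegLE.mono {a : boundedAbove A} {N M : ℤ} (h : DegLE a N) (hNM : N ≤ M) : DegLE a M :=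
  fun n hn => h n (by omega)

/-- The family with the coefficient `a` in degree `n` and zero elsewhere. -/
def single (n : ℤ) : A →+ boundedAbove A where
  toFun a := ⟨Pi.single n a, n, fun k hk => by simp [hk.ne']⟩
  map_zero' := by ext; simp
  map_add' a b := by ext k; simp [Pi.single_add]

theorem single_apply (n : ℤ) (a : A) (k : ℤ) : (single n a).1 k = if k = n then a else 0 := by
  change (Pi.single n a : ℤ → A) k = _
  rw [Pi.single_apply]

theorem single_self (n : ℤ) (a : A) : (single n a).1 n = a := by simp [single_apply]

theorem single_of_ne {n k : ℤ} (h : k ≠ n) (a : A) : (single n a).1 k = 0 := by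
  simp [single_apply, h]

theorem degLE_single (n : ℤ) (a : A) : DegLE (single n a) n :=
  fun _ hk => single_of_ne hk.ne' a

/-- Additive maps that vanish in low degrees are determined by their values on monomials. -/
theorem hom_ext {f g : boundedAbove A →+ E} (hf : ∃ K, ∀ a, DegLE a K → f a = 0)
    (hg : ∃ K, ∀ a, DegLE a K → g a = 0) (h : ∀ n a, f (single n a) = g (single n a)) :
    f = g := by
  obtain ⟨K, hK⟩ := hf
  obtain ⟨K', hK'⟩ := hg
  ext a
  obtain ⟨N, hN⟩ := exists_degLE a
  -- Above `N` the coefficients of `a` vanish, and what is left in degrees at most `min K K'` is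
  -- killed by both maps; so these finitely many degrees are the only ones that count.
  set s := Finset.Ioc (min K K') N
  have hrest : DegLE (a - ∑ n ∈ s, single n (a.1 n)) (min K K') := by
    intro n hn
    rw [sub_apply, sum_apply]
    by_cases hns : n ∈ s
    · rw [Finset.sum_eq_single_of_mem n hns fun m _ hm => single_of_ne hm.symm _, single_self,
        sub_self]
    · rw [hN n (by simp [s] at hns; omega), Finset.sum_eq_zero, sub_zero]
      intro m hm
      exact single_of_ne (by rintro rfl; exact hns hm) _
  have h1 := hK _ (hrest.mono (min_le_left _ _))
  have h2 := hK' _ (hrest.mono (min_le_right _ _))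
  rw [map_sub, sub_eq_zero, map_sum] at h1 h2
  rw [h1, h2]
  exact Finset.sum_congr rfl fun n _ => h n _

/-- The additive map induced on families of coefficients. -/
def map (f : A →+ B) : boundedAbove A →+ boundedAbove B where
  toFun a := ⟨fun n => f (a.1 n), by
    obtain ⟨N, hN⟩ := a.2
    exact ⟨N, fun n hn => by simp [hN n hn]⟩⟩
  map_zero' := by ext n; simp
  map_add' a b := by ext n; simp

@[simp] theorem map_apply (f : A →+ B) (a : boundedAbove A) (n : ℤ) :
    (map f a).1 n = f (a.1 n) := rfl

theorem map_single (f : A →+ B) (n : ℤ) (a : A) : map f (single n a) = single n (f a) := by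
  ext k
  rw [map_apply, single_apply, single_apply]
  split_ifs <;> simp

section star

variable (β : A →+ B →+ C) (d : AddMonoid.End B)

theorem star_support (a : boundedAbove A) (b : boundedAbove B) (n : ℤ) :
    (Function.support fun q : ℤ × ℕ =>
      (Ring.choose q.1 q.2 : ℤ) • β (a.1 q.1) ((⇑d)^[q.2] (b.1 (n - q.1 + q.2)))).Finite := by
  obtain ⟨N, hN⟩ := a.2
  obtain ⟨M, hM⟩ := b.2
  -- A nonzero term needs `q ≤ N` and `n - q + k ≤ M` with `k ≥ 0`, which bounds `q` below by `n -
  -- M` and `k` above by `N + M - n`.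
  refine ((Finset.Icc (n - M) N) ×ˢ (Finset.range (N + M - n + 1).toNat)).finite_toSet.subset ?_
  rintro ⟨q, k⟩ hq
  have h1 : q ≤ N := by
    by_contra h
    exact hq (by simp [hN q (by omega)])
  have h2 : n - q + k ≤ M := by
    by_contra h
    exact hq (by simp [hM (n - q + k) (by omega), iterate_map_zero])
  simp only [Finset.coe_product, Set.mem_prod, Finset.coe_Icc, Set.mem_Icc, Finset.coe_range,
    Set.mem_Iio]
  omega

theorem star_eq_zero {a : boundedAbove A} {b : boundedAbove B} {N M : ℤ} (ha : DegLE a N)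
    (hb : DegLE b M) (n : ℤ) (hn : N + M < n) :
    ∑ᶠ q : ℤ × ℕ, (Ring.choose q.1 q.2 : ℤ) •
      β (a.1 q.1) ((⇑d)^[q.2] (b.1 (n - q.1 + q.2))) = 0 := by
  refine (finsum_congr fun q => ?_).trans finsum_zero
  rcases lt_or_ge N q.1 with h | h
  · simp [ha _ h]
  · simp [hb (n - q.1 + q.2) (by omega), iterate_map_zero]

/-- The composition `(∑ a_q ∂^q) ⋆ (∑ b_r ∂^r) = ∑ (q choose k) β(a_q, dᵏ b_r) ∂^{q+r-k}`
of families of coefficients along a biadditive map `β` and an endomorphism `d`. -/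
noncomputable def star : boundedAbove A →+ boundedAbove B →+ boundedAbove C where
  toFun a :=
    { toFun := fun b => ⟨fun n => ∑ᶠ q : ℤ × ℕ, (Ring.choose q.1 q.2 : ℤ) •
        β (a.1 q.1) ((⇑d)^[q.2] (b.1 (n - q.1 + q.2))), by
          obtain ⟨N, hN⟩ := a.2
          obtain ⟨M, hM⟩ := b.2
          exact ⟨N + M, fun n hn => star_eq_zero β d hN hM n hn⟩⟩
      map_zero' := by
        ext n
        simp [iterate_map_zero]
      map_add' := fun b c => by
        ext n
        rw [add_apply]
        dsimp only
        rw [← finsum_add_distrib (star_support β d a b n) (star_support β d a c n)]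
        simp [iterate_map_add] }
  map_zero' := by
    ext b n
    simp
  map_add' a b := by
    ext c n
    rw [AddMonoidHom.add_apply, add_apply]
    simp only [AddMonoidHom.coe_mk, ZeroHom.coe_mk]
    rw [← finsum_add_distrib (star_support β d a c n) (star_support β d b c n)]
    simp

theorem star_apply (a : boundedAbove A) (b : boundedAbove B) (n : ℤ) :
    (star β d a b).1 n = ∑ᶠ q : ℤ × ℕ, (Ring.choose q.1 q.2 : ℤ) •
      β (a.1 q.1) ((⇑d)^[q.2] (b.1 (n - q.1 + q.2))) := rfl

variable {β d} in
theorem DegLE.star {a : boundedAbove A} {b : boundedAbove B} {N M : ℤ} (ha : DegLE a N)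
    (hb : DegLE b M) : DegLE (star β d a b) (N + M) :=
  fun n hn => star_eq_zero β d ha hb n hn

theorem star_single_left (p : ℤ) (a : A) (b : boundedAbove B) (n : ℤ) :
    (star β d (single p a) b).1 n =
      ∑ᶠ k : ℕ, (Ring.choose p k : ℤ) • β a ((⇑d)^[k] (b.1 (n - p + k))) := by
  rw [star_apply, finsum_curry _ (star_support β d _ b n), finsum_eq_single _ p]
  · simp [single_self]
  · intro q hq
    simp [single_of_ne hq]

/-- The involution `q ↦ n - q + k` trades the degree of the left factor for that of the right one,
the form suited to a monomial on the right. -/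
theorem star_apply' (a : boundedAbove A) (b : boundedAbove B) (n : ℤ) :
    (star β d a b).1 n = ∑ᶠ q : ℤ × ℕ, (Ring.choose (n - q.1 + q.2) q.2 : ℤ) •
      β (a.1 (n - q.1 + q.2)) ((⇑d)^[q.2] (b.1 q.1)) := by
  rw [star_apply]
  refine finsum_eq_of_bijective (fun q : ℤ × ℕ => (n - q.1 + q.2, q.2))
    (Function.Involutive.bijective ?_) ?_
  · rintro ⟨q, k⟩
    rw [Prod.mk.injEq]
    exact ⟨by ring, rfl⟩
  · rintro ⟨q, k⟩
    dsimp only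
    rw [show n - (n - q + k) + k = q by ring]

theorem star_support' (a : boundedAbove A) (b : boundedAbove B) (n : ℤ) :
    (Function.support fun q : ℤ × ℕ => (Ring.choose (n - q.1 + q.2) q.2 : ℤ) •
      β (a.1 (n - q.1 + q.2)) ((⇑d)^[q.2] (b.1 q.1))).Finite := by
  refine ((star_support β d a b n).image fun q : ℤ × ℕ => (n - q.1 + q.2, q.2)).subset ?_
  rintro ⟨q, k⟩ hq
  refine ⟨(n - q + k, k), ?_, by rw [Prod.mk.injEq]; exact ⟨by ring, rfl⟩⟩
  rw [Function.mem_support] at hq ⊢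
  dsimp only
  rwa [show n - (n - q + k) + k = q by ring]

theorem star_single_right (a : boundedAbove A) (r : ℤ) (b : B) (n : ℤ) :
    (star β d a (single r b)).1 n = ∑ᶠ k : ℕ, (Ring.choose (n - r + k) k : ℤ) •
      β (a.1 (n - r + k)) ((⇑d)^[k] b) := by
  rw [star_apply', finsum_curry _ (star_support' β d a _ n), finsum_eq_single _ r]
  · simp [single_self]
  · intro q hq
    simp [single_of_ne hq, iterate_map_zero]

/-- Only the term with `p + r - n` differentiations survives. If this number is negative,
`intChoose` vanishes and the default value of `toNat` does no harm. -/
theorem star_single_single (p : ℤ) (a : A) (r : ℤ) (b : B) (n : ℤ) :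
    (star β d (single p a) (single r b)).1 n =
      intChoose p (p + r - n) • β a ((⇑d)^[(p + r - n).toNat] b) := by
  rw [star_single_left]
  rcases lt_or_ge (p + r - n) 0 with h | h
  · rw [intChoose_of_neg _ h, zero_smul]
    refine (finsum_congr fun k => ?_).trans finsum_zero
    rw [single_of_ne (by omega), iterate_map_zero, map_zero, smul_zero]
  · obtain ⟨k, hk⟩ := Int.eq_ofNat_of_zero_le h
    rw [finsum_eq_single _ k, hk, intChoose_natCast, Int.toNat_natCast,
      show n - p + k = r by omega, single_self]
    intro j hj
    rw [single_of_ne (by omega), iterate_map_zero, map_zero, smul_zero]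

/-- Maps compatible with `β` and `d` are compatible with the composition. -/
theorem map_star {A' B' C' : Type*} [AddCommGroup A'] [AddCommGroup B'] [AddCommGroup C']
    (β' : A' →+ B' →+ C') (d' : AddMonoid.End B') (f : A →+ A') (g : B →+ B') (h : C →+ C')
    (hβ : ∀ a b, h (β a b) = β' (f a) (g b)) (hd : ∀ b, g (d b) = d' (g b))
    (a : boundedAbove A) (b : boundedAbove B) :
    map h (star β d a b) = star β' d' (map f a) (map g b) := by
  have hd' : ∀ (k : ℕ) b, g ((⇑d)^[k] b) = (⇑d')^[k] (g b) := fun k b =>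
    (Function.Semiconj.iterate_right (f := g) (ga := d) (gb := d') hd k) b
  ext n
  rw [map_apply, star_apply, star_apply, AddMonoidHom.map_finsum _ (star_support β d a b n)]
  refine finsum_congr fun q => ?_
  rw [map_zsmul, hβ, hd', map_apply, map_apply]

/-- Derivations compatible with `β` and `d` satisfy the Leibniz rule for the composition. -/
theorem map_star_add {A' B' : Type*} [AddCommGroup A'] [AddCommGroup B']
    {C' : Type*} [AddCommGroup C']
    (β₁ : A' →+ B →+ C') (β₂ : A →+ B' →+ C') (d' : AddMonoid.End B') (f : A →+ A') (g : B →+ B')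
    (h : C →+ C')
    (hβ : ∀ a b, h (β a b) = β₁ (f a) b + β₂ a (g b)) (hd : ∀ b, g (d b) = d' (g b))
    (a : boundedAbove A) (b : boundedAbove B) :
    map h (star β d a b) = star β₁ d (map f a) b + star β₂ d' a (map g b) := by
  have hd' : ∀ (k : ℕ) b, g ((⇑d)^[k] b) = (⇑d')^[k] (g b) := fun k b =>
    (Function.Semiconj.iterate_right (f := g) (ga := d) (gb := d') hd k) b
  ext n
  rw [map_apply, add_apply, star_apply, star_apply, star_apply,
    AddMonoidHom.map_finsum _ (star_support β d a b n),
    ← finsum_add_distrib (star_support β₁ d _ b n) (star_support β₂ d' a _ n)]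
  refine finsum_congr fun q => ?_
  rw [map_zsmul, hβ, hd', map_apply, map_apply, smul_add]

end star

section assoc

variable {A B C P Q G : Type*} [AddCommGroup A] [AddCommGroup B] [AddCommGroup C] [AddCommGroup P]
  [AddCommGroup Q] [AddCommGroup G] (β₁ : A →+ B →+ P) (β₂ : P →+ C →+ G) (β₃ : B →+ C →+ Q)
  (β₄ : A →+ Q →+ G) (dB : AddMonoid.End B) (dC : AddMonoid.End C) (dQ : AddMonoid.End Q)

theorem iterate_leibniz (hd : ∀ b c, dQ (β₃ b c) = β₃ (dB b) c + β₃ b (dC c)) (k : ℕ) (b : B)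
    (c : C) : (⇑dQ)^[k] (β₃ b c) = ∑ x ∈ Finset.HasAntidiagonal.antidiagonal k,
      k.choose x.1 • β₃ ((⇑dB)^[x.1] b) ((⇑dC)^[x.2] c) := by
  induction k with
  | zero => simp
  | succ k ih =>
    rw [Function.iterate_succ_apply', ih, map_sum,
      Finset.sum_antidiagonal_choose_succ_nsmul
        (fun i j => β₃ ((⇑dB)^[i] b) ((⇑dC)^[j] c)) k, ← Finset.sum_add_distrib]
    refine Finset.sum_congr rfl fun x hx => ?_
    rw [map_nsmul, hd, Function.iterate_succ_apply', Function.iterate_succ_apply', smul_add,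
      add_comm, Nat.choose_symm_of_eq_add (Finset.HasAntidiagonal.mem_antidiagonal.1 hx).symm]

/-- In each degree both sides are combinations of `β₄ a (β₃ (dⁱ b) (dʲ c))`. On the right, the
iterated Leibniz rule produces products of three binomial coefficients; trinomial revision frees the
factor `p choose i`, and Vandermonde's identity sums the other two to the coefficient on the left.
-/
theorem star_assoc_single (hβ : ∀ a b c, β₂ (β₁ a b) c = β₄ a (β₃ b c))
    (hd : ∀ b c, dQ (β₃ b c) = β₃ (dB b) c + β₃ b (dC c)) (p q r : ℤ) (a : A) (b : B) (c : C) :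
    star β₂ dC (star β₁ dB (single p a) (single q b)) (single r c) =
      star β₄ dQ (single p a) (star β₃ dC (single q b) (single r c)) := by
  ext n
  rw [star_single_right, star_single_left]
  simp only [star_single_single]
  rcases lt_or_ge (p + q + r - n) 0 with h | h
  · rw [finsum_congr fun k : ℕ => ?_, finsum_zero, finsum_congr fun k : ℕ => ?_, finsum_zero]
    · rw [intChoose_of_neg _ (by omega), zero_smul, iterate_map_zero, map_zero, smul_zero]
    · rw [intChoose_of_neg _ (by omega), zero_smul, map_zero, AddMonoidHom.zero_apply, smul_zero]
  -- `t` is the total number of differentiations that lead to degree `n`.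
  · obtain ⟨t, ht⟩ := Int.eq_ofNat_of_zero_le h
    rw [finsum_eq_sum_antidiagonal _ t, finsum_eq_sum_antidiagonal _ t]
    · have h1 : ∀ x ∈ Finset.HasAntidiagonal.antidiagonal t,
          Ring.choose p x.1 • β₄ a ((⇑dQ)^[x.1] (intChoose q (q + r - (n - p + x.1)) •
            β₃ b ((⇑dC)^[(q + r - (n - p + x.1)).toNat] c))) =
          ∑ y ∈ Finset.HasAntidiagonal.antidiagonal x.1,
            (intChoose p (y.1 + y.2) * intChoose (y.1 + y.2) y.1 * intChoose q x.2) •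
            β₄ a (β₃ ((⇑dB)^[y.1] b) ((⇑dC)^[y.2 + x.2] c)) := by
        intro x hx
        have hx' := Finset.HasAntidiagonal.mem_antidiagonal.1 hx
        rw [show q + r - (n - p + x.1) = (x.2 : ℕ) by omega, Int.toNat_natCast,
          ← AddMonoid.End.coe_pow, map_zsmul, AddMonoid.End.coe_pow,
          iterate_leibniz β₃ dB dC dQ hd, map_zsmul, map_sum, Finset.smul_sum, Finset.smul_sum]
        refine Finset.sum_congr rfl fun y hy => ?_
        have hy' := Finset.HasAntidiagonal.mem_antidiagonal.1 hy
        rw [map_nsmul, ← Function.iterate_add_apply, ← Nat.cast_smul_eq_nsmul ℤ, smul_smul,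
          smul_smul, ← hy', ← intChoose_natCast, Nat.cast_add, ← Ring.choose_natCast (R := ℤ),
          ← intChoose_natCast, Nat.cast_add]
        congr 1
        ring
      rw [Finset.sum_congr rfl h1, sum_antidiagonal_antidiagonal t fun i s j =>
        (intChoose p (i + s) * intChoose (i + s) i * intChoose q j) •
            β₄ a (β₃ ((⇑dB)^[i] b) ((⇑dC)^[s + j] c)), ← Finset.Nat.sum_antidiagonal_swap]
      refine Finset.sum_congr rfl fun x hx => ?_
      have hx' := Finset.HasAntidiagonal.mem_antidiagonal.1 hx
      have h2 : ∀ y ∈ Finset.HasAntidiagonal.antidiagonal x.2,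
          (intChoose p (x.1 + y.1) * intChoose (x.1 + y.1) x.1 * intChoose q y.2) •
            β₄ a (β₃ ((⇑dB)^[x.1] b) ((⇑dC)^[y.1 + y.2] c)) =
          (intChoose p x.1 * (intChoose (p - x.1) y.1 * intChoose q y.2)) •
            β₄ a (β₃ ((⇑dB)^[x.1] b) ((⇑dC)^[x.2] c)) := by
        intro y hy
        rw [Finset.HasAntidiagonal.mem_antidiagonal.1 hy, ← intChoose_mul, mul_assoc]
      rw [Finset.sum_congr rfl h2, ← Finset.sum_smul, ← Finset.mul_sum, sum_intChoose_mul]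
      simp only [Prod.fst_swap]
      rw [show p + q - (n - r + x.2) = (x.1 : ℕ) by omega, Int.toNat_natCast, map_zsmul,
        AddMonoidHom.zsmul_apply, hβ, smul_smul, mul_comm, ← intChoose_natCast,
        show n - r + x.2 = p - x.1 + q by omega]
    · intro k hk
      rw [intChoose_of_neg _ (by omega), zero_smul, iterate_map_zero, map_zero, smul_zero]
    · intro k hk
      rw [intChoose_of_neg _ (by omega), zero_smul, map_zero, AddMonoidHom.zero_apply, smul_zero]

/-- A fixed coefficient of either side ignores the low-degree part of each factor when the other
factors are bounded, so `hom_ext`, applied to one factor at a time, reduces to monomials. -/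
theorem star_assoc (hβ : ∀ a b c, β₂ (β₁ a b) c = β₄ a (β₃ b c))
    (hd : ∀ b c, dQ (β₃ b c) = β₃ (dB b) c + β₃ b (dC c)) (a : boundedAbove A)
    (b : boundedAbove B) (c : boundedAbove C) :
    star β₂ dC (star β₁ dB a b) c = star β₄ dQ a (star β₃ dC b c) := by
  obtain ⟨N, hN⟩ := exists_degLE a
  obtain ⟨M, hM⟩ := exists_degLE b
  obtain ⟨L, hL⟩ := exists_degLE c
  ext n
  refine DFunLike.congr_fun (f := (coeffHom n).comp (((star β₂ dC).flip c).comp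
    ((star β₁ dB).flip b))) (g := (coeffHom n).comp ((star β₄ dQ).flip (star β₃ dC b c)))
    (hom_ext ⟨n - M - L - 1, fun a ha => ((ha.star hM).star hL) n (by omega)⟩
      ⟨n - M - L - 1, fun a ha => (ha.star (hM.star hL)) n (by omega)⟩ fun p a => ?_) a
  refine DFunLike.congr_fun (f := (coeffHom n).comp (((star β₂ dC).flip c).comp
    (star β₁ dB (single p a)))) (g := (coeffHom n).comp ((star β₄ dQ (single p a)).comp
      ((star β₃ dC).flip c)))
    (hom_ext ⟨n - p - L - 1, fun b hb => (((degLE_single p a).star hb).star hL) n (by omega)⟩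
      ⟨n - p - L - 1, fun b hb => ((degLE_single p a).star (hb.star hL)) n (by omega)⟩
      fun q b => ?_) b
  refine DFunLike.congr_fun (f := (coeffHom n).comp
    (star β₂ dC (star β₁ dB (single p a) (single q b)))) (g := (coeffHom n).comp
      ((star β₄ dQ (single p a)).comp (star β₃ dC (single q b))))
    (hom_ext ⟨n - p - q - 1, fun c hc =>
      (((degLE_single p a).star (degLE_single q b)).star hc) n (by omega)⟩
      ⟨n - p - q - 1, fun c hc =>
        ((degLE_single p a).star ((degLE_single q b).star hc)) n (by omega)⟩
      fun r c => ?_) c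
  exact congrArg (fun x : boundedAbove G => x.1 n)
    (star_assoc_single β₁ β₂ β₃ β₄ dB dC dQ hβ hd p q r a b c)

end assoc

end boundedAbove

/-! ### The ring of pseudodifferential operators -/

namespace PDO

open boundedAbove (star DegLE)

variable {F V : Type*} [CommRing F] [CommRing V] [Algebra F V] {D : Derivation F V V}

/-- A derivation as an endomorphism of the additive group. -/
def derivEnd (D : Derivation F V V) : AddMonoid.End V := D.toLinearMap.toAddMonoidHom

@[simp] theorem derivEnd_apply (a : V) : derivEnd D a = D a := rfl

/-- The underlying family of coefficients. -/
def toFamily : PDO D →+ boundedAbove V := AddMonoidHom.id (boundedAbove V)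

@[ext]
theorem ext {a b : PDO D} (h : ∀ n, a.coeff n = b.coeff n) : a = b :=
  boundedAbove.ext (a := toFamily a) (b := toFamily b) h

@[simp] theorem coeff_add (a b : PDO D) (n : ℤ) : (a + b).coeff n = a.coeff n + b.coeff n := rfl
@[simp] theorem coeff_sub (a b : PDO D) (n : ℤ) : (a - b).coeff n = a.coeff n - b.coeff n := rfl
@[simp] theorem coeff_neg (a : PDO D) (n : ℤ) : (-a).coeff n = -a.coeff n := rfl
@[simp] theorem coeff_zero (n : ℤ) : (0 : PDO D).coeff n = 0 := rfl

/-- The coefficient of `∂ⁿ` as an additive map. -/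
def coeffHom (n : ℤ) : PDO D →+ V := boundedAbove.coeffHom n

@[simp] theorem coeffHom_apply (n : ℤ) (a : PDO D) : coeffHom n a = a.coeff n := rfl

@[simp] theorem coeff_sum {κ : Type*} (s : Finset κ) (f : κ → PDO D) (n : ℤ) :
    (∑ i ∈ s, f i).coeff n = ∑ i ∈ s, (f i).coeff n := map_sum (coeffHom n) f s

theorem coeff_zsmul (k : ℤ) (a : PDO D) (n : ℤ) : (k • a).coeff n = k • a.coeff n :=
  map_zsmul (coeffHom n) k a

/-- The operator `a ∂ⁿ`. -/
def mono (n : ℤ) : V →+ PDO D := boundedAbove.single n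

theorem coeff_mono (n : ℤ) (a : V) (k : ℤ) :
    (mono n a : PDO D).coeff k = if k = n then a else 0 := boundedAbove.single_apply n a k

/-- The order of the operator is at most `N`. -/
def OrdLE (a : PDO D) (N : ℤ) : Prop := ∀ n, N < n → a.coeff n = 0

theorem exists_ordLE (a : PDO D) : ∃ N, OrdLE a N := a.2

theorem ordLE_mono (n : ℤ) (a : V) : OrdLE (mono n a : PDO D) n := boundedAbove.degLE_single n a

theorem OrdLE.mono {a : PDO D} {N M : ℤ} (h : OrdLE a N) (hNM : N ≤ M) : OrdLE a M :=
  fun n hn => h n (by omega)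

theorem hom_ext {E : Type*} [AddCommGroup E] {f g : PDO D →+ E}
    (hf : ∃ K, ∀ a, OrdLE a K → f a = 0) (hg : ∃ K, ∀ a, OrdLE a K → g a = 0)
    (h : ∀ n a, f (mono n a) = g (mono n a)) : f = g :=
  boundedAbove.hom_ext (A := V) hf hg h

theorem OrdLE.mul {a b : PDO D} {N M : ℤ} (ha : OrdLE a N) (hb : OrdLE b M) :
    OrdLE (a * b) (N + M) :=
  DegLE.star (β := AddMonoidHom.mul) (d := derivEnd D) (a := toFamily a) (b := toFamily b) ha hb

theorem coeff_mul (a b : PDO D) (n : ℤ) : (a * b).coeff n = ∑ᶠ q : ℤ × ℕ,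
    (Ring.choose q.1 q.2 : ℤ) • (a.coeff q.1 * (⇑D)^[q.2] (b.coeff (n - q.1 + q.2))) := rfl

theorem coeff_mono_mul_mono (p : ℤ) (a : V) (q : ℤ) (b : V) (n : ℤ) :
    (mono p a * mono q b : PDO D).coeff n =
      intChoose p (p + q - n) • (a * (⇑D)^[(p + q - n).toNat] b) :=
  boundedAbove.star_single_single (AddMonoidHom.mul : V →+ V →+ V) (derivEnd D) p a q b n

theorem one_eq_mono : (1 : PDO D) = mono 0 1 := by
  ext n
  rw [coeff_mono]
  rfl

theorem mono_zero_mul_mono (a : V) (q : ℤ) (b : V) :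
    (mono 0 a * mono q b : PDO D) = mono q (a * b) := by
  ext n
  rw [coeff_mono_mul_mono, coeff_mono, zero_add, intChoose_zero_left]
  by_cases h : n = q
  · simp [h]
  · rw [if_neg (by omega), if_neg h, zero_smul]

theorem iterate_one (k : ℕ) : (⇑D)^[k] 1 = if k = 0 then 1 else 0 := by
  cases k with
  | zero => simp
  | succ k => rw [Function.iterate_succ_apply, D.map_one_eq_zero, iterate_map_zero]; simp

theorem mono_mul_mono_one (p : ℤ) (a : V) (q : ℤ) :
    (mono p a * mono q 1 : PDO D) = mono (p + q) a := by
  ext n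
  rw [coeff_mono_mul_mono, coeff_mono, iterate_one]
  rcases lt_trichotomy n (p + q) with h | h | h
  · rw [if_neg (by omega), if_neg h.ne, mul_zero, smul_zero]
  · simp [h, intChoose_zero]
  · rw [intChoose_of_neg _ (by omega), if_neg h.ne', zero_smul]

theorem mono_one_mul_mono_zero (a : V) :
    (mono 1 1 * mono 0 a : PDO D) = mono 1 a + mono 0 (D a) := by
  ext n
  rw [coeff_mono_mul_mono, coeff_add, coeff_mono, coeff_mono]
  have h1 : intChoose 1 (1 + 0 - n) = if n = 1 then 1 else if n = 0 then 1 else 0 := by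
    rw [show (1 : ℤ) = 0 + 1 from rfl, intChoose_succ, intChoose_zero_left, intChoose_zero_left]
    split_ifs <;> omega
  rw [h1]
  split_ifs with h2 h3 h3
  · omega
  · simp [h2]
  · simp [h3]
  · simp

noncomputable scoped instance : NonUnitalNonAssocRing (PDO D) :=
  { (inferInstance : AddCommGroup (PDO D)), (inferInstance : Mul (PDO D)) with
    left_distrib := fun a b c => map_add (star AddMonoidHom.mul (derivEnd D) (toFamily a)) b c
    right_distrib := fun a b c => DFunLike.congr_fun
      (map_add (star AddMonoidHom.mul (derivEnd D)) (toFamily a) (toFamily b)) c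
    zero_mul := fun a => DFunLike.congr_fun (map_zero (star AddMonoidHom.mul (derivEnd D))) a
    mul_zero := fun a => map_zero (star AddMonoidHom.mul (derivEnd D) (toFamily a)) }

/-- The product of operators is `star` for the multiplication of `V` and the endomorphism `D`; the
Leibniz rule for `D` is the compatibility that associativity requires. -/
theorem mul_assoc' (a b c : PDO D) : a * b * c = a * (b * c) :=
  boundedAbove.star_assoc AddMonoidHom.mul AddMonoidHom.mul AddMonoidHom.mul AddMonoidHom.mul
    (derivEnd D) (derivEnd D) (derivEnd D) (fun a b c => mul_assoc a b c)
    (fun b c => by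
      simp only [AddMonoidHom.coe_mul, AddMonoidHom.coe_mulLeft, derivEnd_apply, Derivation.leibniz,
        smul_eq_mul]
      ring) a b c

theorem one_mul' (a : PDO D) : 1 * a = a := by
  refine PDO.ext fun n => ?_
  refine DFunLike.congr_fun (f := (coeffHom n).comp (AddMonoidHom.mulLeft 1)) (g := coeffHom n)
    (hom_ext ⟨n - 1, fun b hb => ?_⟩ ⟨n - 1, fun b hb => hb n (by omega)⟩ fun m b => ?_) a
  · have := (ordLE_mono 0 (1 : V) (D := D)).mul hb
    rw [← one_eq_mono] at this
    exact this n (by omega)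
  · change (1 * mono m b : PDO D).coeff n = (mono m b : PDO D).coeff n
    rw [one_eq_mono, mono_zero_mul_mono, one_mul]

theorem mul_one' (a : PDO D) : a * 1 = a := by
  refine PDO.ext fun n => ?_
  refine DFunLike.congr_fun (f := (coeffHom n).comp (AddMonoidHom.mulRight 1)) (g := coeffHom n)
    (hom_ext ⟨n - 1, fun b hb => ?_⟩ ⟨n - 1, fun b hb => hb n (by omega)⟩ fun m b => ?_) a
  · have := hb.mul (ordLE_mono 0 (1 : V) (D := D))
    rw [← one_eq_mono] at this
    exact this n (by omega)
  · change (mono m b * 1 : PDO D).coeff n = (mono m b : PDO D).coeff n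
    rw [one_eq_mono, mono_mul_mono_one, add_zero]

noncomputable scoped instance : Ring (PDO D) :=
  { (inferInstance : NonUnitalNonAssocRing (PDO D)), (inferInstance : One (PDO D)) with
    mul_assoc := mul_assoc'
    one_mul := one_mul'
    mul_one := mul_one' }

theorem mono_eq (p : ℤ) (a : V) : (mono p a : PDO D) = mono 0 a * mono p 1 := by
  rw [mono_mul_mono_one, zero_add]

/-- Multiplication operators. -/
def const : V →+* PDO D where
  __ := mono 0
  map_one' := one_eq_mono.symm
  map_mul' a b := (mono_zero_mul_mono a 0 b).symm

theorem mono_zero_eq_const (a : V) : (mono 0 a : PDO D) = const a := rfl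

theorem coeff_const_mul (a : V) (b : PDO D) (n : ℤ) : (const a * b).coeff n = a * b.coeff n := by
  change (star AddMonoidHom.mul (derivEnd D) (boundedAbove.single 0 a) (toFamily b)).1 n = _
  rw [boundedAbove.star_single_left, finsum_eq_single _ 0]
  · simp only [CharP.cast_eq_zero, Ring.choose_zero_right, sub_zero, add_zero, one_smul]
    rfl
  · intro k hk
    simp [Ring.choose_zero_ite, hk]

theorem coeff_mono_one_mul (b : PDO D) (n : ℤ) :
    (mono 1 1 * b).coeff n = b.coeff (n - 1) + D (b.coeff n) := by
  refine DFunLike.congr_fun (f := (coeffHom n).comp (AddMonoidHom.mulLeft (mono 1 1)))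
    (g := coeffHom (n - 1) + (derivEnd D : V →+ V).comp (coeffHom n))
    (hom_ext ⟨n - 2, fun b hb => ((ordLE_mono 1 1).mul hb) n (by omega)⟩
      ⟨n - 2, fun b hb => ?_⟩ fun m b => ?_) b
  · change b.coeff (n - 1) + D (b.coeff n) = 0
    rw [hb _ (by omega), hb _ (by omega), map_zero, add_zero]
  · change (mono 1 1 * mono m b : PDO D).coeff n =
      (mono m b : PDO D).coeff (n - 1) + D ((mono m b : PDO D).coeff n)
    rw [mono_eq m b, ← mul_assoc, mono_one_mul_mono_zero, add_mul, mono_mul_mono_one,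
      mono_mul_mono_one, coeff_add, mono_mul_mono_one, coeff_mono, coeff_mono, coeff_mono,
      coeff_mono]
    split_ifs <;> first | omega | simp

theorem coeff_mul_mono_one (b : PDO D) (p n : ℤ) : (b * mono p 1).coeff n = b.coeff (n - p) := by
  refine DFunLike.congr_fun (f := (coeffHom n).comp (AddMonoidHom.mulRight (mono p 1)))
    (g := coeffHom (n - p))
    (hom_ext ⟨n - p - 1, fun b hb => (hb.mul (ordLE_mono p 1)) n (by omega)⟩
      ⟨n - p - 1, fun b hb => hb _ (by omega)⟩ fun m b => ?_) b
  change (mono m b * mono p 1 : PDO D).coeff n = (mono m b : PDO D).coeff (n - p)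
  rw [mono_mul_mono_one, coeff_mono, coeff_mono]
  split_ifs <;> first | omega | simp

theorem mono_mul_inv (p : ℤ) : (mono p 1 * mono (-p) 1 : PDO D) = 1 := by
  rw [mono_mul_mono_one, add_neg_cancel, one_eq_mono]

/-! ### The formal adjoint -/

theorem adjoint_support (a : PDO D) (n : ℤ) :
    (Function.support fun k : ℕ => ((Int.negOnePow (n + k) : ℤ) * Ring.choose (n + k) k) •
      (⇑D)^[k] (a.coeff (n + k))).Finite := by
  obtain ⟨N, hN⟩ := a.exists_ordLE
  refine (Finset.range (N - n + 1).toNat).finite_toSet.subset fun k hk => ?_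
  simp only [Finset.coe_range, Set.mem_Iio]
  by_contra h
  exact hk (by simp [hN (n + k) (by omega), iterate_map_zero])

/-- The formal adjoint as an additive map. -/
noncomputable def adjointHom : PDO D →+ PDO D where
  toFun := adjoint
  map_zero' := by
    ext n
    exact (finsum_congr fun k => by simp [iterate_map_zero]).trans finsum_zero
  map_add' a b := by
    ext n
    refine Eq.trans ?_ (finsum_add_distrib (adjoint_support a n) (adjoint_support b n))
    exact finsum_congr fun k => by simp [iterate_map_add]

theorem adjoint_add (a b : PDO D) : (a + b).adjoint = a.adjoint + b.adjoint :=
  map_add adjointHom a b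
theorem adjoint_sub (a b : PDO D) : (a - b).adjoint = a.adjoint - b.adjoint :=
  map_sub adjointHom a b
theorem adjoint_neg (a : PDO D) : (-a).adjoint = -a.adjoint := map_neg adjointHom a
theorem adjoint_zero : (0 : PDO D).adjoint = 0 := map_zero adjointHom
theorem adjoint_sum {κ : Type*} (s : Finset κ) (f : κ → PDO D) :
    (∑ i ∈ s, f i).adjoint = ∑ i ∈ s, (f i).adjoint := map_sum adjointHom f s

theorem coeff_adjoint (a : PDO D) (n : ℤ) : a.adjoint.coeff n = ∑ᶠ k : ℕ,
    ((Int.negOnePow (n + k) : ℤ) * Ring.choose (n + k) k) • (⇑D)^[k] (a.coeff (n + k)) := rfl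

theorem OrdLE.adjoint {a : PDO D} {N : ℤ} (h : OrdLE a N) : OrdLE a.adjoint N := by
  intro n hn
  rw [coeff_adjoint]
  refine (finsum_congr fun k => ?_).trans finsum_zero
  rw [h _ (by omega), iterate_map_zero, smul_zero]

theorem adjoint_mono (p : ℤ) (a : V) :
    (mono p a : PDO D).adjoint = (Int.negOnePow p : ℤ) • (mono p 1 * const a) := by
  ext n
  rw [coeff_zsmul, ← mono_zero_eq_const, coeff_mono_mul_mono, coeff_adjoint]
  rcases lt_or_ge (p - n) 0 with h | h
  · rw [intChoose_of_neg _ (by omega), zero_smul, smul_zero]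
    refine (finsum_congr fun k => ?_).trans finsum_zero
    rw [coeff_mono, if_neg (by omega), iterate_map_zero, smul_zero]
  · obtain ⟨k, hk⟩ := Int.eq_ofNat_of_zero_le h
    rw [finsum_eq_single _ k]
    · rw [show p + 0 - n = k by omega, show n + k = p by omega, intChoose_natCast, coeff_mono,
        if_pos rfl, smul_smul, one_mul, Int.toNat_natCast]
    · intro j hj
      rw [coeff_mono, if_neg (by omega), iterate_map_zero, smul_zero]

/-- Since orders are raised by at most `N`, each coefficient of the value vanishes on operators of
low order, and `hom_ext` applies to one coefficient at a time. -/
theorem hom_ext_mul {f g : PDO D →+ PDO D} {N : ℤ}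
    (hf : ∀ a K, OrdLE a K → OrdLE (f a) (K + N)) (hg : ∀ a K, OrdLE a K → OrdLE (g a) (K + N))
    (h : ∀ n a, f (mono n a) = g (mono n a)) : f = g := by
  refine AddMonoidHom.ext fun a => PDO.ext fun n => ?_
  exact DFunLike.congr_fun (f := (coeffHom n).comp f) (g := (coeffHom n).comp g)
    (hom_ext ⟨n - N - 1, fun b hb => hf b _ hb n (by omega)⟩
      ⟨n - N - 1, fun b hb => hg b _ hb n (by omega)⟩ fun m b =>
        congrArg (coeffHom n) (h m b)) a

theorem adjoint_const_mul (a : V) (b : PDO D) :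
    (const a * b).adjoint = b.adjoint * const a := by
  refine DFunLike.congr_fun (f := adjointHom.comp (AddMonoidHom.mulLeft (const a)))
    (g := (AddMonoidHom.mulRight (const a)).comp adjointHom) (hom_ext_mul (N := 0)
    (fun b K hb => ?_) (fun b K hb => hb.adjoint.mul (ordLE_mono 0 a)) fun n b => ?_) b
  · exact (((ordLE_mono 0 a).mul hb).mono (by omega)).adjoint
  · change (const a * mono n b : PDO D).adjoint = (mono n b : PDO D).adjoint * const a
    rw [← mono_zero_eq_const, mono_zero_mul_mono, adjoint_mono, adjoint_mono, smul_mul_assoc,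
      mul_assoc, mono_zero_eq_const, ← map_mul, mul_comm]

theorem adjoint_del_mul (b : PDO D) :
    (mono 1 1 * b).adjoint = -(b.adjoint * mono 1 1) := by
  refine DFunLike.congr_fun (f := adjointHom.comp (AddMonoidHom.mulLeft (mono 1 1)))
    (g := -(AddMonoidHom.mulRight (mono 1 1)).comp adjointHom) (hom_ext_mul (N := 1)
    (fun b K hb => ?_) (fun b K hb => ?_) fun n b => ?_) b
  · exact (((ordLE_mono 1 1).mul hb).mono (by omega)).adjoint
  · intro n hn
    exact neg_eq_zero.2 ((hb.adjoint.mul (ordLE_mono 1 1)) n hn)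
  · change (mono 1 1 * mono n b : PDO D).adjoint = -((mono n b : PDO D).adjoint * mono 1 1)
    rw [mono_eq n b, ← mul_assoc, mono_one_mul_mono_zero, add_mul, mono_mul_mono_one,
      mono_mul_mono_one, mono_mul_mono_one, adjoint_add, adjoint_mono, adjoint_mono, adjoint_mono,
      add_comm 1 n, negOnePow_succ_coe, zero_add, smul_mul_assoc, mul_assoc,
      ← mono_mul_mono_one n 1 1,
      mul_assoc, ← mono_zero_eq_const, mono_one_mul_mono_zero, mono_mul_mono_one]
    simp only [mul_add, smul_add, mono_zero_eq_const]
    simp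

theorem adjoint_mono_one_mul (n : ℤ) (b : PDO D) :
    (mono n 1 * b).adjoint = (Int.negOnePow n : ℤ) • (b.adjoint * mono n 1) := by
  induction n using Int.induction_on generalizing b with
  | zero => simp [← one_eq_mono]
  | succ n ih =>
    rw [← mono_mul_mono_one, mul_assoc, ih, adjoint_del_mul, negOnePow_succ_coe, neg_mul, mul_assoc,
      mono_mul_mono_one, mono_mul_mono_one, add_comm (1 : ℤ)]
    simp
  | pred n ih =>
    -- For negative powers, the rule for `∂` is applied to `∂⁻ⁿ⁻¹ ∘ b`, and `∂` is then cancelled on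
    -- the right.
    have h1 := adjoint_del_mul (mono (-n - 1) 1 * b)
    rw [← mul_assoc, mono_mul_mono_one, show (1 : ℤ) + (-n - 1) = -n by ring, ih] at h1
    have h2 := negOnePow_succ_coe (-n - 1)
    rw [sub_add_cancel] at h2
    have h3 := congrArg (fun x => -(x * mono (-1) 1)) h1
    rw [neg_mul, neg_neg, mul_assoc, mono_mul_inv, mul_one, h2, smul_mul_assoc, mul_assoc,
      mono_mul_mono_one] at h3
    rw [← h3]
    simp [sub_eq_add_neg]

/-- By continuity `a` may be a monomial, that is, a multiplication operator times a power of `∂`,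
and for these two kinds of left factor the rule is already known. -/
theorem adjoint_mul (a b : PDO D) : (a * b).adjoint = b.adjoint * a.adjoint := by
  obtain ⟨N, hN⟩ := b.exists_ordLE
  refine DFunLike.congr_fun (f := adjointHom.comp (AddMonoidHom.mulRight b))
    (g := (AddMonoidHom.mulLeft b.adjoint).comp adjointHom) (hom_ext_mul (N := N)
    (fun a K ha => (ha.mul hN).adjoint) (fun a K ha => ?_) fun n a => ?_) a
  · exact (hN.adjoint.mul ha.adjoint).mono (by omega)
  · change (mono n a * b : PDO D).adjoint = b.adjoint * (mono n a).adjoint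
    rw [adjoint_mono, mono_eq, mul_assoc, mono_zero_eq_const, adjoint_const_mul,
      adjoint_mono_one_mul, mul_smul_comm, smul_mul_assoc, mul_assoc]

theorem adjoint_const (a : V) : (const a : PDO D).adjoint = const a := by
  rw [← mono_zero_eq_const, adjoint_mono, ← one_eq_mono]
  simp [mono_zero_eq_const]

theorem adjoint_one : (1 : PDO D).adjoint = 1 := by
  rw [← map_one const, adjoint_const]

theorem adjoint_mono_one (n : ℤ) :
    (mono n 1 : PDO D).adjoint = (Int.negOnePow n : ℤ) • mono n 1 := by
  rw [adjoint_mono, map_one const, mul_one]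

theorem adjoint_zsmul (k : ℤ) (a : PDO D) : (k • a).adjoint = k • a.adjoint :=
  map_zsmul adjointHom k a

theorem negOnePow_smul_smul {E : Type*} [AddCommGroup E] (n : ℤ) (x : E) :
    (Int.negOnePow n : ℤ) • (Int.negOnePow n : ℤ) • x = x := by
  rw [smul_smul, ← Units.val_mul, ← Int.negOnePow_add, Int.negOnePow_even _ ⟨n, rfl⟩]
  simp

theorem adjoint_adjoint (a : PDO D) : a.adjoint.adjoint = a := by
  refine DFunLike.congr_fun (f := adjointHom.comp adjointHom) (g := AddMonoidHom.id _)
    (hom_ext_mul (N := 0) (fun a K ha => ?_) (fun a K ha => ?_) fun n a => ?_) a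
  · exact (ha.mono (by omega)).adjoint.adjoint
  · exact ha.mono (by omega)
  · change (mono n a : PDO D).adjoint.adjoint = mono n a
    rw [adjoint_mono, adjoint_zsmul, adjoint_mul, adjoint_const, adjoint_mono_one, mul_smul_comm,
      negOnePow_smul_smul, mono_eq n a, mono_zero_eq_const]

section Matrix

variable {ι κ ν : Type*}

theorem adjointMatrix_apply (A : Matrix ι κ (PDO D)) (i : κ) (j : ι) :
    adjointMatrix A i j = (A j i).adjoint := rfl

theorem adjointMatrix_mul [Fintype κ] (A : Matrix ι κ (PDO D)) (B : Matrix κ ν (PDO D)) :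
    adjointMatrix (A * B) = adjointMatrix B * adjointMatrix A := by
  ext1 i j
  simp only [adjointMatrix_apply, Matrix.mul_apply, adjoint_sum, adjoint_mul]

theorem adjointMatrix_sub (A B : Matrix ι κ (PDO D)) :
    adjointMatrix (A - B) = adjointMatrix A - adjointMatrix B := by
  ext1 i j
  exact adjoint_sub _ _

theorem adjointMatrix_neg (A : Matrix ι κ (PDO D)) :
    adjointMatrix (-A) = -adjointMatrix A := by
  ext1 i j
  exact adjoint_neg _

theorem adjointMatrix_zero : adjointMatrix (0 : Matrix ι κ (PDO D)) = 0 := by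
  ext1 i j
  exact adjoint_zero

theorem adjointMatrix_one [DecidableEq ι] : adjointMatrix (1 : Matrix ι ι (PDO D)) = 1 := by
  ext1 i j
  rw [adjointMatrix_apply, Matrix.one_apply, Matrix.one_apply]
  split_ifs <;> simp_all [adjoint_one, adjoint_zero]

theorem adjointMatrix_adjointMatrix (A : Matrix ι κ (PDO D)) :
    adjointMatrix (adjointMatrix A) = A := by
  ext1 i j
  exact adjoint_adjoint _

end Matrix

/-! ### Functoriality -/

section Functoriality

variable {V' : Type*} [CommRing V'] [Algebra F V'] {D' : Derivation F V' V'}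

/-- The ring homomorphism of pseudodifferential operators induced by a homomorphism of
differential rings. -/
noncomputable def mapHom (f : V →+* V') (hf : ∀ a, f (D a) = D' (f a)) : PDO D →+* PDO D' where
  toFun a := (boundedAbove.map (f : V →+ V') a : boundedAbove V')
  map_zero' := map_zero (boundedAbove.map (f : V →+ V'))
  map_add' := map_add (boundedAbove.map (f : V →+ V'))
  map_one' := by
    rw [one_eq_mono, one_eq_mono]
    exact (boundedAbove.map_single (f : V →+ V') 0 1).trans (by simp; rfl)
  map_mul' a b := boundedAbove.map_star (AddMonoidHom.mul : V →+ V →+ V) (derivEnd D)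
    (AddMonoidHom.mul : V' →+ V' →+ V') (derivEnd D')
    (f : V →+ V') (f : V →+ V') (f : V →+ V') (fun a b => by simp) hf a b

variable (f : V →+* V') (hf : ∀ a, f (D a) = D' (f a))

theorem coeff_mapHom (a : PDO D) (n : ℤ) : (mapHom f hf a).coeff n = f (a.coeff n) := rfl

include hf in
theorem map_iterate (k : ℕ) (a : V) : f ((⇑D)^[k] a) = (⇑D')^[k] (f a) :=
  (Function.Semiconj.iterate_right (f := f) (ga := D) (gb := D') hf k) a

theorem mapHom_adjoint (a : PDO D) : mapHom f hf a.adjoint = (mapHom f hf a).adjoint := by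
  ext n
  rw [coeff_mapHom, coeff_adjoint, coeff_adjoint]
  refine (AddMonoidHom.map_finsum (f : V →+ V') (adjoint_support a n)).trans
    (finsum_congr fun k => ?_)
  rw [map_zsmul, coeff_mapHom]
  exact congrArg _ (map_iterate f hf _ _)

end Functoriality

end PDO

/-! ### Differential operators and rational operators -/

namespace PDO

variable {F V : Type*} [CommRing F] [CommRing V] [Algebra F V] {D : Derivation F V V}

namespace IsDifferential

variable {a b : PDO D}

theorem zero : (0 : PDO D).IsDifferential := fun _ _ => rfl

theorem add (ha : a.IsDifferential) (hb : b.IsDifferential) : (a + b).IsDifferential :=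
  fun n hn => by rw [coeff_add, ha n hn, hb n hn, add_zero]

theorem neg (ha : a.IsDifferential) : (-a).IsDifferential :=
  fun n hn => by rw [coeff_neg, ha n hn, neg_zero]

theorem sum {κ : Type*} {s : Finset κ} {f : κ → PDO D} (h : ∀ i ∈ s, (f i).IsDifferential) :
    (∑ i ∈ s, f i).IsDifferential :=
  Finset.sum_induction f IsDifferential (fun _ _ => add) zero h

theorem mono_natCast (n : ℕ) (x : V) : (mono n x : PDO D).IsDifferential :=
  fun k hk => by rw [coeff_mono, if_neg (by omega)]

theorem const (x : V) : (PDO.const x : PDO D).IsDifferential := mono_natCast 0 x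

theorem one : (1 : PDO D).IsDifferential := by
  rw [← map_one PDO.const]
  exact const 1

theorem mul (ha : a.IsDifferential) (hb : b.IsDifferential) : (a * b).IsDifferential := by
  intro n hn
  rw [coeff_mul]
  refine (finsum_congr fun q => ?_).trans finsum_zero
  rcases lt_or_ge q.1 0 with h | h
  · rw [ha _ h, zero_mul, smul_zero]
  rcases lt_or_ge (n - q.1 + q.2) 0 with h' | h'
  · rw [hb _ h', iterate_map_zero, mul_zero, smul_zero]
  -- Here `0 ≤ q.1 < q.2`, so the binomial coefficient is zero: composing differential operators
  -- creates no negative powers.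
  · obtain ⟨j, hj⟩ := Int.eq_ofNat_of_zero_le h
    rw [hj, Ring.choose_natCast, Nat.choose_eq_zero_of_lt (by omega)]
    simp

theorem adjoint (ha : a.IsDifferential) : a.adjoint.IsDifferential := by
  intro n hn
  rw [coeff_adjoint]
  refine (finsum_congr fun k => ?_).trans finsum_zero
  rcases lt_or_ge (n + k) 0 with h | h
  · rw [ha _ h, iterate_map_zero, smul_zero]
  · obtain ⟨j, hj⟩ := Int.eq_ofNat_of_zero_le h
    rw [hj, Ring.choose_natCast, Nat.choose_eq_zero_of_lt (by omega)]
    simp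

end IsDifferential

theorem exists_leading {a : PDO D} (ha : a ≠ 0) : ∃ N, a.coeff N ≠ 0 ∧ OrdLE a N := by
  obtain ⟨N, hN⟩ := a.exists_ordLE
  have hne : ∃ n, a.coeff n ≠ 0 := by
    by_contra! h
    exact ha (PDO.ext h)
  obtain ⟨M, hM, hmax⟩ := Int.exists_greatest_of_bdd (P := fun n => a.coeff n ≠ 0)
    ⟨N, fun n hn => not_lt.1 fun h => hn (hN n h)⟩ hne
  exact ⟨M, hM, fun n hn => not_not.1 fun h => absurd (hmax n h) (by omega)⟩

theorem coeff_mul_top {a b : PDO D} {N M : ℤ} (ha : OrdLE a N) (hb : OrdLE b M) :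
    (a * b).coeff (N + M) = a.coeff N * b.coeff M := by
  rw [coeff_mul, finsum_eq_single _ (N, 0)]
  · simp
  · rintro ⟨q, k⟩ hq
    rcases lt_or_ge N q with h | h
    · rw [ha _ h, zero_mul, smul_zero]
    rcases lt_or_ge M (N + M - q + k) with h' | h'
    · dsimp only
      rw [hb _ h', iterate_map_zero, mul_zero, smul_zero]
    · exact absurd (Prod.ext (by omega) (by dsimp only; omega)) hq

instance [NoZeroDivisors V] : NoZeroDivisors (PDO D) where
  eq_zero_or_eq_zero_of_mul_eq_zero {a b} h := by
    by_contra! hab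
    obtain ⟨N, hN, hN'⟩ := exists_leading hab.1
    obtain ⟨M, hM, hM'⟩ := exists_leading hab.2
    have := coeff_mul_top hN' hM'
    rw [h, coeff_zero] at this
    exact mul_ne_zero hN hM this.symm

theorem adjoint_ne_zero {a : PDO D} (ha : a ≠ 0) : a.adjoint ≠ 0 := by
  intro h
  rw [← a.adjoint_adjoint, h, adjoint_zero] at ha
  exact ha rfl

section Relations

variable {κ μ : Type*} [Fintype κ] [Fintype μ]

/-- The coefficients of the unknown operators stand on the left and are never differentiated, so the
equations are linear over `V`. For unknowns of large order there are more coefficients than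
equations, and a linear map that lowers the rank of free modules is not injective. -/
theorem exists_left_relation [Nontrivial V] (hcard : Fintype.card μ < Fintype.card κ)
    (v : κ → μ → PDO D) (hv : ∀ k i, (v k i).IsDifferential) :
    ∃ c : κ → PDO D, (∀ k, (c k).IsDifferential) ∧ c ≠ 0 ∧ ∀ i, ∑ k, c k * v k i = 0 := by
  choose K hK using fun q : κ × μ => (v q.1 q.2).exists_ordLE
  set L : ℕ := ∑ q, (K q).toNat
  have hL : ∀ k i, OrdLE (v k i) L := by
    intro k i
    refine (hK (k, i)).mono ?_
    have : (K (k, i)).toNat ≤ L :=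
      Finset.single_le_sum (f := fun q => (K q).toNat) (fun _ _ => Nat.zero_le _)
        (Finset.mem_univ (k, i))
    omega
  -- Unknowns of order at most `N` have `card κ * (N + 1)` coefficients, against `card μ * (N + L +
  -- 1)` equations. With this `N` and `card κ ≥ card μ + 1`, the first number exceeds the second.
  set N : ℕ := Fintype.card μ * L
  let P : (κ × Fin (N + 1) → V) →+ (κ → PDO D) :=
    { toFun := fun c k => ∑ n : Fin (N + 1), mono (n : ℕ) (c (k, n))
      map_zero' := by ext1 k; simp
      map_add' := fun c c' => by ext1 k; simp [Finset.sum_add_distrib] }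
  have hP : ∀ c k, P c k = ∑ n : Fin (N + 1), mono (n : ℕ) (c (k, n)) := fun _ _ => rfl
  have hPs : ∀ (x : V) c k, P (x • c) k = const x * P c k := by
    intro x c k
    rw [hP, hP, Finset.mul_sum]
    refine Finset.sum_congr rfl fun n _ => ?_
    rw [← mono_zero_eq_const, mono_zero_mul_mono]
    rfl
  have hPc : ∀ c k (n : Fin (N + 1)), (P c k).coeff (n : ℕ) = c (k, n) := by
    intro c k n
    rw [hP, coeff_sum, Finset.sum_eq_single n]
    · rw [coeff_mono, if_pos rfl]
    · intro b _ hb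
      rw [coeff_mono, if_neg]
      intro h
      exact hb (Fin.ext (by exact_mod_cast h.symm))
    · simp
  have hPo : ∀ c k, OrdLE (P c k) N := by
    intro c k n hn
    rw [hP, coeff_sum]
    refine Finset.sum_eq_zero fun j _ => ?_
    rw [coeff_mono, if_neg]
    have := j.2
    omega
  let Φ : (κ × Fin (N + 1) → V) →ₗ[V] (μ × Fin (N + L + 1) → V) :=
    { toFun := fun c q => (∑ k, P c k * v k q.1).coeff (q.2 : ℕ)
      map_add' := fun c c' => by
        ext q
        simp [add_mul, Finset.sum_add_distrib]
      map_smul' := fun x c => by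
        ext q
        simp only [coeff_sum, hPs, mul_assoc, coeff_const_mul, RingHom.id_apply, Pi.smul_apply,
          smul_eq_mul, Finset.mul_sum] }
  have hni : ¬ Function.Injective Φ := by
    intro h
    have := card_le_of_injective V Φ h
    simp only [Fintype.card_prod, Fintype.card_fin] at this
    have h2 : (Fintype.card μ + 1) * (N + 1) ≤ Fintype.card κ * (N + 1) :=
      Nat.mul_le_mul_right _ hcard
    have h3 : Fintype.card μ * L = N := rfl
    nlinarith
  rw [injective_iff_map_eq_zero] at hni
  push Not at hni
  obtain ⟨c, hc, hc0⟩ := hni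
  refine ⟨P c, fun k => ?_, fun h => hc0 ?_, fun i => PDO.ext fun n => ?_⟩
  · rw [hP]
    exact IsDifferential.sum fun n _ => IsDifferential.mono_natCast _ _
  · ext ⟨k, n⟩
    rw [← hPc c k n, h]
    rfl
  · rcases lt_or_ge n 0 with hn | hn
    · exact IsDifferential.sum (fun k _ => IsDifferential.mul
        (by rw [hP]; exact IsDifferential.sum fun n _ => IsDifferential.mono_natCast _ _)
        (hv k i)) n hn
    · rcases lt_or_ge (N + L : ℤ) n with h | h
      · rw [coeff_sum]
        exact Finset.sum_eq_zero fun k _ => ((hPo c k).mul (hL k i)) n h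
      · lift n to ℕ using hn
        exact congrFun hc (i, ⟨n, by omega⟩)

/-- The adjoint reverses products and preserves differential operators, so this is the left version
for the adjoint operators. -/
theorem exists_right_relation [Nontrivial V] (hcard : Fintype.card μ < Fintype.card κ)
    (v : κ → μ → PDO D) (hv : ∀ k i, (v k i).IsDifferential) :
    ∃ c : κ → PDO D, (∀ k, (c k).IsDifferential) ∧ c ≠ 0 ∧ ∀ i, ∑ k, v k i * c k = 0 := by
  obtain ⟨c, hc, hc0, h⟩ := exists_left_relation hcard (fun k i => (v k i).adjoint)
    fun k i => (hv k i).adjoint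
  refine ⟨fun k => (c k).adjoint, fun k => (hc k).adjoint, ?_, fun i => ?_⟩
  · obtain ⟨k, hk⟩ := Function.ne_iff.1 hc0
    exact Function.ne_iff.2 ⟨k, adjoint_ne_zero hk⟩
  · have := congrArg adjoint (h i)
    simpa only [adjoint_sum, adjoint_mul, adjoint_adjoint, adjoint_zero] using this

end Relations

variable [IsDomain V]

theorem ore_condition {a b : PDO D} (ha : a.IsDifferential) (hb : b.IsDifferential)
    (hb0 : b ≠ 0) : ∃ c d : PDO D, c.IsDifferential ∧ d.IsDifferential ∧ c ≠ 0 ∧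
      a * c = b * d := by
  obtain ⟨c, hc, hc0, h⟩ := exists_right_relation (κ := Fin 2) (μ := Unit) (by simp)
    (fun k _ => ![a, b] k) (by
      intro k _
      fin_cases k
      · exact ha
      · exact hb)
  have h1 : a * c 0 + b * c 1 = 0 := by simpa [Fin.sum_univ_two] using h ()
  refine ⟨c 0, -c 1, hc 0, (hc 1).neg, fun h0 => hc0 ?_, ?_⟩
  · rw [h0, mul_zero, zero_add, mul_eq_zero] at h1
    ext1 k
    fin_cases k
    · exact h0
    · exact h1.resolve_left hb0
  · rw [mul_neg]
    exact eq_neg_of_add_eq_zero_left h1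

theorem exists_common_denominator {κ : Type*} (s : Finset κ) (f : κ → PDO D)
    (hf : ∀ i ∈ s, (f i).IsRational) : ∃ b : PDO D, b.IsDifferential ∧ b ≠ 0 ∧
      ∀ i ∈ s, (f i * b).IsDifferential := by
  classical
  induction s using Finset.induction_on with
  | empty =>
    refine ⟨1, IsDifferential.one, fun h => ?_, by simp⟩
    have := congrArg (fun x : PDO D => x.coeff 0) h
    rw [one_eq_mono, coeff_mono, if_pos rfl] at this
    exact one_ne_zero this
  | insert i s _ ih =>
    obtain ⟨b, hb, hb0, h⟩ := ih fun j hj => hf j (Finset.mem_insert_of_mem hj)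
    obtain ⟨A, B, hA, hB, hB0, hAB⟩ := hf i (Finset.mem_insert_self _ _)
    -- The common right multiple `B * c = b * d` of the two denominators serves the new operator and
    -- the old ones alike.
    obtain ⟨c, d, hc, hd, hc0, hcd⟩ := ore_condition hB hb hb0
    refine ⟨B * c, hB.mul hc, mul_ne_zero hB0 hc0, fun j hj => ?_⟩
    rcases Finset.mem_insert.1 hj with rfl | hj
    · rw [← mul_assoc, hAB]
      exact hA.mul hc
    · rw [hcd, ← mul_assoc]
      exact (h j hj).mul hd

theorem IsDifferential.isRational {a : PDO D} (ha : a.IsDifferential) : a.IsRational := by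
  obtain ⟨b, hb, hb0, -⟩ := exists_common_denominator (∅ : Finset Unit) (fun _ => (0 : PDO D))
    (by simp)
  exact ⟨a * b, b, ha.mul hb, hb, hb0, rfl⟩

theorem IsRational.sum {κ : Type*} (s : Finset κ) (f : κ → PDO D)
    (hf : ∀ i ∈ s, (f i).IsRational) : (∑ i ∈ s, f i).IsRational := by
  obtain ⟨b, hb, hb0, h⟩ := exists_common_denominator s f hf
  exact ⟨_, b, IsDifferential.sum h, hb, hb0, Finset.sum_mul _ _ _⟩

theorem IsRational.add {a b : PDO D} (ha : a.IsRational) (hb : b.IsRational) :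
    (a + b).IsRational := by
  have := IsRational.sum (Finset.univ : Finset (Fin 2)) ![a, b] (by
    intro k _
    fin_cases k
    · exact ha
    · exact hb)
  simpa [Fin.sum_univ_two] using this

theorem IsRational.mul {a b : PDO D} (ha : a.IsRational) (hb : b.IsRational) :
    (a * b).IsRational := by
  obtain ⟨A₁, B₁, hA₁, hB₁, hB₁0, h₁⟩ := ha
  obtain ⟨A₂, B₂, hA₂, hB₂, hB₂0, h₂⟩ := hb
  obtain ⟨c, d, hc, hd, hc0, hcd⟩ := ore_condition hA₂ hB₁ hB₁0
  refine ⟨A₁ * d, B₂ * c, hA₁.mul hd, hB₂.mul hc, mul_ne_zero hB₂0 hc0, ?_⟩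
  rw [mul_assoc, ← mul_assoc b, h₂, hcd, ← mul_assoc, h₁]

theorem IsRational.neg {a : PDO D} (ha : a.IsRational) : (-a).IsRational := by
  have := IsRational.mul (IsDifferential.one (D := D)).neg.isRational ha
  rwa [neg_one_mul] at this

namespace IsRationalMatrix

variable {ι κ ν : Type*}

theorem add {A B : Matrix ι κ (PDO D)} (hA : IsRationalMatrix A) (hB : IsRationalMatrix B) :
    IsRationalMatrix (A + B) := fun i j => (hA i j).add (hB i j)

theorem neg {A : Matrix ι κ (PDO D)} (hA : IsRationalMatrix A) : IsRationalMatrix (-A) :=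
  fun i j => (hA i j).neg

theorem sub {A B : Matrix ι κ (PDO D)} (hA : IsRationalMatrix A) (hB : IsRationalMatrix B) :
    IsRationalMatrix (A - B) := sub_eq_add_neg A B ▸ hA.add hB.neg

theorem mul [Fintype κ] {A : Matrix ι κ (PDO D)} {B : Matrix κ ν (PDO D)}
    (hA : IsRationalMatrix A) (hB : IsRationalMatrix B) : IsRationalMatrix (A * B) :=
  fun i j => IsRational.sum _ _ fun k _ => (hA i k).mul (hB k j)

/-- With a common denominator `b` of `A`, the columns of `A b` and the `j`-th unit vector are one
too many to be independent on the right. Multiplying their relation by `X` on the left expresses the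
`j`-th column of `X`, times the coefficient of the unit vector, by differential operators. -/
theorem of_mul_eq_one [Fintype ι] [DecidableEq ι] {A X : Matrix ι ι (PDO D)}
    (hA : IsRationalMatrix A) (hX : X * A = 1) : IsRationalMatrix X := by
  obtain ⟨b, hb, hb0, h⟩ := exists_common_denominator Finset.univ
    (fun q : ι × ι => A q.1 q.2) fun q _ => hA q.1 q.2
  intro k j
  obtain ⟨c, hc, hc0, hrel⟩ := exists_right_relation (κ := Option ι) (μ := ι) (by simp)
    (fun q i => q.elim (if i = j then 1 else 0) fun q => A i q * b) (by
      intro q i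
      cases q with
      | none =>
        dsimp only [Option.elim]
        split_ifs
        · exact IsDifferential.one
        · exact IsDifferential.zero
      | some q => exact h (i, q) (Finset.mem_univ _))
  have hX' : ∀ i, b * c (some i) + X i j * c none = 0 := by
    intro i
    have h1 : ∑ l, X i l * ((if l = j then 1 else 0) * c none + ∑ q, A l q * b * c (some q)) =
        0 := by
      refine Finset.sum_eq_zero fun l _ => ?_
      have := hrel l
      rw [Fintype.sum_option] at this
      exact (congrArg (X i l * ·) this).trans (mul_zero _)
    have h2 : ∑ q, (∑ l, X i l * A l q) * (b * c (some q)) = b * c (some i) := by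
      have h3 : ∀ q, ∑ l, X i l * A l q = if i = q then 1 else 0 := fun q => by
        rw [← Matrix.mul_apply, hX, Matrix.one_apply]
      simp only [h3, ite_mul, one_mul, zero_mul, Finset.sum_ite_eq, Finset.mem_univ, if_true]
    simp only [mul_add, Finset.sum_add_distrib, Finset.mul_sum] at h1
    rw [Finset.sum_comm] at h1
    rw [← h2, add_comm, ← h1]
    congr 1
    · simp
    · refine Finset.sum_congr rfl fun q _ => ?_
      rw [Finset.sum_mul]
      exact Finset.sum_congr rfl fun l _ => by simp only [mul_assoc]
  -- The denominator `c none` is nonzero: otherwise `hX'` gives `b * c (some i) = 0` for all `i`,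
  -- and the whole relation is trivial.
  refine ⟨-(b * c (some k)), c none, (hb.mul (hc _)).neg, hc _, fun h0 => hc0 ?_,
    eq_neg_of_add_eq_zero_right (hX' k)⟩
  ext1 q
  cases q with
  | none => exact h0
  | some i =>
    have := hX' i
    rw [h0, mul_zero, add_zero, mul_eq_zero] at this
    exact this.resolve_left hb0

end IsRationalMatrix

end PDO

/-! ### Bimodules of formal series over a differential module -/

/-- A differential module: a module `M` over `V` with an additive endomorphism `∇` such that
`∇(a m) = D(a) m + a ∇(m)`. -/
structure DiffMod {F V : Type*} [CommRing F] [CommRing V] [Algebra F V] (D : Derivation F V V)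
    (M : Type*) [AddCommGroup M] where
  act : V →+ M →+ M
  act_one : ∀ m, act 1 m = m
  act_mul : ∀ a b m, act (a * b) m = act a (act b m)
  nabla : AddMonoid.End M
  nabla_act : ∀ a m, nabla (act a m) = act (D a) m + act a (nabla m)

namespace DiffMod

open scoped PDO

open boundedAbove (star DegLE)
open PDO (derivEnd mono const OrdLE)
open MulOpposite (op)

variable {F V : Type*} [CommRing F] [CommRing V] [Algebra F V] {D : Derivation F V V}
  {M : Type*} [AddCommGroup M] (T : DiffMod D M)

theorem act_comm (a b : V) (m : M) : T.act a (T.act b m) = T.act b (T.act a m) := by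
  rw [← T.act_mul, ← T.act_mul, mul_comm]

/-- The formal Laurent series `∑_{n ≤ N} mₙ ∂ⁿ` with coefficients in a differential module. -/
def Ser (_T : DiffMod D M) : Type _ := boundedAbove M

noncomputable instance : AddCommGroup T.Ser := inferInstanceAs (AddCommGroup (boundedAbove M))

variable {T}

/-- The coefficient of `∂ⁿ`. -/
def Ser.coeff (w : T.Ser) (n : ℤ) : M := w.1 n

@[ext]
theorem Ser.ext {w w' : T.Ser} (h : ∀ n, w.coeff n = w'.coeff n) : w = w' :=
  boundedAbove.ext h

@[simp] theorem Ser.coeff_add (w w' : T.Ser) (n : ℤ) :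
    (w + w').coeff n = w.coeff n + w'.coeff n := rfl
@[simp] theorem Ser.coeff_neg (w : T.Ser) (n : ℤ) : (-w).coeff n = -w.coeff n := rfl
@[simp] theorem Ser.coeff_sub (w w' : T.Ser) (n : ℤ) :
    (w - w').coeff n = w.coeff n - w'.coeff n := rfl
@[simp] theorem Ser.coeff_zero (n : ℤ) : (0 : T.Ser).coeff n = 0 := rfl

@[simp] theorem Ser.coeff_sum {κ : Type*} (s : Finset κ) (f : κ → T.Ser) (n : ℤ) :
    (∑ i ∈ s, f i).coeff n = ∑ i ∈ s, (f i).coeff n :=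
  boundedAbove.sum_apply s f n

/-- The series `m ∂ⁿ`. -/
def Ser.mono (n : ℤ) : M →+ T.Ser := boundedAbove.single n

theorem Ser.coeff_mono (n : ℤ) (m : M) (k : ℤ) :
    (Ser.mono n m : T.Ser).coeff k = if k = n then m else 0 := boundedAbove.single_apply n m k

/-- Left composition with pseudodifferential operators. -/
noncomputable def lmul : PDO D →+ T.Ser →+ T.Ser := star T.act T.nabla

/-- Right composition with pseudodifferential operators. -/
noncomputable def rmul : T.Ser →+ PDO D →+ T.Ser := star T.act.flip (derivEnd D)

theorem coeff_mono_lmul (p : ℤ) (a : V) (w : T.Ser) (n : ℤ) :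
    (lmul (mono p a) w).coeff n = ∑ᶠ k : ℕ,
      (Ring.choose p k : ℤ) • T.act a ((⇑T.nabla)^[k] (w.coeff (n - p + k))) :=
  boundedAbove.star_single_left T.act T.nabla p a w n

theorem coeff_rmul_mono (w : T.Ser) (r : ℤ) (b : V) (n : ℤ) :
    (rmul w (mono r b)).coeff n = ∑ᶠ k : ℕ, (Ring.choose (n - r + k) k : ℤ) •
      T.act ((⇑D)^[k] b) (w.coeff (n - r + k)) :=
  boundedAbove.star_single_right T.act.flip (derivEnd D) w r b n

/-- The bimodule axioms are all cases of `star_assoc`: for this one the hypotheses are `act_mul` and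
`nabla_act`. -/
theorem lmul_mul (a b : PDO D) (w : T.Ser) : lmul (a * b) w = lmul a (lmul b w) :=
  boundedAbove.star_assoc (AddMonoidHom.mul : V →+ V →+ V) T.act T.act T.act (derivEnd D)
    T.nabla T.nabla (fun a b m => T.act_mul a b m) (fun a m => T.nabla_act a m) a b w

theorem rmul_mul (w : T.Ser) (a b : PDO D) : rmul w (a * b) = rmul (rmul w a) b :=
  (boundedAbove.star_assoc T.act.flip T.act.flip (AddMonoidHom.mul : V →+ V →+ V)
    T.act.flip (derivEnd D)
    (derivEnd D) (derivEnd D) (fun m a b => (T.act_mul b a m).symm.trans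
      (congrArg (fun x => T.act x m) (mul_comm b a)))
    (fun a b => by
      simp only [AddMonoidHom.coe_mul, AddMonoidHom.coe_mulLeft, PDO.derivEnd_apply,
        Derivation.leibniz, smul_eq_mul]
      ring) w a b).symm

theorem lmul_rmul (a : PDO D) (w : T.Ser) (b : PDO D) :
    rmul (lmul a w) b = lmul a (rmul w b) :=
  boundedAbove.star_assoc T.act T.act.flip T.act.flip T.act T.nabla
    (derivEnd D) T.nabla (fun a m b => T.act_comm b a m)
    (fun m b => (T.nabla_act b m).trans (add_comm _ _)) a w b

theorem one_lmul (w : T.Ser) : lmul 1 w = w := by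
  ext n
  rw [PDO.one_eq_mono, coeff_mono_lmul, finsum_eq_single _ 0]
  · simp [T.act_one]
  · intro k hk
    simp [Ring.choose_zero_ite, hk]

theorem rmul_one (w : T.Ser) : rmul w 1 = w := by
  ext n
  rw [PDO.one_eq_mono, coeff_rmul_mono, finsum_eq_single _ 0]
  · simp [T.act_one]
  · intro k hk
    simp [PDO.iterate_one, hk]

noncomputable instance : Module (PDO D) T.Ser where
  smul a w := lmul a w
  one_smul := one_lmul
  mul_smul := lmul_mul
  smul_zero a := map_zero (lmul a)
  smul_add a := map_add (lmul a)
  add_smul a b w := DFunLike.congr_fun (map_add lmul a b) w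
  zero_smul w := DFunLike.congr_fun (map_zero lmul) w

noncomputable instance : Module (PDO D)ᵐᵒᵖ T.Ser where
  smul a w := rmul w a.unop
  one_smul := rmul_one
  mul_smul a b w := rmul_mul w b.unop a.unop
  smul_zero a := DFunLike.congr_fun (map_zero rmul) a.unop
  smul_add a w w' := DFunLike.congr_fun (map_add rmul w w') a.unop
  add_smul a b w := map_add (rmul w) a.unop b.unop
  zero_smul w := map_zero (rmul w)

instance : SMulCommClass (PDO D) (PDO D)ᵐᵒᵖ T.Ser where
  smul_comm a b w := (lmul_rmul a w b.unop).symm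

theorem smul_eq_lmul (a : PDO D) (w : T.Ser) : a • w = lmul a w := rfl
/-- An additive map of the coefficients, applied coefficientwise. -/
def Ser.map {M' : Type*} [AddCommGroup M'] {T' : DiffMod D M'} (φ : M →+ M') :
    T.Ser →+ T'.Ser := boundedAbove.map φ

section Map

variable {φ : AddMonoid.End M}

theorem Ser.map_smul (hφ : ∀ a m, φ (T.act a m) = T.act a (φ m))
    (hφ' : ∀ m, φ (T.nabla m) = T.nabla (φ m)) (a : PDO D) (w : T.Ser) :
    (Ser.map φ (a • w) : T.Ser) = a • (Ser.map φ w : T.Ser) := by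
  refine (boundedAbove.map_star T.act T.nabla T.act T.nabla (AddMonoidHom.id V) φ φ hφ hφ'
    a w).trans ?_
  rfl

theorem Ser.map_op_smul (hφ : ∀ a m, φ (T.act a m) = T.act a (φ m)) (a : PDO D) (w : T.Ser) :
    (Ser.map φ (op a • w) : T.Ser) = op a • (Ser.map φ w : T.Ser) := by
  refine (boundedAbove.map_star T.act.flip (derivEnd D) T.act.flip (derivEnd D) φ
    (AddMonoidHom.id V) φ (fun m a => hφ a m) (fun _ => rfl) w a).trans ?_
  rfl

end Map

/-- A derivation with values in a differential module that commutes with the differentials. -/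
structure Der (T : DiffMod D M) extends V →+ M where
  leibniz : ∀ a b, toFun (a * b) = T.act a (toFun b) + T.act b (toFun a)
  comm : ∀ a, toFun (D a) = T.nabla (toFun a)

/-- The coefficientwise application of a derivation to pseudodifferential operators. -/
def Der.extend (δ : T.Der) : PDO D →+ T.Ser := boundedAbove.map δ.toAddMonoidHom

theorem Der.coeff_extend (δ : T.Der) (a : PDO D) (n : ℤ) :
    (δ.extend a).coeff n = δ.toAddMonoidHom (a.coeff n) := rfl

/-- The Leibniz rule for coefficients together with commutation with the differentials makes
`δ.extend` a derivation of the ring of operators into a bimodule, so matrix formulas can be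
differentiated without looking at coefficients. -/
theorem Der.extend_mul (δ : T.Der) (a b : PDO D) :
    δ.extend (a * b) = a • δ.extend b + op b • δ.extend a :=
  (boundedAbove.map_star_add (AddMonoidHom.mul : V →+ V →+ V) (derivEnd D) T.act.flip T.act
    T.nabla δ.toAddMonoidHom δ.toAddMonoidHom δ.toAddMonoidHom
    (fun a b => (δ.leibniz a b).trans (add_comm _ _)) δ.comm a b).trans (add_comm _ _)

/-- The pseudodifferential operators as a left module over `V`, with `∇ m = ∂ ∘ m`. -/
noncomputable def left (D : Derivation F V V) : DiffMod D (PDO D) where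
  act := (AddMonoidHom.mul : PDO D →+ PDO D →+ PDO D).comp ((const : V →+* PDO D) : V →+ PDO D)
  act_one m := by simp
  act_mul a b m := by simp [mul_assoc]
  nabla := AddMonoidHom.mulLeft (mono 1 1)
  nabla_act a m := by
    change mono 1 1 * (const a * m) = const (D a) * m + const a * (mono 1 1 * m)
    rw [← mul_assoc, ← PDO.mono_zero_eq_const (D := D) a, PDO.mono_one_mul_mono_zero,
      PDO.mono_eq 1 a]
    simp only [PDO.mono_zero_eq_const]
    noncomm_ring

theorem left_act (a : V) (m : PDO D) : (left D).act a m = const a * m := rfl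
theorem left_nabla (m : PDO D) : (left D).nabla m = mono 1 1 * m := rfl

/-- The pseudodifferential operators as a right module over `V`, with `∇ m = -m ∘ ∂`. -/
noncomputable def right (D : Derivation F V V) : DiffMod D (PDO D) where
  act := (AddMonoidHom.mul : PDO D →+ PDO D →+ PDO D).flip.comp
    ((const : V →+* PDO D) : V →+ PDO D)
  act_one m := by simp
  act_mul a b m := by
    change m * const (a * b) = m * const b * const a
    rw [mul_comm a b, map_mul, mul_assoc]
  nabla := -AddMonoidHom.mulRight (mono 1 1)
  nabla_act a m := by
    change -(m * const a * mono 1 1) = m * const (D a) + -(m * mono 1 1) * const a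
    have h : (const a * mono 1 1 : PDO D) = mono 1 1 * const a - const (D a) := by
      rw [eq_sub_iff_add_eq, ← PDO.mono_zero_eq_const (D := D) a, PDO.mono_one_mul_mono_zero,
        PDO.mono_eq 1 a]
      rfl
    rw [mul_assoc, h]
    noncomm_ring

theorem right_act (a : V) (m : PDO D) : (right D).act a m = m * const a := rfl
theorem right_nabla (m : PDO D) : (right D).nabla m = -(m * mono 1 1) := rfl

/-- Coefficientwise right multiplication. -/
noncomputable def coefRight (Q : PDO D) : AddMonoid.End (left D).Ser :=
  Ser.map (AddMonoidHom.mulRight Q)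

/-- Coefficientwise left multiplication. -/
noncomputable def coefLeft (P : PDO D) : AddMonoid.End (right D).Ser :=
  Ser.map (AddMonoidHom.mulLeft P)

theorem coeff_coefRight (Q : PDO D) (w : (left D).Ser) (n : ℤ) :
    (coefRight Q w).coeff n = w.coeff n * Q := rfl

theorem coeff_coefLeft (P : PDO D) (w : (right D).Ser) (n : ℤ) :
    (coefLeft P w).coeff n = P * w.coeff n := rfl

/-- Multiplying coefficients on the right commutes with the action of `V` and with `∇` on `left D`,
both of which multiply on the left. It thus provides a third action, commuting with the bimodule
structure. -/
theorem coefRight_smul (Q a : PDO D) (w : (left D).Ser) :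
    coefRight Q (a • w) = a • coefRight Q w :=
  Ser.map_smul (T := left D) (φ := AddMonoidHom.mulRight Q) (fun _ _ => mul_assoc _ _ _)
    (fun _ => mul_assoc _ _ _) a w

theorem coefRight_op_smul (Q a : PDO D) (w : (left D).Ser) :
    coefRight Q (op a • w) = op a • coefRight Q w :=
  Ser.map_op_smul (T := left D) (φ := AddMonoidHom.mulRight Q) (fun _ _ => mul_assoc _ _ _) a w

theorem coefLeft_smul (P a : PDO D) (w : (right D).Ser) :
    coefLeft P (a • w) = a • coefLeft P w :=
  Ser.map_smul (T := right D) (φ := AddMonoidHom.mulLeft P) (fun _ _ => (mul_assoc _ _ _).symm)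
    (fun m => by
      change P * -(m * mono 1 1) = -(P * m * mono 1 1)
      rw [mul_neg, mul_assoc]) a w

theorem coefLeft_op_smul (P a : PDO D) (w : (right D).Ser) :
    coefLeft P (op a • w) = op a • coefLeft P w :=
  Ser.map_op_smul (T := right D) (φ := AddMonoidHom.mulLeft P) (fun _ _ => (mul_assoc _ _ _).symm)
    a w

end DiffMod

/-! ### The derivative of a Dirac modification -/

section Derivation

variable {R E : Type*} [Ring R] [Ring E] {ι μ : Type*}

theorem Matrix.map_derivation_mul {α β γ : Type*} [Fintype β] (f : R →+* E) (δ : R →+ E)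
    (hδ : ∀ a b, δ (a * b) = f a * δ b + δ a * f b) (A : Matrix α β R) (B : Matrix β γ R) :
    (A * B).map δ = A.map f * B.map δ + A.map δ * B.map f := by
  ext1 i j
  simp only [Matrix.map_apply, Matrix.mul_apply, Matrix.add_apply, map_sum, hδ,
    Finset.sum_add_distrib]

variable [Fintype ι] [Fintype μ] [DecidableEq ι] [DecidableEq μ]

/-- The derivative of `H - H ∘ θ' ∘ C⁻¹ ∘ θ ∘ H`, `C = θ ∘ H ∘ θ'`. -/
theorem Matrix.map_derivation_dirac (f : R →+* E) (δ : R →+ E)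
    (hδ : ∀ a b, δ (a * b) = f a * δ b + δ a * f b) (H : Matrix ι ι R) (θ : Matrix μ ι R)
    (θ' : Matrix ι μ R) (X : Matrix μ μ R) (h₁ : X * (θ * H * θ') = 1)
    (h₂ : θ * H * θ' * X = 1) :
    (H - H * θ' * X * θ * H).map δ =
      (1 - H * θ' * X * θ).map f * H.map δ * (1 - θ' * X * θ * H).map f -
      (H - H * θ' * X * θ * H).map f * θ'.map δ * (X * θ * H).map f -
      (H * θ' * X).map f * θ.map δ * (H - H * θ' * X * θ * H).map f := by
  have hδ1 : δ 1 = 0 := by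
    have := hδ 1 1
    rw [mul_one, map_one f, one_mul, mul_one] at this
    exact left_eq_add.1 this
  -- The identity `X C = 1` is differentiated, and the result is solved for the derivative of `X` by
  -- multiplying by `X` on the right, where `C X = 1` enters.
  have hX : X.map δ = -(X.map f * ((θ * H * θ').map δ * X.map f)) := by
    have h3 : (X * (θ * H * θ')).map δ = 0 := by
      rw [h₁]
      ext i j
      rw [Matrix.map_apply, Matrix.one_apply]
      split_ifs <;> simp [hδ1]
    rw [Matrix.map_derivation_mul f δ hδ] at h3
    have h4 := congrArg (· * X.map f) h3
    simp only [add_mul, zero_mul] at h4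
    rw [Matrix.mul_assoc (X.map δ), ← Matrix.map_mul, h₂, Matrix.map_one f (map_zero f) (map_one f),
      mul_one, Matrix.mul_assoc] at h4
    exact eq_neg_of_add_eq_zero_right h4
  rw [Matrix.map_sub δ (map_sub δ), Matrix.map_sub f (map_sub f), Matrix.map_sub f (map_sub f),
    Matrix.map_sub f (map_sub f), Matrix.map_one f (map_zero f) (map_one f)]
  simp only [Matrix.map_derivation_mul f δ hδ, hX, Matrix.map_mul]
  simp only [Matrix.mul_assoc, Matrix.mul_add, Matrix.add_mul, Matrix.mul_sub, Matrix.sub_mul,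
    Matrix.neg_mul, Matrix.mul_neg, Matrix.one_mul, Matrix.mul_one]
  abel

end Derivation

namespace DiffMod

open scoped PDO

open MulOpposite (op)

variable {F V : Type*} [CommRing F] [CommRing V] [Algebra F V] {D : Derivation F V V}
  {M : Type*} [AddCommGroup M] {T : DiffMod D M} {ι μ : Type*} [Fintype ι] [Fintype μ]
  [DecidableEq ι] [DecidableEq μ]

theorem Der.map_inl_mul_map_inr_mul (δ : T.Der) {α β γ ν : Type*} [Fintype α] [Fintype β]
    (P : Matrix γ α (PDO D)) (A : Matrix α β (PDO D)) (Q : Matrix β ν (PDO D)) (i : γ) (j : ν) :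
    (P.map (TrivSqZeroExt.inlHom (PDO D) T.Ser) *
      A.map ((TrivSqZeroExt.inrHom (PDO D) T.Ser).toAddMonoidHom.comp δ.extend) *
      Q.map (TrivSqZeroExt.inlHom (PDO D) T.Ser)) i j =
      TrivSqZeroExt.inr (∑ r, ∑ s, P i r • op (Q s j) • δ.extend (A r s)) := by
  rw [Matrix.mul_apply]
  simp only [Matrix.mul_apply, Matrix.map_apply, Finset.sum_mul, TrivSqZeroExt.inr_sum]
  rw [Finset.sum_comm]
  refine Finset.sum_congr rfl fun r _ => Finset.sum_congr rfl fun s _ => ?_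
  change TrivSqZeroExt.inl _ * TrivSqZeroExt.inr _ * TrivSqZeroExt.inl _ = _
  rw [TrivSqZeroExt.inl_mul_inr, TrivSqZeroExt.inr_mul_inl,
    smul_comm (P i r) (op (Q s j))]

/-- A derivation into a bimodule becomes a derivation between rings inside the trivial square-zero
extension. There `Matrix.map_derivation_dirac` applies, and injectivity of `inr` returns the result
to the bimodule. -/
theorem Der.extend_dirac (δ : T.Der) (H : Matrix ι ι (PDO D)) (θ : Matrix μ ι (PDO D))
    (θ' : Matrix ι μ (PDO D)) (X : Matrix μ μ (PDO D)) (h₁ : X * (θ * H * θ') = 1)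
    (h₂ : θ * H * θ' * X = 1) (i j : ι) :
    δ.extend ((H - H * θ' * X * θ * H) i j) =
      ∑ r, ∑ s, (1 - H * θ' * X * θ : Matrix ι ι (PDO D)) i r •
        op ((1 - θ' * X * θ * H : Matrix ι ι (PDO D)) s j) • δ.extend (H r s) -
      ∑ l, ∑ α, (H - H * θ' * X * θ * H) i l • op ((X * θ * H) α j) • δ.extend (θ' l α) -
      ∑ α, ∑ l, (H * θ' * X) i α • op ((H - H * θ' * X * θ * H) l j) • δ.extend (θ α l) := by
  have h := congrFun (congrFun (Matrix.map_derivation_dirac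
    (TrivSqZeroExt.inlHom (PDO D) T.Ser)
    ((TrivSqZeroExt.inrHom (PDO D) T.Ser).toAddMonoidHom.comp δ.extend) (fun a b => by
      change TrivSqZeroExt.inr (δ.extend (a * b)) = TrivSqZeroExt.inl a * TrivSqZeroExt.inr _ +
        TrivSqZeroExt.inr _ * TrivSqZeroExt.inl b
      rw [Der.extend_mul, TrivSqZeroExt.inl_mul_inr, TrivSqZeroExt.inr_mul_inl,
        TrivSqZeroExt.inr_add]) H θ θ' X h₁ h₂) i) j
  rw [Matrix.sub_apply, Matrix.sub_apply, Der.map_inl_mul_map_inr_mul,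
    Der.map_inl_mul_map_inr_mul, Der.map_inl_mul_map_inr_mul, ← TrivSqZeroExt.inr_sub,
    ← TrivSqZeroExt.inr_sub] at h
  exact TrivSqZeroExt.inr_injective h

end DiffMod

/-! ### Operators on the space of series in three variables -/

namespace ThreeVar

open scoped PDO

section Basic

variable {V : Type*} [AddCommGroup V]

@[ext]
theorem ext {X Y : ThreeVar V} (h : ∀ a b c, X.1 a b c = Y.1 a b c) : X = Y :=
  Subtype.ext (funext fun a => funext fun b => funext fun c => h a b c)

@[simp] theorem add_apply (X Y : ThreeVar V) (a b c : ℤ) :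
    (X + Y).1 a b c = X.1 a b c + Y.1 a b c := rfl
@[simp] theorem sub_apply (X Y : ThreeVar V) (a b c : ℤ) :
    (X - Y).1 a b c = X.1 a b c - Y.1 a b c := rfl
@[simp] theorem neg_apply (X : ThreeVar V) (a b c : ℤ) : (-X).1 a b c = -X.1 a b c := rfl
@[simp] theorem zero_apply (a b c : ℤ) : (0 : ThreeVar V).1 a b c = 0 := rfl

/-- A coefficient as an additive map. -/
def coeffHom (a b c : ℤ) : ThreeVar V →+ V where
  toFun X := X.1 a b c
  map_zero' := rfl
  map_add' _ _ := rfl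

theorem sum_apply {κ : Type*} (s : Finset κ) (f : κ → ThreeVar V) (a b c : ℤ) :
    (∑ i ∈ s, f i).1 a b c = ∑ i ∈ s, (f i).1 a b c := map_sum (coeffHom a b c) f s

theorem mulRel_apply (X : ThreeVar V) (a b c : ℤ) :
    (mulRel X).1 a b c = X.1 a b (c - 1) - X.1 (a - 1) b c - X.1 a (b - 1) c := rfl

/-- The monomial `x λᵃ μᵇ νᶜ`. -/
def mono (a b c : ℤ) : V →+ ThreeVar V where
  toFun x := ⟨fun i j k => if i = a ∧ j = b ∧ k = c then x else 0,
    max a (max b c), fun i j k h => if_neg (by omega)⟩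
  map_zero' := by ext; simp
  map_add' x y := by
    ext i j k
    simp only [add_apply]
    split_ifs <;> simp

theorem mono_apply (a b c : ℤ) (x : V) (i j k : ℤ) :
    (mono a b c x).1 i j k = if i = a ∧ j = b ∧ k = c then x else 0 := rfl

/-- The total degree of `X` is at most `N`. -/
def DegLE (X : ThreeVar V) (N : ℤ) : Prop := ∀ a b c, N < a + b + c → X.1 a b c = 0

theorem DegLE.mono {X : ThreeVar V} {N M : ℤ} (h : DegLE X N) (hNM : N ≤ M) : DegLE X M :=
  fun a b c hn => h a b c (by omega)

/-- Additive maps that vanish in low degrees are determined by their values on monomials. -/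
theorem hom_ext {E : Type*} [AddCommGroup E] {f g : ThreeVar V →+ E}
    (hf : ∃ K, ∀ X, DegLE X K → f X = 0) (hg : ∃ K, ∀ X, DegLE X K → g X = 0)
    (h : ∀ a b c x, f (ThreeVar.mono a b c x) = g (ThreeVar.mono a b c x)) : f = g := by
  obtain ⟨K₁, hK₁⟩ := hf
  obtain ⟨K₂, hK₂⟩ := hg
  ext X
  obtain ⟨N, hN⟩ := X.2
  set K := min K₁ K₂
  -- In a nonzero coefficient of total degree above `K` all exponents are at most `N`, so each of
  -- them exceeds `K - 2 * N`.
  set s := Finset.Ioc (K - 2 * N) N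
  have hrest : DegLE (X - ∑ q ∈ s ×ˢ s ×ˢ s,
      ThreeVar.mono q.1 q.2.1 q.2.2 (X.1 q.1 q.2.1 q.2.2)) K := by
    intro a b c hn
    rw [sub_apply, sum_apply]
    by_cases hs : (a, b, c) ∈ s ×ˢ s ×ˢ s
    · rw [Finset.sum_eq_single_of_mem (a, b, c) hs, mono_apply, if_pos ⟨rfl, rfl, rfl⟩, sub_self]
      rintro ⟨i, j, k⟩ _ hne
      rw [mono_apply, if_neg]
      rintro ⟨rfl, rfl, rfl⟩
      exact hne rfl
    · rw [hN, Finset.sum_eq_zero, sub_zero]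
      · rintro ⟨i, j, k⟩ hq
        rw [mono_apply, if_neg]
        rintro ⟨rfl, rfl, rfl⟩
        exact hs hq
      · simp only [s, Finset.mem_product, Finset.mem_Ioc] at hs
        omega
  have h1 := hK₁ _ (hrest.mono (min_le_left _ _))
  have h2 := hK₂ _ (hrest.mono (min_le_right _ _))
  rw [map_sub, sub_eq_zero, map_sum] at h1 h2
  rw [h1, h2]
  exact Finset.sum_congr rfl fun q _ => h _ _ _ _

/-- The exchange of `λ` and `μ`. -/
def swap : ThreeVar V →+ ThreeVar V where
  toFun X := ⟨fun a b c => X.1 b a c, by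
    obtain ⟨N, hN⟩ := X.2
    exact ⟨N, fun a b c h => hN b a c (by tauto)⟩⟩
  map_zero' := rfl
  map_add' _ _ := rfl

@[simp] theorem swap_apply (X : ThreeVar V) (a b c : ℤ) : (swap X).1 a b c = X.1 b a c := rfl

theorem swap_mono (a b c : ℤ) (x : V) : swap (mono a b c x) = mono b a c x := by
  ext i j k
  simp only [swap_apply, mono_apply]
  exact if_congr (by tauto) rfl rfl

theorem swap_mulRel (X : ThreeVar V) : swap (mulRel X) = mulRel (swap X) := by
  ext a b c
  simp only [swap_apply, mulRel_apply]
  abel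

theorem DegLE.swap {X : ThreeVar V} {N : ℤ} (h : DegLE X N) : DegLE (swap X) N :=
  fun a b c hn => h b a c (by omega)

theorem expandMuLambda_support (X : ThreeVar V) (i j : ℤ) :
    (Function.support fun q : ℕ × ℤ =>
      (Ring.choose q.2 q.1 : ℤ) • X.1 (i - q.1) (j - q.2 + q.1) q.2).Finite := by
  obtain ⟨N, hN⟩ := X.2
  refine ((Finset.range (2 * N - j + 1).toNat) ×ˢ (Finset.Icc (j - N) N)).finite_toSet.subset ?_
  rintro ⟨k, c⟩ hq
  have h : ¬ (N < i - k ∨ N < j - c + k ∨ N < c) := by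
    intro h
    exact hq (by simp only [hN _ _ _ h, smul_zero])
  simp only [Finset.coe_product, Set.mem_prod, Finset.coe_Icc, Set.mem_Icc, Finset.coe_range,
    Set.mem_Iio]
  omega

theorem expandLambdaNu_support (X : ThreeVar V) (i j : ℤ) :
    (Function.support fun q : ℕ × ℤ => ((Int.negOnePow (q.2 - q.1) : ℤ) * Ring.choose q.2 q.1) •
      X.1 (i - q.2 + q.1) q.2 (j - q.1)).Finite := by
  obtain ⟨N, hN⟩ := X.2
  refine ((Finset.range (2 * N - i + 1).toNat) ×ˢ (Finset.Icc (i - N) N)).finite_toSet.subset ?_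
  rintro ⟨k, c⟩ hq
  have h : ¬ (N < i - c + k ∨ N < c ∨ N < j - k) := by
    intro h
    exact hq (by simp only [hN _ _ _ h, smul_zero])
  simp only [Finset.coe_product, Set.mem_prod, Finset.coe_Icc, Set.mem_Icc, Finset.coe_range,
    Set.mem_Iio]
  omega

theorem DegLE.expandMuLambda {X : ThreeVar V} {N : ℤ} (h : DegLE X N) {i j : ℤ}
    (hij : N < i + j) : expandMuLambda X i j = 0 :=
  (finsum_congr fun q => by rw [h _ _ _ (by omega), smul_zero]).trans finsum_zero

theorem DegLE.expandLambdaNu {X : ThreeVar V} {N : ℤ} (h : DegLE X N) {i j : ℤ}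
    (hij : N < i + j) : expandLambdaNu X i j = 0 :=
  (finsum_congr fun q => by rw [h _ _ _ (by omega), smul_zero]).trans finsum_zero

theorem exists_degLE (X : ThreeVar V) : ∃ N, DegLE X N := by
  obtain ⟨N, hN⟩ := X.2
  exact ⟨3 * N, fun a b c h => hN a b c (by omega)⟩

end Basic

variable {F V : Type*} [CommRing F] [CommRing V] [Algebra F V] {D : Derivation F V V}

open PDO (OrdLE)
open DiffMod (Ser rmul lmul coefRight coefLeft)
open MulOpposite (op)

/-- The expansion in the domain `|μ| > |λ|`, as a series in `μ` of series in `λ`. -/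
noncomputable def expandLeft : ThreeVar V →+ (DiffMod.left D).Ser where
  toFun X := ⟨fun j => ⟨fun i => expandMuLambda X i j, by
      obtain ⟨N, hN⟩ := exists_degLE X
      exact ⟨N - j, fun i hi => hN.expandMuLambda (by omega)⟩⟩, by
    obtain ⟨N, hN⟩ := X.2
    refine ⟨2 * N, fun j hj => PDO.ext fun i => ?_⟩
    refine (finsum_congr fun q => ?_).trans finsum_zero
    rw [hN _ _ _ (by omega), smul_zero]⟩
  map_zero' := by
    refine Ser.ext fun j => PDO.ext fun i => ?_
    exact (finsum_congr fun q => by simp).trans finsum_zero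
  map_add' X Y := by
    refine Ser.ext fun j => PDO.ext fun i => ?_
    refine Eq.trans ?_ (finsum_add_distrib (expandMuLambda_support X i j)
      (expandMuLambda_support Y i j))
    exact finsum_congr fun q => by simp

theorem coeff_expandLeft (X : ThreeVar V) (i j : ℤ) :
    ((expandLeft X : (DiffMod.left D).Ser).coeff j).coeff i = expandMuLambda X i j := rfl

/-- The expansion in the domain `|λ| > |ν|`, as a series in `λ` of series in `ν`. -/
noncomputable def expandRight : ThreeVar V →+ (DiffMod.right D).Ser where
  toFun X := ⟨fun i => ⟨fun j => expandLambdaNu X i j, by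
      obtain ⟨N, hN⟩ := exists_degLE X
      exact ⟨N - i, fun j hj => hN.expandLambdaNu (by omega)⟩⟩, by
    obtain ⟨N, hN⟩ := X.2
    refine ⟨2 * N, fun j hj => PDO.ext fun i => ?_⟩
    refine (finsum_congr fun q => ?_).trans finsum_zero
    rw [hN _ _ _ (by omega), smul_zero]⟩
  map_zero' := by
    refine Ser.ext fun j => PDO.ext fun i => ?_
    exact (finsum_congr fun q => by simp).trans finsum_zero
  map_add' X Y := by
    refine Ser.ext fun i => PDO.ext fun j => ?_
    refine Eq.trans ?_ (finsum_add_distrib (expandLambdaNu_support X i j)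
      (expandLambdaNu_support Y i j))
    exact finsum_congr fun q => by simp

theorem coeff_expandRight (X : ThreeVar V) (i j : ℤ) :
    ((expandRight X : (DiffMod.right D).Ser).coeff i).coeff j = expandLambdaNu X i j := rfl

theorem expandMuLambda_swap (X : ThreeVar V) (i j : ℤ) :
    expandMuLambda (swap X) j i = expandLambdaMu X i j := rfl

/-- The coefficient of `λᵃ μᵇ` as an operator in `ν`. -/
noncomputable def row (a b : ℤ) : ThreeVar V →+ PDO D where
  toFun X := ⟨fun c => X.1 a b c, by
    obtain ⟨N, hN⟩ := X.2
    exact ⟨N, fun c hc => hN a b c (by tauto)⟩⟩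
  map_zero' := rfl
  map_add' _ _ := rfl

theorem coeff_row (a b : ℤ) (X : ThreeVar V) (c : ℤ) :
    (row a b X : PDO D).coeff c = X.1 a b c := rfl

/-- The coefficient of `μᵇ` as a series in `λ` of series in `ν`. -/
noncomputable def slice (b : ℤ) : ThreeVar V →+ (DiffMod.right D).Ser where
  toFun X := ⟨fun a => row a b X, by
    obtain ⟨N, hN⟩ := X.2
    exact ⟨N, fun a ha => PDO.ext fun c => hN a b c (by tauto)⟩⟩
  map_zero' := rfl
  map_add' _ _ := rfl

theorem coeff_slice (b : ℤ) (X : ThreeVar V) (a : ℤ) :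
    (slice b X : (DiffMod.right D).Ser).coeff a = row a b X := rfl

/-! #### Degree estimates -/

theorem ordLE_finsum {κ : Type*} {f : κ → PDO D} {N : ℤ} (h : ∀ i, OrdLE (f i) N) :
    OrdLE (∑ᶠ i, f i) N :=
  finsum_induction (fun a => OrdLE a N) (fun _ _ => rfl)
    (fun a b ha hb n hn => by rw [PDO.coeff_add, ha n hn, hb n hn, add_zero]) h

theorem ordLE_zsmul {a : PDO D} {N : ℤ} (h : OrdLE a N) (k : ℤ) : OrdLE (k • a) N :=
  fun n hn => by rw [PDO.coeff_zsmul, h n hn, smul_zero]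

/-- The total degree of a series of operators is at most `N`. -/
def _root_.DiffMod.Ser.BiLE {T : DiffMod D (PDO D)} (w : T.Ser) (N : ℤ) : Prop :=
  ∀ n, OrdLE (w.coeff n) (N - n)

section

variable {T : DiffMod D (PDO D)} {w : T.Ser} {N : ℤ}

theorem biLE_rmul (hT : ∀ a m K, OrdLE m K → OrdLE (T.act a m) K) (hw : w.BiLE N) {Q : PDO D}
    {M : ℤ} (hQ : OrdLE Q M) : (op Q • w).BiLE (N + M) := by
  intro n
  change OrdLE (∑ᶠ q : ℤ × ℕ, (Ring.choose q.1 q.2 : ℤ) •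
    T.act ((⇑D)^[q.2] (Q.coeff (n - q.1 + q.2))) (w.coeff q.1)) (N + M - n)
  refine ordLE_finsum fun q => ?_
  rcases lt_or_ge M (n - q.1 + q.2) with h | h
  · rw [hQ _ h, iterate_map_zero, map_zero, AddMonoidHom.zero_apply, smul_zero]
    exact fun _ _ => rfl
  · exact ordLE_zsmul (hT _ _ _ ((hw q.1).mono (by omega))) _

/-- Right composition differentiates only the coefficients of `Q`, so a uniform bound on the orders
of the coefficients persists. This bounds the exponent of `ν` in `opR₁`. -/
theorem ordLE_rmul (hT : ∀ a m K, OrdLE m K → OrdLE (T.act a m) K)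
    (hw : ∀ n, OrdLE (w.coeff n) N) (Q : PDO D) (n : ℤ) : OrdLE ((op Q • w).coeff n) N := by
  change OrdLE (∑ᶠ q : ℤ × ℕ, (Ring.choose q.1 q.2 : ℤ) •
    T.act ((⇑D)^[q.2] (Q.coeff (n - q.1 + q.2))) (w.coeff q.1)) N
  exact ordLE_finsum fun q => ordLE_zsmul (hT _ _ _ (hw q.1)) _

/-- Each `∇` raises the order of a coefficient by at most one and at the same time costs one power
of the outer variable, so total degrees add. -/
theorem biLE_lmul (hT : ∀ a m K, OrdLE m K → OrdLE (T.act a m) K)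
    (hT' : ∀ m K, OrdLE m K → OrdLE (T.nabla m) (K + 1)) (hw : w.BiLE N) {P : PDO D}
    {M : ℤ} (hP : OrdLE P M) : (P • w).BiLE (N + M) := by
  have hit : ∀ (k : ℕ) m K, OrdLE m K → OrdLE ((⇑T.nabla)^[k] m) (K + k) := by
    intro k
    induction k with
    | zero => intro m K h; simpa using h
    | succ k ih =>
      intro m K h
      rw [Function.iterate_succ_apply']
      exact (hT' _ _ (ih m K h)).mono (by push_cast; omega)
  intro n
  change OrdLE (∑ᶠ q : ℤ × ℕ, (Ring.choose q.1 q.2 : ℤ) •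
    T.act (P.coeff q.1) ((⇑T.nabla)^[q.2] (w.coeff (n - q.1 + q.2)))) (N + M - n)
  refine ordLE_finsum fun q => ?_
  rcases lt_or_ge M q.1 with h | h
  · rw [hP _ h, map_zero, AddMonoidHom.zero_apply, smul_zero]
    exact fun _ _ => rfl
  · exact ordLE_zsmul (hT _ _ _ ((hit _ _ _ (hw _)).mono (by omega))) _

end

theorem ordLE_left_act (a : V) (m : PDO D) (K : ℤ) (h : OrdLE m K) :
    OrdLE ((DiffMod.left D).act a m) K :=
  ((PDO.ordLE_mono 0 a).mul h).mono (by omega)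

theorem ordLE_left_nabla (m : PDO D) (K : ℤ) (h : OrdLE m K) :
    OrdLE ((DiffMod.left D).nabla m) (K + 1) :=
  ((PDO.ordLE_mono 1 1).mul h).mono (by omega)

theorem ordLE_right_act (a : V) (m : PDO D) (K : ℤ) (h : OrdLE m K) :
    OrdLE ((DiffMod.right D).act a m) K :=
  (h.mul (PDO.ordLE_mono 0 a)).mono (by omega)

theorem ordLE_right_nabla (m : PDO D) (K : ℤ) (h : OrdLE m K) :
    OrdLE ((DiffMod.right D).nabla m) (K + 1) := by
  intro n hn
  rw [DiffMod.right_nabla, PDO.coeff_neg, (h.mul (PDO.ordLE_mono 1 1)) n hn, neg_zero]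

theorem DegLE.row {X : ThreeVar V} {N : ℤ} (h : DegLE X N) (a b : ℤ) :
    OrdLE (row a b X : PDO D) (N - a - b) := fun c hc => h a b c (by omega)

theorem DegLE.slice {X : ThreeVar V} {N : ℤ} (h : DegLE X N) (b : ℤ) :
    (slice b X : (DiffMod.right D).Ser).BiLE (N - b) := fun a c hc => h a b c (by omega)

theorem DegLE.expandLeft {X : ThreeVar V} {N : ℤ} (h : DegLE X N) :
    (expandLeft X : (DiffMod.left D).Ser).BiLE N := fun _ _ hi => h.expandMuLambda (by omega)

theorem DegLE.expandRight {X : ThreeVar V} {N : ℤ} (h : DegLE X N) :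
    (expandRight X : (DiffMod.right D).Ser).BiLE N := fun _ _ hi => h.expandLambdaNu (by omega)

/-! #### The operators -/

/-- The operator `X ↦ P(ν + ∂) X`. -/
noncomputable def opL (P : PDO D) : ThreeVar V →+ ThreeVar V where
  toFun X := ⟨fun a b c => (P * row a b X).coeff c, by
    obtain ⟨N, hN⟩ := X.2
    obtain ⟨M, hM⟩ := P.exists_ordLE
    refine ⟨max N (M + N), fun a b c h => ?_⟩
    by_cases h' : N < a ∨ N < b
    · have h0 : (row a b X : PDO D) = 0 := PDO.ext fun c => hN a b c (by tauto)
      dsimp only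
      rw [h0, mul_zero, PDO.coeff_zero]
    · exact (hM.mul (b := row a b X) (M := N) fun c hc => hN a b c (by tauto)) c (by omega)⟩
  map_zero' := by
    ext a b c
    simp
  map_add' X Y := by
    ext a b c
    simp [mul_add]

theorem row_opL (P : PDO D) (X : ThreeVar V) (a b : ℤ) : row a b (opL P X) = P * row a b X := rfl

/-- The operator `X ↦ X(λ + ∂, μ, ν + ∂) Q(λ)`. -/
noncomputable def opR₁ (Q : PDO D) : ThreeVar V →+ ThreeVar V where
  toFun X := ⟨fun a b c => ((op Q • (slice b X : (DiffMod.right D).Ser)).coeff a).coeff c, by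
    obtain ⟨N, hN⟩ := X.2
    obtain ⟨M, hM⟩ := Q.exists_ordLE
    refine ⟨max N (N + M), fun a b c h => ?_⟩
    rcases lt_or_ge N b with hb | hb
    · have h0 : (slice b X : (DiffMod.right D).Ser) = 0 :=
        Ser.ext fun a => PDO.ext fun c => hN a b c (by tauto)
      dsimp only
      rw [h0, smul_zero, Ser.coeff_zero, PDO.coeff_zero]
    rcases lt_or_ge N c with hc | hc
    · exact ordLE_rmul ordLE_right_act (w := slice b X) (N := N)
        (fun a c hc => hN a b c (by tauto)) Q a c hc
    · have := boundedAbove.DegLE.star (β := (DiffMod.right D).act.flip) (d := PDO.derivEnd D)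
        (a := (slice b X : (DiffMod.right D).Ser)) (b := PDO.toFamily Q) (N := N) (M := M)
        (fun a ha => PDO.ext fun c => hN a b c (by tauto)) hM a (by omega)
      exact congrArg (fun x : PDO D => x.coeff c) this⟩
  map_zero' := by
    ext a b c
    simp
  map_add' X Y := by
    ext a b c
    simp

theorem slice_opR₁ (Q : PDO D) (X : ThreeVar V) (b : ℤ) :
    (slice b (opR₁ Q X) : (DiffMod.right D).Ser) = op Q • slice b X := rfl

/-- The operator `X ↦ X(λ, μ + ∂, ν + ∂) Q(μ)`. -/
noncomputable def opR₂ (Q : PDO D) : ThreeVar V →+ ThreeVar V := swap.comp ((opR₁ Q).comp swap)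

theorem swap_opR₁ (Q : PDO D) (X : ThreeVar V) : swap (opR₁ Q X) = opR₂ Q (swap X) := rfl
theorem swap_opR₂ (Q : PDO D) (X : ThreeVar V) : swap (opR₂ Q X) = opR₁ Q (swap X) := rfl
theorem swap_opL (P : PDO D) (X : ThreeVar V) : swap (opL P X) = opL P (swap X) := rfl

theorem DegLE.opL {X : ThreeVar V} {N : ℤ} (h : DegLE X N) {P : PDO D} {M : ℤ}
    (hP : OrdLE P M) : DegLE (opL P X) (N + M) :=
  fun a b c hc => (hP.mul (h.row a b)) c (by omega)

theorem DegLE.opR₁ {X : ThreeVar V} {N : ℤ} (h : DegLE X N) {Q : PDO D} {M : ℤ}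
    (hQ : OrdLE Q M) : DegLE (opR₁ Q X) (N + M) :=
  fun a b c hc => (biLE_rmul ordLE_right_act (h.slice b) hQ) a c (by omega)

theorem DegLE.opR₂ {X : ThreeVar V} {N : ℤ} (h : DegLE X N) {Q : PDO D} {M : ℤ}
    (hQ : OrdLE Q M) : DegLE (opR₂ Q X) (N + M) :=
  (h.swap.opR₁ hQ).swap

theorem row_mulRel (X : ThreeVar V) (a b : ℤ) : (row a b (mulRel X) : PDO D) =
    row a b X * PDO.mono 1 1 - row (a - 1) b X - row a (b - 1) X := by
  ext c
  rw [PDO.coeff_sub, PDO.coeff_sub, PDO.coeff_mul_mono_one]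
  rfl

/-- On rows `ν` is right multiplication by `∂`, and `λ`, `μ` are shifts; left multiplication by `P`
commutes with all three. -/
theorem opL_mulRel (P : PDO D) (X : ThreeVar V) : opL P (mulRel X) = mulRel (opL P X) := by
  ext a b c
  change (row a b (opL P (mulRel X)) : PDO D).coeff c = (row a b (mulRel (opL P X)) : PDO D).coeff c
  rw [row_opL, row_mulRel, row_mulRel, mul_sub, mul_sub, ← mul_assoc, row_opL, row_opL, row_opL]

theorem coeff_mono_one_smul {M : Type*} [AddCommGroup M] {T : DiffMod D M} (w : T.Ser) (n : ℤ) :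
    ((PDO.mono 1 1 : PDO D) • w).coeff n = w.coeff (n - 1) + T.nabla (w.coeff n) := by
  rw [DiffMod.smul_eq_lmul, DiffMod.coeff_mono_lmul,
    finsum_eq_sum_of_support_subset (s := Finset.range 2)]
  · simp [Finset.sum_range_succ, T.act_one]
  · intro k hk
    simp only [Finset.coe_range, Set.mem_Iio]
    by_contra h
    refine hk ?_
    have h2 := Ring.choose_natCast (R := ℤ) 1 k
    rw [Nat.choose_eq_zero_of_lt (by omega), Nat.cast_one, Nat.cast_zero] at h2
    simp only [h2, zero_smul]

/-- In `right D` the variable `ν` acts on coefficients as `-∇`, so `ν - λ` acts on series in `λ` as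
`-∂` from the left. This makes the relation visibly compatible with right composition. -/
theorem slice_mulRel (X : ThreeVar V) (b : ℤ) : (slice b (mulRel X) : (DiffMod.right D).Ser) =
    -((PDO.mono 1 1 : PDO D) • slice b X) - slice (b - 1) X := by
  refine Ser.ext fun a => ?_
  rw [coeff_slice, row_mulRel, Ser.coeff_sub, Ser.coeff_neg, coeff_mono_one_smul,
    DiffMod.right_nabla, coeff_slice, coeff_slice, coeff_slice]
  abel

theorem opR₁_mulRel (Q : PDO D) (X : ThreeVar V) : opR₁ Q (mulRel X) = mulRel (opR₁ Q X) := by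
  ext a b c
  change ((slice b (opR₁ Q (mulRel X)) : (DiffMod.right D).Ser).coeff a).coeff c =
    ((slice b (mulRel (opR₁ Q X)) : (DiffMod.right D).Ser).coeff a).coeff c
  rw [slice_opR₁, slice_mulRel, slice_mulRel, smul_sub, smul_neg, slice_opR₁, slice_opR₁,
    smul_comm (PDO.mono 1 1) (op Q)]

theorem opR₂_mulRel (Q : PDO D) (X : ThreeVar V) : opR₂ Q (mulRel X) = mulRel (opR₂ Q X) := by
  change swap (opR₁ Q (swap (mulRel X))) = mulRel (swap (opR₁ Q (swap X)))
  rw [swap_mulRel, opR₁_mulRel, swap_mulRel]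

end ThreeVar

/-! ### Equivariance of the expansions -/

namespace ThreeVar

open scoped PDO

open PDO (OrdLE const)
open DiffMod.Ser (BiLE)
open DiffMod (Ser lmul rmul coefRight coefLeft)
open MulOpposite (op)

variable {F V : Type*} [CommRing F] [CommRing V] [Algebra F V] {D : Derivation F V V}

section Continuity

variable {T : DiffMod D (PDO D)}

theorem _root_.DiffMod.Ser.BiLE.mono {w : T.Ser} {N M : ℤ} (h : w.BiLE N) (hNM : N ≤ M) :
    w.BiLE M :=
  fun n => (h n).mono (by omega)

theorem biLE_mono (n : ℤ) {m : PDO D} {K : ℤ} (h : OrdLE m K) :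
    (Ser.mono n m : T.Ser).BiLE (n + K) := by
  intro k
  rw [Ser.coeff_mono]
  split_ifs with hk
  · exact h.mono (by omega)
  · exact fun _ _ => rfl

theorem biLE_zsmul {w : T.Ser} {N : ℤ} (h : w.BiLE N) (k : ℤ) : (k • w).BiLE N :=
  fun n => by
    have h1 : (k • w).coeff n = k • w.coeff n := map_zsmul (boundedAbove.coeffHom n) k w
    rw [h1]
    exact ordLE_zsmul (h n) k

/-- A bounded shift of the total degree lets every double coefficient ignore the low-order part of
the argument, so comparison on monomials suffices; `ser_three_hom_ext` is the same principle for
series in three variables. -/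
theorem ser_hom_ext {f g : PDO D →+ T.Ser} (hf : ∃ N, ∀ a K, OrdLE a K → (f a).BiLE (K + N))
    (hg : ∃ N, ∀ a K, OrdLE a K → (g a).BiLE (K + N))
    (h : ∀ n x, f (PDO.mono n x) = g (PDO.mono n x)) : f = g := by
  obtain ⟨N, hN⟩ := hf
  obtain ⟨M, hM⟩ := hg
  refine AddMonoidHom.ext fun a => Ser.ext fun n => PDO.ext fun i => ?_
  refine DFunLike.congr_fun (PDO.hom_ext
    (f := ((PDO.coeffHom i).comp (boundedAbove.coeffHom n)).comp f)
    (g := ((PDO.coeffHom i).comp (boundedAbove.coeffHom n)).comp g)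
    ⟨n + i - N - 1, fun a ha => hN a _ ha n i (by omega)⟩
    ⟨n + i - M - 1, fun a ha => hM a _ ha n i (by omega)⟩ fun k x => ?_) a
  exact congrArg (fun w : T.Ser => (w.coeff n).coeff i) (h k x)

theorem ser_three_hom_ext {f g : ThreeVar V →+ T.Ser}
    (hf : ∃ N, ∀ X K, DegLE X K → (f X).BiLE (K + N))
    (hg : ∃ N, ∀ X K, DegLE X K → (g X).BiLE (K + N))
    (h : ∀ a b c x, f (mono a b c x) = g (mono a b c x)) : f = g := by
  obtain ⟨N, hN⟩ := hf
  obtain ⟨M, hM⟩ := hg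
  refine AddMonoidHom.ext fun a => Ser.ext fun n => PDO.ext fun i => ?_
  refine DFunLike.congr_fun (hom_ext
    (f := ((PDO.coeffHom i).comp (boundedAbove.coeffHom n)).comp f)
    (g := ((PDO.coeffHom i).comp (boundedAbove.coeffHom n)).comp g)
    ⟨n + i - N - 1, fun a ha => hN a _ ha n i (by omega)⟩
    ⟨n + i - M - 1, fun a ha => hM a _ ha n i (by omega)⟩ fun a b c x => ?_) a
  exact congrArg (fun w : T.Ser => (w.coeff n).coeff i) (h a b c x)

end Continuity

section Monomials

/-- In `m ∂ᵇ ∘ Q` the element `m` is never differentiated, so the coefficients of `∂ᵇ ∘ Q` simply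
act on it. -/
theorem op_smul_mono {M : Type*} [AddCommGroup M] {T : DiffMod D M} (Q : PDO D) (b : ℤ) (m : M)
    (n : ℤ) : (op Q • (Ser.mono b m : T.Ser)).coeff n =
      T.act ((PDO.mono b 1 * Q).coeff n) m := by
  refine (boundedAbove.star_single_left T.act.flip (PDO.derivEnd D) b m (PDO.toFamily Q) n).trans ?_
  have h : (PDO.mono b 1 * Q).coeff n = ∑ᶠ k : ℕ, (Ring.choose b k : ℤ) •
      ((1 : V) * (⇑D)^[k] (Q.coeff (n - b + k))) :=
    boundedAbove.star_single_left (AddMonoidHom.mul : V →+ V →+ V) (PDO.derivEnd D) b 1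
      (PDO.toFamily Q) n
  have hfin : (Function.support fun k : ℕ => (Ring.choose b k : ℤ) •
      ((1 : V) * (⇑D)^[k] (Q.coeff (n - b + k)))).Finite := by
    obtain ⟨N, hN⟩ := Q.exists_ordLE
    refine (Finset.range (N - n + b + 1).toNat).finite_toSet.subset fun k hk => ?_
    have : ¬ N < n - b + k := fun h => hk (by simp [hN _ h, iterate_map_zero])
    simp only [Finset.coe_range, Set.mem_Iio]
    omega
  rw [h]
  have h2 := (T.act.flip m).map_finsum hfin
  refine Eq.trans ?_ h2.symm
  refine finsum_congr fun k => ?_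
  rw [map_zsmul, one_mul]
  rfl

theorem op_mono_smul_mono {M : Type*} [AddCommGroup M] {T : DiffMod D M} (n : ℤ) (y : V) (m : M) :
    op (PDO.mono n y : PDO D) • (Ser.mono 0 m : T.Ser) = Ser.mono n (T.act y m) := by
  refine Ser.ext fun k => ?_
  rw [op_smul_mono, ← PDO.one_eq_mono, one_mul, PDO.coeff_mono, Ser.coeff_mono]
  split_ifs
  · rfl
  · rw [map_zero, AddMonoidHom.zero_apply]

theorem const_smul_mono {M : Type*} [AddCommGroup M] {T : DiffMod D M} (n : ℤ) (y : V) (m : M) :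
    (const y : PDO D) • (Ser.mono n m : T.Ser) = Ser.mono n (T.act y m) := by
  refine Ser.ext fun k => ?_
  refine (boundedAbove.star_single_single T.act T.nabla 0 y n m k).trans ?_
  rw [intChoose_zero_left, Ser.coeff_mono]
  rcases eq_or_ne k n with rfl | h
  · simp
  · rw [if_neg (by omega), if_neg h, zero_smul]

theorem mono_smul_mono_coeff {M : Type*} [AddCommGroup M] {T : DiffMod D M} (p : ℤ) (x : V) (n : ℤ)
    (m : M) (k : ℤ) : ((PDO.mono p x : PDO D) • (Ser.mono n m : T.Ser)).coeff k =
      intChoose p (p + n - k) • T.act x ((⇑T.nabla)^[(p + n - k).toNat] m) :=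
  boundedAbove.star_single_single T.act T.nabla p x n m k

/-- The series `A(ν) λᵃ μᵇ`. -/
noncomputable def monoRow (a b : ℤ) : PDO D →+ ThreeVar V where
  toFun A := ⟨fun i j c => if i = a ∧ j = b then A.coeff c else 0, by
    obtain ⟨N, hN⟩ := A.exists_ordLE
    refine ⟨max N (max a b), fun i j c h => ?_⟩
    dsimp only
    split_ifs with h'
    · exact hN c (by omega)
    · rfl⟩
  map_zero' := by ext; simp
  map_add' A B := by
    ext i j c
    simp only [add_apply]
    split_ifs <;> simp

theorem monoRow_apply (a b : ℤ) (A : PDO D) (i j c : ℤ) :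
    (monoRow a b A).1 i j c = if i = a ∧ j = b then A.coeff c else 0 := rfl

theorem monoRow_mono (a b c : ℤ) (x : V) :
    monoRow a b (PDO.mono c x : PDO D) = mono a b c x := by
  ext i j k
  rw [monoRow_apply, mono_apply, PDO.coeff_mono]
  split_ifs <;> first | rfl | tauto

theorem row_monoRow (a b : ℤ) (A : PDO D) (i j : ℤ) :
    (row i j (monoRow a b A) : PDO D) = if i = a ∧ j = b then A else 0 := by
  ext c
  rw [coeff_row, monoRow_apply]
  split_ifs <;> rfl

theorem swap_monoRow (a b : ℤ) (A : PDO D) : swap (monoRow a b A) = monoRow b a A := by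
  ext i j k
  rw [swap_apply, monoRow_apply, monoRow_apply]
  exact if_congr (by tauto) rfl rfl

theorem degLE_monoRow (a b : ℤ) {A : PDO D} {K : ℤ} (h : OrdLE A K) :
    DegLE (monoRow a b A) (a + b + K) := by
  intro i j c hc
  rw [monoRow_apply]
  split_ifs with h'
  · exact h c (by omega)
  · rfl

theorem iterate_left_nabla (k : ℕ) (a : ℤ) :
    (⇑(DiffMod.left D).nabla)^[k] (PDO.mono a 1) = PDO.mono (a + k) 1 := by
  induction k with
  | zero => simp
  | succ k ih =>
    rw [Function.iterate_succ_apply', ih, DiffMod.left_nabla, PDO.mono_mul_mono_one]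
    congr 1
    push_cast
    ring_nf

theorem iterate_right_nabla (k : ℕ) (A : PDO D) :
    (⇑(DiffMod.right D).nabla)^[k] A = (Int.negOnePow k : ℤ) • (A * PDO.mono k 1) := by
  induction k with
  | zero => simp [← PDO.one_eq_mono]
  | succ k ih =>
    rw [Function.iterate_succ_apply', ih, map_zsmul, DiffMod.right_nabla, mul_assoc,
      PDO.mono_mul_mono_one, Nat.cast_succ, negOnePow_succ_coe, neg_smul, smul_neg]

/-- In `left D` the map `∇` takes `λᵃ` to `λᵃ⁺¹`. The binomial expansion of `(λ + μ)ᶜ` for `|μ| >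
|λ|` is therefore the formula for `∂ᶜ` acting from the left on series in `μ`. -/
theorem expandLeft_mono (a b c : ℤ) (x : V) : (expandLeft (mono a b c x) : (DiffMod.left D).Ser) =
    (PDO.mono c x : PDO D) • Ser.mono b (PDO.mono a 1) := by
  refine Ser.ext fun j => PDO.ext fun i => ?_
  rw [coeff_expandLeft, mono_smul_mono_coeff, iterate_left_nabla, PDO.coeff_zsmul,
    DiffMod.left_act, PDO.coeff_const_mul, PDO.coeff_mono, expandMuLambda]
  rcases lt_or_ge (c + b - j) 0 with hk | hk
  · rw [intChoose_of_neg _ hk, zero_smul]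
    refine (finsum_congr fun q => ?_).trans finsum_zero
    rw [mono_apply, if_neg (by omega), smul_zero]
  · obtain ⟨k, hk'⟩ := Int.eq_ofNat_of_zero_le hk
    rw [hk', intChoose_natCast, Int.toNat_natCast, finsum_eq_single _ (k, c)]
    · rw [mono_apply]
      by_cases h : i = a + k
      · rw [if_pos h, if_pos (by omega), mul_one]
      · rw [if_neg h, if_neg (by omega), mul_zero]
    · rintro ⟨k', c'⟩ hne
      rw [mono_apply, if_neg, smul_zero]
      rintro ⟨h1, h2, h3⟩
      dsimp only at h1 h2 h3
      exact hne (by ext <;> dsimp only <;> omega)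

theorem expandLeft_monoRow (a b : ℤ) (A : PDO D) :
    (expandLeft (monoRow a b A) : (DiffMod.left D).Ser) = A • Ser.mono b (PDO.mono a 1) := by
  refine DFunLike.congr_fun (ser_hom_ext (f := expandLeft.comp (monoRow a b))
    (g := lmul.flip (Ser.mono b (PDO.mono a 1))) ⟨a + b, fun A K h => ?_⟩
    ⟨a + b, fun A K h => ?_⟩ fun c x => ?_) A
  · exact BiLE.mono ((degLE_monoRow a b h).expandLeft) (by omega)
  · exact BiLE.mono (biLE_lmul (T := DiffMod.left D) ordLE_left_act ordLE_left_nabla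
      (biLE_mono b (PDO.ordLE_mono a 1)) h) (by omega)
  · change expandLeft (monoRow a b _) = _
    rw [monoRow_mono, expandLeft_mono]
    rfl

/-- The variable `μ = ν - λ` acts as `-∂` from the left on series in `λ`, because `∇` on `right D`
is multiplication by `-ν`. Hence the power of `∂` and its sign. -/
theorem expandRight_monoRow (a b : ℤ) (A : PDO D) :
    (expandRight (monoRow a b A) : (DiffMod.right D).Ser) =
      (Int.negOnePow b : ℤ) • (PDO.mono b 1 : PDO D) • Ser.mono a A := by
  refine Ser.ext fun i => PDO.ext fun j => ?_
  have h1 : ((Int.negOnePow b : ℤ) • (PDO.mono b 1 : PDO D) •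
      (Ser.mono a A : (DiffMod.right D).Ser)).coeff i = (Int.negOnePow b : ℤ) •
      ((PDO.mono b 1 : PDO D) • (Ser.mono a A : (DiffMod.right D).Ser)).coeff i :=
    map_zsmul (boundedAbove.coeffHom i) _ _
  rw [h1, coeff_expandRight, mono_smul_mono_coeff, (DiffMod.right D).act_one, iterate_right_nabla,
    PDO.coeff_zsmul, PDO.coeff_zsmul, PDO.coeff_zsmul, PDO.coeff_mul_mono_one, expandLambdaNu]
  rcases lt_or_ge (b + a - i) 0 with hk | hk
  · rw [intChoose_of_neg _ hk, zero_smul, smul_zero]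
    refine (finsum_congr fun q => ?_).trans finsum_zero
    rw [monoRow_apply, if_neg (by omega), smul_zero]
  · obtain ⟨k, hk'⟩ := Int.eq_ofNat_of_zero_le hk
    rw [hk', intChoose_natCast, Int.toNat_natCast, finsum_eq_single _ (k, b)]
    · rw [monoRow_apply, if_pos (by omega), smul_smul, smul_smul, Int.negOnePow_sub]
      congr 1
      push_cast
      ring
    · rintro ⟨k', c'⟩ hne
      rw [monoRow_apply, if_neg, smul_zero]
      rintro ⟨h1, h2⟩
      dsimp only at h1 h2
      exact hne (by ext <;> dsimp only <;> omega)

theorem opL_monoRow (P A : PDO D) (a b : ℤ) : opL P (monoRow a b A) = monoRow a b (P * A) := by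
  ext i j c
  change (P * row i j (monoRow a b A)).coeff c = _
  rw [row_monoRow, monoRow_apply]
  split_ifs
  · rfl
  · rw [mul_zero, PDO.coeff_zero]

/-- The series `A(ν + ∂) B(λ) μᵇ`. -/
noncomputable def monoSlice (b : ℤ) (A : PDO D) : PDO D →+ ThreeVar V where
  toFun B := ⟨fun i j c => if j = b then (A * const (B.coeff i)).coeff c else 0, by
    obtain ⟨N, hN⟩ := A.exists_ordLE
    obtain ⟨M, hM⟩ := B.exists_ordLE
    refine ⟨max N (max M b), fun i j c h => ?_⟩
    dsimp only
    split_ifs with h'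
    · rcases lt_or_ge M i with hi | hi
      · rw [hM i hi, map_zero, mul_zero, PDO.coeff_zero]
      · exact ordLE_right_act (B.coeff i) A N hN c (by omega)
    · rfl⟩
  map_zero' := by ext; simp
  map_add' A B := by
    ext i j c
    simp only [add_apply]
    split_ifs <;> simp [mul_add]

theorem monoSlice_apply (b : ℤ) (A B : PDO D) (i j c : ℤ) :
    (monoSlice b A B).1 i j c = if j = b then (A * const (B.coeff i)).coeff c else 0 := rfl

theorem monoSlice_mono (b : ℤ) (A : PDO D) (n : ℤ) (y : V) :
    monoSlice b A (PDO.mono n y) = monoRow n b (A * const y) := by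
  ext i j c
  rw [monoSlice_apply, monoRow_apply, PDO.coeff_mono]
  split_ifs <;> first | rfl | tauto | simp

theorem degLE_monoSlice (b : ℤ) {A B : PDO D} {N K : ℤ} (hA : OrdLE A N) (hB : OrdLE B K) :
    DegLE (monoSlice b A B) (b + N + K) := by
  intro i j c hc
  rw [monoSlice_apply]
  split_ifs with h'
  · rcases lt_or_ge K i with hi | hi
    · rw [hB i hi, map_zero, mul_zero, PDO.coeff_zero]
    · exact ordLE_right_act (B.coeff i) A N hA c (by omega)
  · rfl

theorem slice_monoRow (a b : ℤ) (A : PDO D) (j : ℤ) :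
    (slice j (monoRow a b A) : (DiffMod.right D).Ser) = if j = b then Ser.mono a A else 0 := by
  refine Ser.ext fun i => PDO.ext fun c => ?_
  rw [coeff_slice, coeff_row, monoRow_apply]
  split_ifs with h1 h2 h2
  · rw [Ser.coeff_mono, if_pos h1.1]
  · exact absurd h1.2 h2
  · rw [Ser.coeff_mono, if_neg (by tauto)]
    rfl
  · rfl

theorem opR₁_monoRow (Q A : PDO D) (a b : ℤ) :
    opR₁ Q (monoRow a b A) = monoSlice b A (PDO.mono a 1 * Q) := by
  ext i j c
  change ((op Q • (slice j (monoRow a b A) : (DiffMod.right D).Ser)).coeff i).coeff c = _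
  rw [slice_monoRow, monoSlice_apply]
  split_ifs
  · rw [op_smul_mono]
    rfl
  · rw [smul_zero]
    rfl

theorem expandLeft_monoSlice (b : ℤ) (A B : PDO D) :
    (expandLeft (monoSlice b A B) : (DiffMod.left D).Ser) = A • Ser.mono b B := by
  obtain ⟨N, hN⟩ := A.exists_ordLE
  refine DFunLike.congr_fun (ser_hom_ext (f := expandLeft.comp (monoSlice b A))
    (g := (lmul A).comp (Ser.mono b)) ⟨b + N, fun B K h => ?_⟩
    ⟨b + N, fun B K h => ?_⟩ fun n y => ?_) B
  · exact BiLE.mono ((degLE_monoSlice b hN h).expandLeft) (by omega)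
  · exact BiLE.mono (biLE_lmul (T := DiffMod.left D) ordLE_left_act ordLE_left_nabla
      (biLE_mono b h) hN)
      (by omega)
  · change (expandLeft (monoSlice b A (PDO.mono n y)) : (DiffMod.left D).Ser) =
      A • Ser.mono b (PDO.mono n y : PDO D)
    rw [monoSlice_mono, expandLeft_monoRow, mul_smul, const_smul_mono, DiffMod.left_act,
      PDO.mono_eq n y]
    rfl

theorem expandRight_monoSlice (b : ℤ) (A B : PDO D) :
    (expandRight (monoSlice b A B) : (DiffMod.right D).Ser) =
      (Int.negOnePow b : ℤ) • (PDO.mono b 1 : PDO D) • op B • Ser.mono 0 A := by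
  obtain ⟨N, hN⟩ := A.exists_ordLE
  refine DFunLike.congr_fun (ser_hom_ext (f := expandRight.comp (monoSlice b A))
    (g := (Int.negOnePow b : ℤ) • (lmul (PDO.mono b 1)).comp (rmul (Ser.mono 0 A)))
    ⟨b + N, fun B K h => ?_⟩ ⟨b + N, fun B K h => ?_⟩ fun n y => ?_) B
  · exact BiLE.mono ((degLE_monoSlice b hN h).expandRight) (by omega)
  · refine biLE_zsmul ?_ _
    exact BiLE.mono (biLE_lmul (T := DiffMod.right D) ordLE_right_act ordLE_right_nabla
      (biLE_rmul ordLE_right_act (biLE_mono 0 hN) h) (PDO.ordLE_mono b 1)) (by omega)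
  · change (expandRight (monoSlice b A (PDO.mono n y)) : (DiffMod.right D).Ser) =
      (Int.negOnePow b : ℤ) •
      (PDO.mono b 1 : PDO D) • op (PDO.mono n y : PDO D) • Ser.mono 0 A
    rw [monoSlice_mono, expandRight_monoRow, op_mono_smul_mono, DiffMod.right_act]

theorem expandLeft_swap_monoSlice (b : ℤ) (A B : PDO D) :
    (expandLeft (swap (monoSlice b A B)) : (DiffMod.left D).Ser) =
      A • op B • Ser.mono 0 (PDO.mono b 1) := by
  obtain ⟨N, hN⟩ := A.exists_ordLE
  refine DFunLike.congr_fun (ser_hom_ext (f := expandLeft.comp (swap.comp (monoSlice b A)))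
    (g := (lmul A).comp (rmul (Ser.mono 0 (PDO.mono b 1)))) ⟨b + N, fun B K h => ?_⟩
    ⟨b + N, fun B K h => ?_⟩ fun n y => ?_) B
  · exact BiLE.mono ((degLE_monoSlice b hN h).swap.expandLeft) (by omega)
  · exact BiLE.mono (biLE_lmul (T := DiffMod.left D) ordLE_left_act ordLE_left_nabla
      (biLE_rmul ordLE_left_act (biLE_mono 0 (PDO.ordLE_mono b 1)) h) hN) (by omega)
  · change (expandLeft (swap (monoSlice b A (PDO.mono n y))) : (DiffMod.left D).Ser) =
      A • op (PDO.mono n y : PDO D) • Ser.mono 0 (PDO.mono b 1 : PDO D)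
    rw [monoSlice_mono, swap_monoRow, expandLeft_monoRow, mul_smul, const_smul_mono,
      op_mono_smul_mono]

/-- After the exchange `B` is evaluated at `μ`, which acts as `-∂`; its coefficients act before
these powers do, which is the definition of the adjoint. -/
theorem expandRight_swap_monoSlice (b : ℤ) (A B : PDO D) :
    (expandRight (swap (monoSlice b A B)) : (DiffMod.right D).Ser) =
      B.adjoint • Ser.mono b A := by
  obtain ⟨N, hN⟩ := A.exists_ordLE
  refine DFunLike.congr_fun (ser_hom_ext (f := expandRight.comp (swap.comp (monoSlice b A)))
    (g := (lmul.flip (Ser.mono b A)).comp PDO.adjointHom) ⟨b + N, fun B K h => ?_⟩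
    ⟨b + N, fun B K h => ?_⟩ fun n y => ?_) B
  · exact BiLE.mono ((degLE_monoSlice b hN h).swap.expandRight) (by omega)
  · exact BiLE.mono (biLE_lmul (T := DiffMod.right D) ordLE_right_act ordLE_right_nabla
      (biLE_mono b hN) h.adjoint) (by omega)
  · change (expandRight (swap (monoSlice b A (PDO.mono n y))) : (DiffMod.right D).Ser) =
      (PDO.mono n y : PDO D).adjoint • Ser.mono b A
    rw [monoSlice_mono, swap_monoRow, expandRight_monoRow, PDO.adjoint_mono, smul_assoc, mul_smul,
      const_smul_mono, DiffMod.right_act]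

theorem op_smul_mono_zero {T : DiffMod D (PDO D)} (a : ℤ) (m : PDO D) :
    op (PDO.mono a 1 : PDO D) • (Ser.mono 0 m : T.Ser) = Ser.mono a m := by
  rw [op_mono_smul_mono, T.act_one]

end Monomials

section Equivariance

theorem biLE_coefRight {w : (DiffMod.left D).Ser} {N M : ℤ} (h : w.BiLE N) {Q : PDO D}
    (hQ : OrdLE Q M) : (coefRight Q w).BiLE (N + M) :=
  fun n => ((h n).mul hQ).mono (by omega)

theorem biLE_coefLeft {w : (DiffMod.right D).Ser} {N M : ℤ} (h : w.BiLE N) {Q : PDO D}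
    (hQ : OrdLE Q M) : (coefLeft Q w).BiLE (N + M) :=
  fun n => (hQ.mul (h n)).mono (by omega)

theorem coefRight_mono (Q m : PDO D) (n : ℤ) :
    coefRight Q (Ser.mono n m) = Ser.mono n (m * Q) :=
  boundedAbove.map_single (AddMonoidHom.mulRight Q) n m

theorem coefLeft_mono (Q m : PDO D) (n : ℤ) :
    coefLeft Q (Ser.mono n m) = Ser.mono n (Q * m) :=
  boundedAbove.map_single (AddMonoidHom.mulLeft Q) n m

/-- The degree estimates make both sides continuous, so monomials suffice; for these the expansions
have been computed. The other intertwining rules follow the same pattern. -/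
theorem expandLeft_opL (P : PDO D) (X : ThreeVar V) :
    (expandLeft (opL P X) : (DiffMod.left D).Ser) = P • expandLeft X := by
  obtain ⟨N, hN⟩ := P.exists_ordLE
  refine DFunLike.congr_fun (ser_three_hom_ext (f := expandLeft.comp (opL P))
    (g := (lmul P).comp expandLeft) ⟨N, fun X K h => (h.opL hN).expandLeft⟩
    ⟨N, fun X K h => biLE_lmul ordLE_left_act ordLE_left_nabla h.expandLeft hN⟩
    fun a b c x => ?_) X
  change (expandLeft (opL P _) : (DiffMod.left D).Ser) = P • (expandLeft _ : (DiffMod.left D).Ser)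
  rw [← monoRow_mono (D := D), opL_monoRow, expandLeft_monoRow, expandLeft_monoRow, mul_smul]

theorem expandRight_opL (P : PDO D) (X : ThreeVar V) :
    (expandRight (opL P X) : (DiffMod.right D).Ser) = coefLeft P (expandRight X) := by
  obtain ⟨N, hN⟩ := P.exists_ordLE
  refine DFunLike.congr_fun (ser_three_hom_ext (f := expandRight.comp (opL P))
    (g := (coefLeft P : (DiffMod.right D).Ser →+ (DiffMod.right D).Ser).comp expandRight)
    ⟨N, fun X K h => (h.opL hN).expandRight⟩
    ⟨N, fun X K h => biLE_coefLeft h.expandRight hN⟩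
    fun a b c x => ?_) X
  change (expandRight (opL P _) : (DiffMod.right D).Ser) =
      coefLeft P ((expandRight _ : (DiffMod.right D).Ser))
  rw [← monoRow_mono (D := D), opL_monoRow, expandRight_monoRow, expandRight_monoRow, map_zsmul,
    DiffMod.coefLeft_smul, coefLeft_mono]

theorem expandLeft_opR₁ (Q : PDO D) (X : ThreeVar V) :
    (expandLeft (opR₁ Q X) : (DiffMod.left D).Ser) = coefRight Q (expandLeft X) := by
  obtain ⟨N, hN⟩ := Q.exists_ordLE
  refine DFunLike.congr_fun (ser_three_hom_ext (f := expandLeft.comp (opR₁ Q))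
    (g := (coefRight Q : (DiffMod.left D).Ser →+ (DiffMod.left D).Ser).comp expandLeft)
    ⟨N, fun X K h => (h.opR₁ hN).expandLeft⟩
    ⟨N, fun X K h => biLE_coefRight h.expandLeft hN⟩
    fun a b c x => ?_) X
  change (expandLeft (opR₁ Q _) : (DiffMod.left D).Ser) =
      coefRight Q ((expandLeft _ : (DiffMod.left D).Ser))
  rw [← monoRow_mono (D := D), opR₁_monoRow, expandLeft_monoSlice, expandLeft_monoRow,
    DiffMod.coefRight_smul, coefRight_mono]

theorem expandRight_opR₁ (Q : PDO D) (X : ThreeVar V) :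
    (expandRight (opR₁ Q X) : (DiffMod.right D).Ser) = op Q • expandRight X := by
  obtain ⟨N, hN⟩ := Q.exists_ordLE
  refine DFunLike.congr_fun (ser_three_hom_ext (f := expandRight.comp (opR₁ Q))
    (g := (rmul.flip Q).comp expandRight) ⟨N, fun X K h => (h.opR₁ hN).expandRight⟩
    ⟨N, fun X K h => biLE_rmul ordLE_right_act h.expandRight hN⟩
    fun a b c x => ?_) X
  change (expandRight (opR₁ Q _) : (DiffMod.right D).Ser) =
      op Q • (expandRight _ : (DiffMod.right D).Ser)
  rw [← monoRow_mono (D := D), opR₁_monoRow, expandRight_monoSlice, expandRight_monoRow,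
    MulOpposite.op_mul, mul_smul, op_smul_mono_zero, smul_comm (op Q) (Int.negOnePow b : ℤ),
    ← smul_comm (PDO.mono b 1) (op Q)]

theorem expandLeft_opR₂ (Q : PDO D) (X : ThreeVar V) :
    (expandLeft (opR₂ Q X) : (DiffMod.left D).Ser) = op Q • expandLeft X := by
  obtain ⟨N, hN⟩ := Q.exists_ordLE
  refine DFunLike.congr_fun (ser_three_hom_ext (f := expandLeft.comp (opR₂ Q))
    (g := (rmul.flip Q).comp expandLeft) ⟨N, fun X K h => (h.opR₂ hN).expandLeft⟩
    ⟨N, fun X K h => biLE_rmul ordLE_left_act h.expandLeft hN⟩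
    fun a b c x => ?_) X
  change (expandLeft (opR₂ Q _) : (DiffMod.left D).Ser) =
      op Q • (expandLeft _ : (DiffMod.left D).Ser)
  rw [← monoRow_mono (D := D), ← swap_monoRow, ← swap_opR₁, opR₁_monoRow,
    expandLeft_swap_monoSlice, swap_monoRow, expandLeft_monoRow, MulOpposite.op_mul, mul_smul,
    op_smul_mono_zero, ← smul_comm (PDO.mono c x) (op Q)]

theorem expandRight_opR₂ (Q : PDO D) (X : ThreeVar V) :
    (expandRight (opR₂ Q X) : (DiffMod.right D).Ser) = Q.adjoint • expandRight X := by
  obtain ⟨N, hN⟩ := Q.exists_ordLE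
  refine DFunLike.congr_fun (ser_three_hom_ext (f := expandRight.comp (opR₂ Q))
    (g := (lmul Q.adjoint).comp expandRight) ⟨N, fun X K h => (h.opR₂ hN).expandRight⟩
    ⟨N, fun X K h => biLE_lmul ordLE_right_act ordLE_right_nabla h.expandRight hN.adjoint⟩
    fun a b c x => ?_) X
  change (expandRight (opR₂ Q _) : (DiffMod.right D).Ser) =
      Q.adjoint • (expandRight _ : (DiffMod.right D).Ser)
  rw [← monoRow_mono (D := D), ← swap_monoRow, ← swap_opR₁, opR₁_monoRow,
    expandRight_swap_monoSlice, swap_monoRow, expandRight_monoRow, PDO.adjoint_mul, mul_smul,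
    PDO.adjoint_mono_one, smul_assoc]

end Equivariance

end ThreeVar

/-! ### Frechet derivatives and the associated derivations -/

namespace DiffFunAlg

open scoped PDO

open PDO (const)
open DiffMod (Ser Der left right coefRight coefLeft)
open MulOpposite (op)

variable {F V : Type*} [CommRing F] [CommRing V] [Algebra F V] {D : Derivation F V V}
  {ι : Type*} (S : DiffFunAlg D ι)

theorem coeff_frechet_natCast (f : V) (i : ι) (n : ℕ) : (S.frechet f i).coeff n = S.pd i n f := rfl

theorem coeff_frechet_of_neg (f : V) (i : ι) {n : ℤ} (hn : n < 0) :
    (S.frechet f i).coeff n = 0 := by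
  obtain ⟨k, rfl⟩ := Int.eq_negSucc_of_lt_zero hn
  rfl

theorem isDifferential_frechet (f : V) (i : ι) : (S.frechet f i).IsDifferential :=
  fun _ hn => S.coeff_frechet_of_neg f i hn

theorem pdo_ext_of_isDifferential {a b : PDO D} (ha : a.IsDifferential) (hb : b.IsDifferential)
    (h : ∀ n : ℕ, a.coeff n = b.coeff n) : a = b := by
  ext n
  rcases lt_or_ge n 0 with hn | hn
  · rw [ha n hn, hb n hn]
  · obtain ⟨k, rfl⟩ := Int.eq_ofNat_of_zero_le hn
    exact h k

/-- The Frechet derivative as an additive map. -/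
noncomputable def frechetHom (i : ι) : V →+ PDO D where
  toFun f := S.frechet f i
  map_zero' := pdo_ext_of_isDifferential (S.isDifferential_frechet _ _) PDO.IsDifferential.zero
    fun n => by rw [coeff_frechet_natCast, map_zero, PDO.coeff_zero]
  map_add' f g := pdo_ext_of_isDifferential (S.isDifferential_frechet _ _)
    ((S.isDifferential_frechet _ _).add (S.isDifferential_frechet _ _)) fun n => by
      rw [PDO.coeff_add, coeff_frechet_natCast, coeff_frechet_natCast, coeff_frechet_natCast,
        map_add]

theorem frechetHom_apply (i : ι) (f : V) : S.frechetHom i f = S.frechet f i := rfl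

theorem frechet_mul (f g : V) (i : ι) :
    S.frechet (f * g) i = const f * S.frechet g i + const g * S.frechet f i := by
  refine pdo_ext_of_isDifferential (S.isDifferential_frechet _ _)
    (((PDO.IsDifferential.const f).mul (S.isDifferential_frechet _ _)).add
      ((PDO.IsDifferential.const g).mul (S.isDifferential_frechet _ _))) fun n => ?_
  rw [PDO.coeff_add, PDO.coeff_const_mul, PDO.coeff_const_mul, coeff_frechet_natCast,
    coeff_frechet_natCast, coeff_frechet_natCast, Derivation.leibniz, smul_eq_mul, smul_eq_mul]

/-- Coefficient by coefficient this is the commutation rule of the partial derivatives with `D`. It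
makes Frechet derivatives into derivations with values in `left D`, and their adjoints into
derivations with values in `right D`. -/
theorem frechet_D (f : V) (i : ι) : S.frechet (D f) i = PDO.mono 1 1 * S.frechet f i := by
  refine pdo_ext_of_isDifferential (S.isDifferential_frechet _ _)
    (PDO.IsDifferential.mul (PDO.IsDifferential.mono_natCast 1 1) (S.isDifferential_frechet _ _))
    fun n => ?_
  rw [PDO.coeff_mono_one_mul, coeff_frechet_natCast, coeff_frechet_natCast]
  cases n with
  | zero => rw [S.coeff_frechet_of_neg _ _ (by simp), S.pd_zero_D, zero_add]
  | succ n =>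
    rw [S.pd_succ_D, show ((n + 1 : ℕ) : ℤ) - 1 = (n : ℤ) by push_cast; ring,
      coeff_frechet_natCast, add_comm]

theorem frechet_u [DecidableEq ι] (i j : ι) : S.frechet (S.u i) j = if j = i then 1 else 0 := by
  refine pdo_ext_of_isDifferential (S.isDifferential_frechet _ _) ?_ fun n => ?_
  · split_ifs
    · exact PDO.IsDifferential.one
    · exact PDO.IsDifferential.zero
  · rw [coeff_frechet_natCast]
    split_ifs with h
    · subst h
      rw [PDO.one_eq_mono, PDO.coeff_mono]
      rcases Nat.eq_zero_or_pos n with rfl | hn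
      · exact S.pd_self j 0
      · rw [if_neg (by omega)]
        exact S.pd_other j n j 0 (by simp; omega)
    · exact S.pd_other j n i 0 (by simp [h])

theorem frechet_eq_sum {f : V} {N : ℕ} (hN : ∀ i n, N ≤ n → S.pd i n f = 0) (i : ι) :
    S.frechet f i = ∑ n ∈ Finset.range N, PDO.mono n (S.pd i n f) := by
  refine pdo_ext_of_isDifferential (S.isDifferential_frechet _ _)
    (PDO.IsDifferential.sum fun n _ => PDO.IsDifferential.mono_natCast n _) fun n => ?_
  simp only [PDO.coeff_sum, PDO.coeff_mono, coeff_frechet_natCast, Nat.cast_inj]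
  rw [Finset.sum_ite_eq (Finset.range N) n fun k => S.pd i k f]
  split_ifs with h
  · rfl
  · exact hN i n (by simpa using h)

theorem pd_bound {f : V} {N : ℕ} (hN : ∀ i n, N ≤ n → S.pd i n f = 0) (j : ι) (k : ℕ) (i : ι)
    (n : ℕ) (hn : N ≤ n) : S.pd i n (S.pd j k f) = 0 := by
  rw [S.pd_pd, hN i n hn, map_zero]

/-- The derivation `f ↦ ∑ₗ (D_f)ₗ ∘ Fₗ`. -/
noncomputable def evol [Fintype ι] (G : ι → PDO D) : (left D).Der where
  toFun f := ∑ l, S.frechet f l * G l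
  map_zero' := Finset.sum_eq_zero fun l _ => by rw [← S.frechetHom_apply, map_zero, zero_mul]
  map_add' f g := by
    simp only [← S.frechetHom_apply, map_add, add_mul, Finset.sum_add_distrib]
  leibniz f g := by
    change ∑ l, S.frechet (f * g) l * G l = const f * ∑ l, S.frechet g l * G l +
      const g * ∑ l, S.frechet f l * G l
    simp only [frechet_mul, add_mul, Finset.sum_add_distrib, Finset.mul_sum, mul_assoc]
  comm f := by
    change ∑ l, S.frechet (D f) l * G l = PDO.mono 1 1 * ∑ l, S.frechet f l * G l
    simp only [frechet_D, Finset.mul_sum, mul_assoc]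

theorem evol_apply [Fintype ι] (G : ι → PDO D) (f : V) :
    (S.evol G).toAddMonoidHom f = ∑ l, S.frechet f l * G l := rfl

/-- The derivation `f ↦ (D_f)ₗ*`. -/
noncomputable def adjFrechet (l : ι) : (right D).Der where
  toFun f := (S.frechet f l).adjoint
  map_zero' := by rw [← S.frechetHom_apply, map_zero, PDO.adjoint_zero]
  map_add' f g := by simp only [← S.frechetHom_apply, map_add, PDO.adjoint_add]
  leibniz f g := by
    change (S.frechet (f * g) l).adjoint = (S.frechet g l).adjoint * const f +
      (S.frechet f l).adjoint * const g
    rw [frechet_mul, PDO.adjoint_add, PDO.adjoint_mul, PDO.adjoint_mul, PDO.adjoint_const,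
      PDO.adjoint_const]
  comm f := by
    change (S.frechet (D f) l).adjoint = -((S.frechet f l).adjoint * PDO.mono 1 1)
    rw [frechet_D, PDO.adjoint_mul, PDO.adjoint_mono_one, Int.negOnePow_one]
    simp

theorem adjFrechet_apply (l : ι) (f : V) :
    (S.adjFrechet l).toAddMonoidHom f = (S.frechet f l).adjoint := rfl

theorem evol_extend_sum [Fintype ι] {κ : Type*} [Fintype κ] (A : ι → κ → PDO D) (Q : κ → PDO D)
    (a : PDO D) : (S.evol fun l => ∑ t, A l t * Q t).extend a =
      ∑ t, coefRight (Q t) ((S.evol fun l => A l t).extend a) := by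
  refine Ser.ext fun n => ?_
  simp only [Ser.coeff_sum, DiffMod.coeff_coefRight, Der.coeff_extend, evol_apply, Finset.mul_sum,
    Finset.sum_mul, mul_assoc]
  exact Finset.sum_comm

/-- Right linearity in the characteristic `G` reduces to the elementary derivations `f ↦ (D_f)_r`,
to which the symmetry of second derivatives applies. -/
theorem evol_extend_eq_sum_single [Fintype ι] [DecidableEq ι] (G : ι → PDO D) (a : PDO D) :
    (S.evol G).extend a =
      ∑ r, coefRight (G r) ((S.evol fun l => if l = r then 1 else 0).extend a) := by
  rw [← evol_extend_sum]
  simp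

theorem evol_single_apply [Fintype ι] [DecidableEq ι] (r : ι) (f : V) :
    (S.evol fun l => if l = r then 1 else 0).toAddMonoidHom f = S.frechet f r := by
  rw [evol_apply]
  simp

section Bracket

variable [Fintype ι] (H : Matrix ι ι (PDO D))

theorem bracket_u_left (i : ι) (f : V) :
    S.bracket H (S.u i) f = ∑ l, S.frechet f l * H l i := by
  classical
  simp only [bracket, frechet_u]
  rw [Finset.sum_eq_single i]
  · simp [PDO.adjoint_one]
  · intro b _ hb
    simp [hb, PDO.adjoint_zero]
  · simp

theorem bracket_u_right (f : V) (k : ι) :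
    S.bracket H f (S.u k) = ∑ l, H k l * (S.frechet f l).adjoint := by
  classical
  simp only [bracket, frechet_u]
  refine Finset.sum_congr rfl fun l _ => ?_
  rw [Finset.sum_eq_single k]
  · simp
  · intro b _ hb
    simp [hb]
  · simp

theorem bracket_u_u (i k : ι) : S.bracket H (S.u i) (S.u k) = H k i := by
  classical
  rw [bracket_u_left]
  simp [frechet_u]

end Bracket

end DiffFunAlg

/-! ### Derivations applied to the coefficients of Frechet derivatives -/

namespace DiffMod

open scoped PDO

open PDO (const)

variable {F V : Type*} [CommRing F] [CommRing V] [Algebra F V] {D : Derivation F V V}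
  {M : Type*} [AddCommGroup M] {T : DiffMod D M} {ι : Type*} (S : DiffFunAlg D ι)

theorem Der.map_one (δ : T.Der) : δ.toAddMonoidHom 1 = 0 := by
  have h := δ.leibniz 1 1
  rw [mul_one, T.act_one] at h
  exact left_eq_add.1 h

theorem Der.extend_mono (δ : T.Der) (n : ℤ) (a : V) :
    δ.extend (PDO.mono n a) = Ser.mono n (δ.toAddMonoidHom a) :=
  boundedAbove.map_single δ.toAddMonoidHom n a

/-- A derivation vanishes on `1`, so it passes the power of `∂` in `(-∂)ⁿ ∘ a` and reaches only `a`.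
-/
theorem Der.extend_adjoint_mono (δ : T.Der) (n : ℤ) (a : V) :
    δ.extend (PDO.mono n a : PDO D).adjoint =
      (PDO.mono n 1 : PDO D).adjoint • Ser.mono 0 (δ.toAddMonoidHom a) := by
  rw [PDO.adjoint_mono, PDO.adjoint_mono_one, map_zsmul, Der.extend_mul, Der.extend_mono,
    Der.map_one, map_zero, smul_zero, add_zero, ← PDO.mono_zero_eq_const, Der.extend_mono,
    smul_assoc]

variable {S} {f : V} {N : ℕ}

theorem Der.extend_frechet (δ : T.Der) (hN : ∀ i n, N ≤ n → S.pd i n f = 0) (l : ι) :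
    δ.extend (S.frechet f l) =
      ∑ n ∈ Finset.range N, Ser.mono n (δ.toAddMonoidHom (S.pd l n f)) := by
  rw [S.frechet_eq_sum hN, map_sum]
  exact Finset.sum_congr rfl fun n _ => δ.extend_mono _ _

theorem Der.extend_adjoint_frechet (δ : T.Der) (hN : ∀ i n, N ≤ n → S.pd i n f = 0) (l : ι) :
    δ.extend (S.frechet f l).adjoint = ∑ n ∈ Finset.range N,
      (PDO.mono n 1 : PDO D).adjoint • Ser.mono 0 (δ.toAddMonoidHom (S.pd l n f)) := by
  rw [S.frechet_eq_sum hN, PDO.adjoint_sum, map_sum]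
  exact Finset.sum_congr rfl fun n _ => δ.extend_adjoint_mono _ _

end DiffMod

/-! ### Triples of expansions of a common origin -/

namespace ThreeVar

open scoped PDO

open PDO (const)
open DiffMod (Ser lmul rmul left right coefRight coefLeft)
open MulOpposite (op)

variable {F V : Type*} [CommRing F] [CommRing V] [Algebra F V] {D : Derivation F V V}

/-- Triples of series of operators. -/
abbrev Triple (D : Derivation F V V) : Type _ := (left D).Ser × (left D).Ser × (right D).Ser

/-- The triples of the expansions of `X`, `Y` and `Z` with `X - Y = Z` modulo `ν - λ - μ`. -/
def good (D : Derivation F V V) : AddSubgroup (Triple D) where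
  carrier := {w | ∃ X Y Z : ThreeVar V, expandLeft X = w.1 ∧ expandLeft (swap Y) = w.2.1 ∧
    expandRight Z = w.2.2 ∧ ∃ E, X - Y - Z = mulRel E}
  zero_mem' := ⟨0, 0, 0, map_zero _, by rw [map_zero, map_zero]; rfl, map_zero _, 0, by simp⟩
  add_mem' := by
    rintro v w ⟨X, Y, Z, h1, h2, h3, E, h4⟩ ⟨X', Y', Z', h1', h2', h3', E', h4'⟩
    refine ⟨X + X', Y + Y', Z + Z', ?_, ?_, ?_, E + E', ?_⟩
    · rw [map_add, h1, h1']; rfl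
    · rw [map_add, map_add, h2, h2']; rfl
    · rw [map_add, h3, h3']; rfl
    · rw [map_add, ← h4, ← h4']; abel
  neg_mem' := by
    rintro v ⟨X, Y, Z, h1, h2, h3, E, h4⟩
    refine ⟨-X, -Y, -Z, ?_, ?_, ?_, -E, ?_⟩
    · rw [map_neg, h1]; rfl
    · rw [map_neg, map_neg, h2]; rfl
    · rw [map_neg, h3]; rfl
    · rw [map_neg, ← h4]; abel

/-- The operator `P(ν + ∂)` on triples. -/
noncomputable def tripleL (P : PDO D) : Triple D →+ Triple D :=
  (lmul P).prodMap ((lmul P).prodMap (coefLeft P : (right D).Ser →+ (right D).Ser))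

/-- The operator of right composition with `Q(λ)` on triples. -/
noncomputable def tripleR₁ (Q : PDO D) : Triple D →+ Triple D :=
  (coefRight Q : (left D).Ser →+ (left D).Ser).prodMap ((rmul.flip Q).prodMap (rmul.flip Q))

/-- The operator of right composition with `Q(μ)` on triples. -/
noncomputable def tripleR₂ (Q : PDO D) : Triple D →+ Triple D :=
  (rmul.flip Q).prodMap
    ((coefRight Q : (left D).Ser →+ (left D).Ser).prodMap (lmul Q.adjoint))

theorem tripleL_apply (P : PDO D) (w : Triple D) :
    tripleL P w = (P • w.1, P • w.2.1, coefLeft P w.2.2) := rfl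
theorem tripleR₁_apply (Q : PDO D) (w : Triple D) :
    tripleR₁ Q w = (coefRight Q w.1, op Q • w.2.1, op Q • w.2.2) := rfl
theorem tripleR₂_apply (Q : PDO D) (w : Triple D) :
    tripleR₂ Q w = (op Q • w.1, coefRight Q w.2.1, Q.adjoint • w.2.2) := rfl

/-- The operator is applied to the three witnesses and to the cofactor `E`: the expansions
intertwine it with the action on triples, and it commutes with multiplication by `ν - λ - μ`. The
same argument serves `tripleR₁_mem` and `tripleR₂_mem`. -/
theorem tripleL_mem (P : PDO D) {w : Triple D} (hw : w ∈ good D) : tripleL P w ∈ good D := by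
  obtain ⟨X, Y, Z, h1, h2, h3, E, h4⟩ := hw
  refine ⟨opL P X, opL P Y, opL P Z, ?_, ?_, ?_, opL P E, ?_⟩
  · rw [expandLeft_opL, h1]; rfl
  · rw [swap_opL, expandLeft_opL, h2]; rfl
  · rw [expandRight_opL, h3]; rfl
  · rw [← opL_mulRel, ← h4, map_sub, map_sub]

theorem tripleR₁_mem (Q : PDO D) {w : Triple D} (hw : w ∈ good D) : tripleR₁ Q w ∈ good D := by
  obtain ⟨X, Y, Z, h1, h2, h3, E, h4⟩ := hw
  refine ⟨opR₁ Q X, opR₁ Q Y, opR₁ Q Z, ?_, ?_, ?_, opR₁ Q E, ?_⟩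
  · rw [expandLeft_opR₁, h1]; rfl
  · rw [swap_opR₁, expandLeft_opR₂, h2]; rfl
  · rw [expandRight_opR₁, h3]; rfl
  · rw [← opR₁_mulRel, ← h4, map_sub, map_sub]

theorem tripleR₂_mem (Q : PDO D) {w : Triple D} (hw : w ∈ good D) : tripleR₂ Q w ∈ good D := by
  obtain ⟨X, Y, Z, h1, h2, h3, E, h4⟩ := hw
  refine ⟨opR₂ Q X, opR₂ Q Y, opR₂ Q Z, ?_, ?_, ?_, opR₂ Q E, ?_⟩
  · rw [expandLeft_opR₂, h1]; rfl
  · rw [swap_opR₂, expandLeft_opR₁, h2]; rfl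
  · rw [expandRight_opR₂, h3]; rfl
  · rw [← opR₂_mulRel, ← h4, map_sub, map_sub]

theorem expandLeft_one : (expandLeft (mono 0 0 0 1) : (left D).Ser) = Ser.mono 0 1 := by
  rw [expandLeft_mono, ← PDO.one_eq_mono, one_smul]

theorem expandRight_one : (expandRight (mono 0 0 0 1) : (right D).Ser) = Ser.mono 0 1 := by
  rw [← monoRow_mono (D := D), expandRight_monoRow, ← PDO.one_eq_mono, one_smul]
  simp

/-- The trivial identities `1 - 1 = 0`, here, and `1 - 0 = 1`, `0 - 1 = -1`, in the companion
lemmas, are the seeds from which the three operations generate all triples of second derivatives. -/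
theorem one_one_zero_mem : ((Ser.mono 0 1, Ser.mono 0 1, 0) : Triple D) ∈ good D :=
  ⟨mono 0 0 0 1, mono 0 0 0 1, 0, expandLeft_one, by rw [swap_mono, expandLeft_one], map_zero _, 0,
    by simp⟩

theorem one_zero_one_mem : ((Ser.mono 0 1, 0, Ser.mono 0 1) : Triple D) ∈ good D :=
  ⟨mono 0 0 0 1, 0, mono 0 0 0 1, expandLeft_one, by rw [map_zero, map_zero], expandRight_one, 0,
    by simp⟩

theorem zero_one_neg_one_mem : ((0, Ser.mono 0 1, -Ser.mono 0 1) : Triple D) ∈ good D :=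
  ⟨0, mono 0 0 0 1, -mono 0 0 0 1, map_zero _, by rw [swap_mono, expandLeft_one],
    by rw [map_neg, expandRight_one], 0, by simp⟩

end ThreeVar

namespace DiffFunAlg

open scoped PDO

open ThreeVar (Triple good tripleL tripleR₁ tripleR₂)
open DiffMod (Ser Der left right coefRight coefLeft)
open MulOpposite (op)

variable {F V : Type*} [CommRing F] [CommRing V] [Algebra F V] {D : Derivation F V V}
  {ι : Type*} [Fintype ι] (S : DiffFunAlg D ι)

/-- The three terms of the Jacobi identity for `u_i`, `u_j`, `u_k`. -/
noncomputable def jacobiTriple (H : Matrix ι ι (PDO D)) (i j k : ι) : Triple D :=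
  ((S.evol fun l => H l i).extend (H k j), (S.evol fun l => H l j).extend (H k i),
    ∑ l, coefLeft (H k l) ((S.adjFrechet l).extend (H j i)))

/-- With one argument a generator, the bracket is a derivation in the other: `f ↦ ∑ (D_f)ₗ Hₗᵢ` into
`left D`, or `f ↦ ∑ Hₖₗ (D_f)ₗ*` into `right D` up to left multiplications. Each iterated bracket is
such a map applied to the coefficients of an entry of `H`. -/
theorem jacobiAt_iff (H : Matrix ι ι (PDO D)) (i j k : ι) :
    S.JacobiAt H (S.u i) (S.u j) (S.u k) ↔ S.jacobiTriple H i j k ∈ good D := by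
  simp only [JacobiAt, bracket_u_u]
  refine exists_congr fun X => exists_congr fun Y => exists_congr fun Z => ?_
  refine and_congr ?_ (and_congr ?_ (and_congr ?_ ?_))
  · constructor
    · intro h
      refine Ser.ext fun b => PDO.ext fun a => ?_
      rw [ThreeVar.coeff_expandLeft, h, bracket_u_left]
      rfl
    · intro h a b
      rw [← ThreeVar.coeff_expandLeft (D := D), h, bracket_u_left]
      rfl
  · constructor
    · intro h
      refine Ser.ext fun b => PDO.ext fun a => ?_
      rw [ThreeVar.coeff_expandLeft, ThreeVar.expandMuLambda_swap, h, bracket_u_left]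
      rfl
    · intro h a b
      rw [← ThreeVar.expandMuLambda_swap, ← ThreeVar.coeff_expandLeft (D := D), h, bracket_u_left]
      rfl
  · have h3 : ∀ a, (S.jacobiTriple H i j k).2.2.coeff a =
        S.bracket H ((H j i).coeff a) (S.u k) := by
      intro a
      rw [bracket_u_right]
      exact Ser.coeff_sum _ _ _
    constructor
    · intro h
      refine Ser.ext fun a => PDO.ext fun b => ?_
      rw [ThreeVar.coeff_expandRight, h, h3]
    · intro h a b
      rw [← ThreeVar.coeff_expandRight (D := D), h, h3]
  · rw [← QuotientAddGroup.mk_sub, QuotientAddGroup.eq_iff_sub_mem, AddMonoidHom.mem_range]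
    exact exists_congr fun E => eq_comm

end DiffFunAlg

/-! ### Dirac modification of a Poisson structure -/

namespace DiffFunAlg

open scoped PDO

open ThreeVar (Triple good tripleL tripleR₁ tripleR₂)
open PDO (const adjointMatrix)
open DiffMod (Ser Der left right coefRight coefLeft)
open MulOpposite (op)

variable {F V : Type*} [CommRing F] [CommRing V] [Algebra F V] {D : Derivation F V V}
  {ι : Type*} [Fintype ι] [DecidableEq ι] (S : DiffFunAlg D ι)

/-- The derivation `f ↦ (D_f)_r`. -/
noncomputable def evolSingle (r : ι) : (left D).Der := S.evol fun l => if l = r then 1 else 0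

theorem evolSingle_apply (r : ι) (f : V) :
    (S.evolSingle r).toAddMonoidHom f = S.frechet f r := S.evol_single_apply r f

section Second

variable (f : V) (r l : ι)

/-- Both sides are the same double sum over the second derivatives of `f` in `u_r⁽ᵐ⁾` and `u_l⁽ⁿ⁾`,
once the two partial derivatives are interchanged. -/
theorem adjoint_frechet_pd_smul_mono {N : ℕ} (hN : ∀ i n, N ≤ n → S.pd i n f = 0) :
    ∑ m ∈ Finset.range N, (S.frechet (S.pd r m f) l).adjoint •
      (Ser.mono 0 (PDO.mono m 1) : (left D).Ser) =
      (S.evolSingle r).extend (S.frechet f l).adjoint := by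
  rw [Der.extend_adjoint_frechet _ hN]
  have h1 : ∀ m, S.frechet (S.pd r m f) l =
      ∑ n ∈ Finset.range N, PDO.mono n (S.pd l n (S.pd r m f)) :=
    fun m => S.frechet_eq_sum (S.pd_bound hN r m) l
  have h2 : ∀ n, S.frechet (S.pd l n f) r =
      ∑ m ∈ Finset.range N, PDO.mono m (S.pd r m (S.pd l n f)) :=
    fun m => S.frechet_eq_sum (S.pd_bound hN l m) r
  simp only [h1, h2, evolSingle_apply, PDO.adjoint_sum, Finset.sum_smul, map_sum,
    Finset.smul_sum]
  rw [Finset.sum_comm]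
  refine Finset.sum_congr rfl fun n _ => Finset.sum_congr rfl fun m _ => ?_
  rw [PDO.adjoint_mono, PDO.adjoint_mono_one, smul_assoc, smul_assoc, mul_smul,
    ThreeVar.const_smul_mono, DiffMod.left_act, S.pd_pd l n r m, PDO.mono_eq (m : ℤ) (S.pd r m _)]
  rfl

/-- Generated from `1 - 0 = 1`: for each `m`, the operator `(D_g)_l*` with `g = ∂f/∂u_r⁽ᵐ⁾` acts on
the left and `λᵐ` on the right. The symmetry of second derivatives identifies the first component.
-/
theorem mem_good_one : (((S.evolSingle r).extend (S.frechet f l).adjoint, 0,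
    (S.adjFrechet l).extend (S.frechet f r)) : Triple D) ∈ good D := by
  obtain ⟨N, hN⟩ := S.exists_bound f
  convert (good D).sum_mem (t := Finset.range N) fun m _ => ThreeVar.tripleR₁_mem (PDO.mono m 1)
    (ThreeVar.tripleL_mem (S.frechet (S.pd r m f) l).adjoint
      (ThreeVar.one_zero_one_mem (D := D))) using 1
  simp only [ThreeVar.tripleL_apply, ThreeVar.tripleR₁_apply]
  refine Prod.ext ?_ (Prod.ext ?_ ?_)
  · simp only [Prod.fst_sum, ← S.adjoint_frechet_pd_smul_mono f r l hN]
    refine Finset.sum_congr rfl fun m _ => ?_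
    rw [DiffMod.coefRight_smul, ThreeVar.coefRight_mono, one_mul]
  · simp [Prod.snd_sum, Prod.fst_sum]
  · simp only [Prod.snd_sum, Der.extend_frechet _ hN]
    refine Finset.sum_congr rfl fun m _ => ?_
    rw [ThreeVar.coefLeft_mono, mul_one, ThreeVar.op_smul_mono_zero, adjFrechet_apply]

/-- As for `mem_good_one`, but from `0 - 1 = -1` and with `μᵐ` on the right; on the third component
this acts as the adjoint of `∂ᵐ`, so the adjoint Frechet derivative appears there. -/
theorem mem_good_two : ((0, (S.evolSingle r).extend (S.frechet f l).adjoint,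
    -(S.adjFrechet l).extend (S.frechet f r).adjoint) : Triple D) ∈ good D := by
  obtain ⟨N, hN⟩ := S.exists_bound f
  convert (good D).sum_mem (t := Finset.range N) fun m _ => ThreeVar.tripleR₂_mem (PDO.mono m 1)
    (ThreeVar.tripleL_mem (S.frechet (S.pd r m f) l).adjoint
      (ThreeVar.zero_one_neg_one_mem (D := D))) using 1
  simp only [ThreeVar.tripleL_apply, ThreeVar.tripleR₂_apply]
  refine Prod.ext ?_ (Prod.ext ?_ ?_)
  · rw [Prod.fst_sum]
    simp
  · simp only [Prod.snd_sum, Prod.fst_sum, ← S.adjoint_frechet_pd_smul_mono f r l hN]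
    refine Finset.sum_congr rfl fun m _ => ?_
    rw [DiffMod.coefRight_smul, ThreeVar.coefRight_mono, one_mul]
  · simp only [Prod.snd_sum, Der.extend_adjoint_frechet _ hN, ← Finset.sum_neg_distrib]
    refine Finset.sum_congr rfl fun m _ => ?_
    rw [map_neg, smul_neg, ThreeVar.coefLeft_mono, mul_one, adjFrechet_apply]

/-- Generated from `1 - 1 = 0` by the second derivatives of `f`, each with its factor `λᵐ μⁿ`: the
first two components expand the same symmetric Hessian. -/
theorem mem_good_three : (((S.evolSingle r).extend (S.frechet f l),
    (S.evolSingle l).extend (S.frechet f r), 0) : Triple D) ∈ good D := by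
  obtain ⟨N, hN⟩ := S.exists_bound f
  have h1 : ∀ r n, S.frechet (S.pd l n f) r =
      ∑ m ∈ Finset.range N, PDO.mono m (S.pd r m (S.pd l n f)) :=
    fun r n => S.frechet_eq_sum (S.pd_bound hN l n) r
  have h2 : ∀ m, S.frechet (S.pd r m f) l =
      ∑ n ∈ Finset.range N, PDO.mono n (S.pd l n (S.pd r m f)) :=
    fun m => S.frechet_eq_sum (S.pd_bound hN r m) l
  convert (good D).sum_mem (t := Finset.range N) fun n _ => (good D).sum_mem
    (t := Finset.range N) fun m _ => ThreeVar.tripleR₁_mem (PDO.mono m 1)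
      (ThreeVar.tripleR₂_mem (PDO.mono n 1)
        (ThreeVar.tripleL_mem (const (S.pd r m (S.pd l n f)))
          (ThreeVar.one_one_zero_mem (D := D)))) using 1
  simp only [ThreeVar.tripleL_apply, ThreeVar.tripleR₁_apply, ThreeVar.tripleR₂_apply]
  refine Prod.ext ?_ (Prod.ext ?_ ?_)
  · simp only [Prod.fst_sum, Der.extend_frechet _ hN, evolSingle_apply, h1, map_sum]
    refine Finset.sum_congr rfl fun n _ => Finset.sum_congr rfl fun m _ => ?_
    rw [DiffMod.coefRight_op_smul, DiffMod.coefRight_smul, ThreeVar.coefRight_mono, one_mul,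
      ThreeVar.const_smul_mono, ThreeVar.op_smul_mono_zero, PDO.mono_eq, DiffMod.left_act]
    rfl
  · simp only [Prod.fst_sum, Prod.snd_sum, Der.extend_frechet _ hN, evolSingle_apply, h2, map_sum]
    rw [Finset.sum_comm]
    refine Finset.sum_congr rfl fun n _ => Finset.sum_congr rfl fun m _ => ?_
    rw [DiffMod.coefRight_smul, ThreeVar.coefRight_mono, one_mul,
      ThreeVar.const_smul_mono, ThreeVar.op_smul_mono_zero, PDO.mono_eq, DiffMod.left_act,
      S.pd_pd l n r m]
    rfl
  · simp [Prod.snd_sum]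

end Second

section Dirac

variable {μ : Type*} [Fintype μ] [DecidableEq μ]

/-- The first two components of the triple of the Dirac modification. -/
theorem evol_extend_dirac {H K P P' : Matrix ι ι (PDO D)} {T : Matrix μ ι (PDO D)}
    {T' : Matrix ι μ (PDO D)} {X : Matrix μ μ (PDO D)} (h₁ : X * (T * H * T') = 1)
    (h₂ : T * H * T' * X = 1) (hK : K = H - H * T' * X * T * H) (hP : P = 1 - T' * X * T * H)
    (hP' : P' = 1 - H * T' * X * T) (i j k : ι) :
    (S.evol fun l => K l i).extend (K k j) =
      (∑ r, ∑ t, ∑ s, P' k r • op (P s j) • coefRight (P t i)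
        ((S.evol fun l => H l t).extend (H r s))) -
      (∑ l, ∑ r, ∑ α, K k l • op ((X * T * H) α j) • coefRight (K r i)
        ((S.evolSingle r).extend (T' l α))) -
      ∑ l, ∑ r, ∑ α, (H * T' * X) k α • op (K l j) • coefRight (K r i)
        ((S.evolSingle r).extend (T α l)) := by
  -- For the terms that differentiate `H`, the factorization `K = H * P` turns the derivation into
  -- those of the bracket of `H`. For the terms that differentiate `T` and `T'`, `e2` uses
  -- elementary derivations instead.
  have e1 : ∀ a, (S.evol fun l => K l i).extend a =
      ∑ t, coefRight (P t i) ((S.evol fun l => H l t).extend a) := by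
    intro a
    refine Eq.trans ?_ (S.evol_extend_sum (fun l t => H l t) (fun t => P t i) a)
    have : K = H * P := by
      rw [hK, hP, mul_sub, mul_one]
      simp only [Matrix.mul_assoc]
    rw [this]
    rfl
  have e2 : ∀ a, (S.evol fun l => K l i).extend a =
      ∑ r, coefRight (K r i) ((S.evolSingle r).extend a) :=
    S.evol_extend_eq_sum_single _
  have h := (S.evol fun l => K l i).extend_dirac H T T' X h₁ h₂ k j
  rw [← hK, ← hP, ← hP'] at h
  rw [h]
  congr 1
  · congr 1
    · refine Finset.sum_congr rfl fun r _ => ?_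
      rw [Finset.sum_comm]
      refine Finset.sum_congr rfl fun s _ => ?_
      rw [e1, Finset.smul_sum, Finset.smul_sum]
    · refine Finset.sum_congr rfl fun l _ => ?_
      rw [Finset.sum_comm]
      refine Finset.sum_congr rfl fun α _ => ?_
      rw [e2, Finset.smul_sum, Finset.smul_sum]
  · rw [Finset.sum_comm]
    refine Finset.sum_congr rfl fun l _ => ?_
    rw [Finset.sum_comm]
    refine Finset.sum_congr rfl fun α _ => ?_
    rw [e2, Finset.smul_sum, Finset.smul_sum]

/-- The third component of the triple of the Dirac modification. -/
theorem adjFrechet_extend_dirac {H K P P' : Matrix ι ι (PDO D)} {T : Matrix μ ι (PDO D)}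
    {T' : Matrix ι μ (PDO D)} {X : Matrix μ μ (PDO D)} (h₁ : X * (T * H * T') = 1)
    (h₂ : T * H * T' * X = 1) (hK : K = H - H * T' * X * T * H) (hP : P = 1 - T' * X * T * H)
    (hP' : P' = 1 - H * T' * X * T) (i j k : ι) :
    ∑ q, coefLeft (K k q) ((S.adjFrechet q).extend (K j i)) =
      (∑ r, ∑ t, ∑ s, coefLeft (P' k r) (P' j s • op (P t i) •
        ∑ q, coefLeft (H r q) ((S.adjFrechet q).extend (H s t)))) -
      (∑ l, ∑ r, ∑ α, coefLeft (K k l) (K j r • op ((X * T * H) α i) •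
        (S.adjFrechet l).extend (T' r α))) -
      ∑ l, ∑ r, ∑ α, coefLeft (K k l) ((H * T' * X) j α • op (K r i) •
        (S.adjFrechet l).extend (T α r)) := by
  -- The left counterpart `K = P' * H` is needed here, since `K` multiplies the coefficients from
  -- the left.
  have e1 : ∀ q w, coefLeft (K k q) w = ∑ r, coefLeft (P' k r) (coefLeft (H r q) w) := by
    intro q w
    have : K = P' * H := by
      rw [hK, hP', sub_mul, one_mul]
    refine Ser.ext fun n => ?_
    rw [Ser.coeff_sum, DiffMod.coeff_coefLeft, this,
      Matrix.mul_apply, Finset.sum_mul]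
    exact Finset.sum_congr rfl fun r _ => mul_assoc _ _ _
  have h := fun q => (S.adjFrechet q).extend_dirac H T T' X h₁ h₂ j i
  rw [← hK, ← hP, ← hP'] at h
  simp only [h, map_sub, Finset.sum_sub_distrib]
  congr 1
  · congr 1
    · simp only [e1, map_sum, Finset.smul_sum]
      rw [Finset.sum_comm]
      refine Finset.sum_congr rfl fun r _ => ?_
      rw [Finset.sum_comm]
      conv_rhs => rw [Finset.sum_comm]
      refine Finset.sum_congr rfl fun s _ => ?_
      rw [Finset.sum_comm]
      refine Finset.sum_congr rfl fun t _ => Finset.sum_congr rfl fun q _ => ?_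
      rw [DiffMod.coefLeft_smul, DiffMod.coefLeft_op_smul]
    · simp only [map_sum]
  · simp only [map_sum]
    refine Finset.sum_congr rfl fun l _ => ?_
    rw [Finset.sum_comm]

/-- Differentiating `K` in the three terms of its Jacobi triple yields transforms of Jacobi triples
of `H`, plus corrections with second derivatives of the constraints. All of them lie in `good`. -/
theorem jacobiTriple_dirac_mem {H K : Matrix ι ι (PDO D)} {θ : μ → V}
    {X : Matrix μ μ (PDO D)} (hH : adjointMatrix H = -H)
    (h₁ : X * S.constraintMatrix H θ = 1) (h₂ : S.constraintMatrix H θ * X = 1)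
    (hX : adjointMatrix X = -X)
    (hK : K = H - H * adjointMatrix (S.frechetMatrix θ) * X * S.frechetMatrix θ * H)
    (hJ : ∀ i j k, S.jacobiTriple H i j k ∈ good D) (i j k : ι) :
    S.jacobiTriple K i j k ∈ good D := by
  set T := S.frechetMatrix θ with hT
  set T' := adjointMatrix T with hT'
  have hT'' : adjointMatrix T' = T := PDO.adjointMatrix_adjointMatrix T
  obtain ⟨P, hP⟩ : ∃ P, P = 1 - T' * X * T * H := ⟨_, rfl⟩
  obtain ⟨P', hP'⟩ : ∃ P', P' = 1 - H * T' * X * T := ⟨_, rfl⟩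
  -- On the third component `tripleR₂` acts through an adjoint. The adjoints of `P`, `X * T * H` and
  -- `K` turn it into the left factors found in `adjFrechet_extend_dirac`.
  have aP : ∀ s j, (P s j).adjoint = P' j s := by
    have : adjointMatrix P = P' := by
      rw [hP, hP', PDO.adjointMatrix_sub, PDO.adjointMatrix_one]
      simp only [PDO.adjointMatrix_mul, hT'', hH, hX, ← hT', Matrix.mul_assoc, Matrix.neg_mul,
        Matrix.mul_neg, neg_neg]
    intro s j
    rw [← this]
    rfl
  have aN : ∀ α j, ((X * T * H) α j).adjoint = (H * T' * X) j α := by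
    have : adjointMatrix (X * T * H) = H * T' * X := by
      simp only [PDO.adjointMatrix_mul, hH, hX, ← hT', Matrix.mul_assoc, Matrix.neg_mul,
        Matrix.mul_neg, neg_neg]
    intro s j
    rw [← this]
    rfl
  have aK : ∀ r j, (K r j).adjoint = -K j r := by
    have : adjointMatrix K = -K := by
      rw [hK, PDO.adjointMatrix_sub]
      simp only [PDO.adjointMatrix_mul, hT'', hH, hX, ← hT', Matrix.mul_assoc, Matrix.neg_mul,
        Matrix.mul_neg, neg_neg]
      abel
    intro r j
    exact congrFun (congrFun this j) r
  -- Each component differentiates `T` once and `T'` once. These six corrections pair off: `T'` in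
  -- the first with `T` in the third, `T'` in the second with `T'` in the third, and `T` in the
  -- first with `T` in the second.
  have key : S.jacobiTriple K i j k =
      (∑ r, ∑ t, ∑ s, tripleL (P' k r) (tripleR₁ (P t i) (tripleR₂ (P s j)
        (S.jacobiTriple H t s r)))) -
      (∑ l, ∑ r, ∑ α, tripleL (K k l) (tripleR₁ (K r i) (tripleR₂ ((X * T * H) α j)
        ((S.evolSingle r).extend (S.frechet (θ α) l).adjoint, 0,
          (S.adjFrechet l).extend (S.frechet (θ α) r))))) -
      (∑ l, ∑ r, ∑ α, tripleL (K k l) (tripleR₁ ((X * T * H) α i) (tripleR₂ (K r j)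
        (0, (S.evolSingle r).extend (S.frechet (θ α) l).adjoint,
          -(S.adjFrechet l).extend (S.frechet (θ α) r).adjoint)))) -
      ∑ l, ∑ r, ∑ α, tripleL ((H * T' * X) k α) (tripleR₁ (K r i) (tripleR₂ (K l j)
        ((S.evolSingle r).extend (S.frechet (θ α) l),
          (S.evolSingle l).extend (S.frechet (θ α) r), 0))) := by
    refine Prod.ext ?_ (Prod.ext ?_ ?_)
    · simp only [Prod.fst_sub, Prod.fst_sum, ThreeVar.tripleL_apply, ThreeVar.tripleR₁_apply,
        ThreeVar.tripleR₂_apply, smul_zero, map_zero, Finset.sum_const_zero, sub_zero,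
        DiffMod.coefRight_op_smul]
      exact S.evol_extend_dirac h₁ h₂ hK hP hP' i j k
    · simp only [Prod.fst_sub, Prod.fst_sum, Prod.snd_sub, Prod.snd_sum, ThreeVar.tripleL_apply,
        ThreeVar.tripleR₁_apply,
        ThreeVar.tripleR₂_apply, smul_zero, map_zero, Finset.sum_const_zero, sub_zero]
      refine (S.evol_extend_dirac h₁ h₂ hK hP hP' j i k).trans ?_
      congr 1
      · congr 1
        exact Finset.sum_congr rfl fun r _ => Finset.sum_comm
      · exact Finset.sum_comm
    · simp only [Prod.snd_sub, Prod.snd_sum, ThreeVar.tripleL_apply,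
        ThreeVar.tripleR₁_apply, ThreeVar.tripleR₂_apply, smul_zero, map_zero,
        Finset.sum_const_zero, sub_zero, aP, aN, aK, neg_smul, smul_neg, neg_neg,
        ← smul_comm (_ : PDO D) (op (_ : PDO D)) (_ : (right D).Ser)]
      refine (S.adjFrechet_extend_dirac h₁ h₂ hK hP hP' i j k).trans ?_
      rw [sub_right_comm]
      rfl
  rw [key]
  have hop : ∀ {A B C : PDO D} {w : Triple D}, w ∈ good D →
      tripleL A (tripleR₁ B (tripleR₂ C w)) ∈ good D := fun hw =>
    ThreeVar.tripleL_mem _ (ThreeVar.tripleR₁_mem _ (ThreeVar.tripleR₂_mem _ hw))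
  refine sub_mem (sub_mem (sub_mem ?_ ?_) ?_) ?_
  · exact sum_mem fun r _ => sum_mem fun t _ => sum_mem fun s _ => hop (hJ _ _ _)
  · exact sum_mem fun l _ => sum_mem fun r _ => sum_mem fun α _ => hop (S.mem_good_one _ _ _)
  · exact sum_mem fun l _ => sum_mem fun r _ => sum_mem fun α _ => hop (S.mem_good_two _ _ _)
  · exact sum_mem fun l _ => sum_mem fun r _ => sum_mem fun α _ => hop (S.mem_good_three _ _ _)

end Dirac

end DiffFunAlg

/-! ### Dirac modification of bi-Poisson structures -/

namespace PDO

variable {F V : Type*} [CommRing F] [CommRing V] [Algebra F V] {D : Derivation F V V}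
  {ι : Type*} [Fintype ι] [DecidableEq ι]

theorem IsInvertible.mul_inverse {C : Matrix ι ι (PDO D)} (h : IsInvertible C) :
    C * inverse C = 1 := by
  rw [inverse, dif_pos h]
  exact h.choose_spec.1

theorem IsInvertible.inverse_mul {C : Matrix ι ι (PDO D)} (h : IsInvertible C) :
    inverse C * C = 1 := by
  rw [inverse, dif_pos h]
  exact h.choose_spec.2

theorem IsInvertible.adjointMatrix_inverse {C : Matrix ι ι (PDO D)} (h : IsInvertible C)
    (hC : adjointMatrix C = -C) : adjointMatrix (inverse C) = -inverse C := by
  have h1 : adjointMatrix (inverse C) * C = -1 := by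
    rw [← neg_eq_iff_eq_neg, ← Matrix.mul_neg, ← hC, ← adjointMatrix_mul, h.mul_inverse,
      adjointMatrix_one]
  calc adjointMatrix (inverse C) = adjointMatrix (inverse C) * (C * inverse C) := by
        rw [h.mul_inverse, Matrix.mul_one]
    _ = -inverse C := by rw [← Matrix.mul_assoc, h1, Matrix.neg_mul, Matrix.one_mul]

end PDO

namespace DiffFunAlg

open scoped PDO

open PDO (adjointMatrix IsInvertible IsRationalMatrix)

variable {F V : Type*} [CommRing F] [CommRing V] [Algebra F V] {D : Derivation F V V}
  {ι : Type*} [Fintype ι] {S : DiffFunAlg D ι}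
  {μ : Type*} [Fintype μ] [DecidableEq μ] {H H₀ H₁ : Matrix ι ι (PDO D)} {θ : μ → V}

omit [Fintype μ] [DecidableEq μ] in
theorem adjointMatrix_constraintMatrix (hH : adjointMatrix H = -H) :
    adjointMatrix (S.constraintMatrix H θ) = -S.constraintMatrix H θ := by
  simp only [constraintMatrix, PDO.adjointMatrix_mul, PDO.adjointMatrix_adjointMatrix, hH,
    Matrix.mul_assoc, Matrix.neg_mul, Matrix.mul_neg]

/-- The correction is designed for this: applying `D_θ` to it produces `C C⁻¹`. The constraints
thereby become central for the modified structure, which is what the reduction in (b) requires. -/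
theorem frechetMatrix_mul_dirac (hC : IsInvertible (S.constraintMatrix H θ)) :
    S.frechetMatrix θ * S.dirac H θ = 0 := by
  have h : S.frechetMatrix θ * (H * adjointMatrix (S.frechetMatrix θ) *
      PDO.inverse (S.constraintMatrix H θ) * S.frechetMatrix θ * H) =
      S.constraintMatrix H θ * PDO.inverse (S.constraintMatrix H θ) * S.frechetMatrix θ * H := by
    simp only [constraintMatrix, Matrix.mul_assoc]
  rw [dirac, Matrix.mul_sub, h, hC.mul_inverse, Matrix.one_mul, sub_self]

theorem IsPoisson.dirac [IsDomain V] (h : S.IsPoisson H)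
    (hC : IsInvertible (S.constraintMatrix H θ)) : S.IsPoisson (S.dirac H θ) := by
  classical
  have hX := hC.adjointMatrix_inverse (adjointMatrix_constraintMatrix h.skewadjoint)
  have hT : IsRationalMatrix (S.frechetMatrix θ) :=
    fun α i => (S.isDifferential_frechet _ _).isRational
  have hT' : IsRationalMatrix (adjointMatrix (S.frechetMatrix θ)) :=
    fun i α => (S.isDifferential_frechet _ _).adjoint.isRational
  refine ⟨?_, ?_, fun i j k => (S.jacobiAt_iff _ i j k).2 ?_⟩
  · simp only [DiffFunAlg.dirac, PDO.adjointMatrix_sub, PDO.adjointMatrix_mul,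
      PDO.adjointMatrix_adjointMatrix, h.skewadjoint, hX, Matrix.mul_assoc, Matrix.neg_mul,
      Matrix.mul_neg, neg_neg]
    abel
  · have hX' : IsRationalMatrix (PDO.inverse (S.constraintMatrix H θ)) :=
      -- Invertibility is only assumed over pseudodifferential operators; rationality of the inverse
      -- comes from that of `C`.
      IsRationalMatrix.of_mul_eq_one ((hT.mul h.rational).mul hT') hC.inverse_mul
    exact h.rational.sub ((((h.rational.mul hT').mul hX').mul hT).mul h.rational)
  · exact S.jacobiTriple_dirac_mem h.skewadjoint hC.inverse_mul hC.mul_inverse hX rfl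
      (fun i j k => (S.jacobiAt_iff _ i j k).1 (h.jacobi i j k)) i j k

omit [Fintype μ] [DecidableEq μ] in
theorem frechetMatrix_mul_eq_zero (hθ : ∀ α, S.IsCentral H (θ α)) : S.frechetMatrix θ * H = 0 := by
  ext1 α i
  exact congrFun (congrFun (hθ α) ()) i

omit [Fintype μ] [DecidableEq μ] in
theorem mul_adjoint_frechetMatrix_eq_zero (hH : adjointMatrix H = -H)
    (h : S.frechetMatrix θ * H = 0) : H * adjointMatrix (S.frechetMatrix θ) = 0 := by
  have h1 := congrArg adjointMatrix h
  rwa [PDO.adjointMatrix_mul, hH, PDO.adjointMatrix_zero, Matrix.neg_mul, neg_eq_zero] at h1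

omit [Fintype μ] [DecidableEq μ] in
theorem constraintMatrix_add (h : S.frechetMatrix θ * H₀ = 0) :
    S.constraintMatrix (H₀ + H₁) θ = S.constraintMatrix H₁ θ := by
  rw [constraintMatrix, Matrix.mul_add, h, zero_add, constraintMatrix]

theorem dirac_add (h : S.frechetMatrix θ * H₀ = 0)
    (h' : H₀ * adjointMatrix (S.frechetMatrix θ) = 0) :
    S.dirac (H₀ + H₁) θ = H₀ + S.dirac H₁ θ := by
  rw [dirac, dirac, constraintMatrix_add h, Matrix.add_mul, h', zero_add,
    Matrix.mul_assoc _ (S.frechetMatrix θ), Matrix.mul_add, h, zero_add, ← Matrix.mul_assoc,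
    add_sub_assoc]

/-- Compatibility needs no separate computation: the sum with `H₀` is itself the Dirac modification
of the Poisson structure `H₀ + H₁`. -/
theorem IsBiPoisson.dirac [IsDomain V] (hH : S.IsBiPoisson H₀ H₁)
    (h : S.frechetMatrix θ * H₀ = 0) (hC : IsInvertible (S.constraintMatrix H₁ θ)) :
    S.IsBiPoisson H₀ (S.dirac H₁ θ) := by
  refine ⟨hH.left, hH.right.dirac hC, ?_⟩
  rw [← dirac_add h (mul_adjoint_frechetMatrix_eq_zero hH.left.skewadjoint h)]
  exact hH.add.dirac (by rwa [constraintMatrix_add h])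

/-! ### Reduction to the first variables -/

theorem bracket_eq_mul (f g : V) : S.bracket H f g = (S.frechetMatrix (fun _ : Unit => g) * H *
    adjointMatrix (S.frechetMatrix fun _ : Unit => f)) () () := by
  simp only [bracket, Matrix.mul_apply, Finset.sum_mul]
  rfl

omit [Fintype ι] in
theorem frechet_iterate (n : ℕ) (f : V) (i : ι) :
    S.frechet ((⇑D)^[n] f) i = PDO.mono n 1 * S.frechet f i := by
  induction n with
  | zero => rw [Function.iterate_zero_apply, Nat.cast_zero, ← PDO.one_eq_mono, one_mul]
  | succ n ih =>
    rw [Function.iterate_succ_apply', frechet_D, ih, ← mul_assoc, PDO.mono_mul_mono_one,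
      Nat.cast_succ, add_comm]

variable {κ : Type*} {e : κ ⊕ μ ≃ ι} {p : μ → V}

omit [Fintype ι] [Fintype μ] in
theorem SpecialForm.frechet_right (h : S.SpecialForm e θ p) (α β : μ) :
    S.frechet (θ α) (e (Sum.inr β)) = if α = β then 1 else 0 := by
  classical
  have hp : S.frechet (p α) (e (Sum.inr β)) = 0 :=
    pdo_ext_of_isDifferential (S.isDifferential_frechet _ _) PDO.IsDifferential.zero
      fun n => h.indep α β n
  rw [h.eq, ← frechetHom_apply, map_add, frechetHom_apply, frechetHom_apply, hp, add_zero,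
    frechet_u]
  exact if_congr (by simp [eq_comm]) rfl rfl

omit [Fintype ι] [Fintype μ] [DecidableEq μ] in
theorem SpecialForm.frechet_left (h : S.SpecialForm e θ p) (α : μ) (i : κ) :
    S.frechet (θ α) (e (Sum.inl i)) = S.frechetLeft e p α i := by
  classical
  rw [h.eq, ← frechetHom_apply, map_add, frechetHom_apply, frechetHom_apply, frechet_u,
    if_neg (by simp), zero_add]
  rfl

variable [Fintype κ]

theorem SpecialForm.submatrix_frechetMatrix_mul (h : S.SpecialForm e θ p)
    {ν : Type*} (K : Matrix ι ν (PDO D)) :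
    S.frechetMatrix θ * K = S.frechetLeft e p * K.submatrix (e ∘ Sum.inl) id +
      K.submatrix (e ∘ Sum.inr) id := by
  ext1 α j
  rw [Matrix.mul_apply, ← e.sum_comp, Fintype.sum_sum_type]
  refine congrArg₂ (· + ·) ?_ ?_
  · exact Finset.sum_congr rfl fun i _ => congrArg (· * _) (h.frechet_left α i)
  · refine (Finset.sum_congr rfl fun β _ => congrArg (· * _) (h.frechet_right α β)).trans ?_
    simp

-- A chain rule: the Frechet derivative of `∂ⁿ p_α` is `∂ⁿ ∘ D_{p_α}`, so the sum over `n` in the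
-- modified partial derivatives assembles into the composition of `(D_f)_α` with `D_{p_α}`.
omit [Fintype ι] [DecidableEq μ] [Fintype κ] in
theorem SpecialForm.frechet_tilde (h : S.SpecialForm e θ p) (f : V) (i : κ) :
    (S.tilde e θ p h).frechet f i = S.frechet f (e (Sum.inl i)) -
      ∑ α, S.frechet f (e (Sum.inr α)) * S.frechetLeft e p α i := by
  obtain ⟨N, hN⟩ := S.exists_bound f
  have h1 : ∀ α, S.frechet f (e (Sum.inr α)) * S.frechetLeft e p α i =
      ∑ n ∈ Finset.range N, PDO.const (S.pd (e (Sum.inr α)) n f) *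
        S.frechet ((⇑D)^[n] (p α)) (e (Sum.inl i)) := by
    intro α
    rw [S.frechet_eq_sum hN, Finset.sum_mul]
    refine Finset.sum_congr rfl fun n _ => ?_
    rw [frechet_iterate, ← mul_assoc, PDO.mono_eq, PDO.mono_zero_eq_const]
    rfl
  simp only [h1]
  ext s
  rcases lt_or_ge s 0 with hs | hs
  · rw [coeff_frechet_of_neg _ _ _ hs, PDO.coeff_sub, coeff_frechet_of_neg _ _ _ hs]
    simp only [PDO.coeff_sum, PDO.coeff_const_mul, coeff_frechet_of_neg _ _ _ hs, mul_zero,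
      Finset.sum_const_zero, sub_zero]
  · obtain ⟨k, rfl⟩ := Int.eq_ofNat_of_zero_le hs
    rw [PDO.coeff_sub]
    simp only [PDO.coeff_sum, PDO.coeff_const_mul, coeff_frechet_natCast]
    refine (tildePd_eq_range p i k f N hN).trans ?_
    simp only [mul_comm]

variable [DecidableEq κ]

omit [Fintype ι] [DecidableEq μ] in
theorem SpecialForm.frechetMatrix_tilde (h : S.SpecialForm e θ p) {ν : Type*} (f : ν → V) :
    (S.tilde e θ p h).frechetMatrix f =
      (S.frechetMatrix f).submatrix id e *
        (Matrix.fromRows 1 (-S.frechetLeft e p) : Matrix (κ ⊕ μ) κ (PDO D)) := by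
  ext1 x i
  refine (h.frechet_tilde (f x) i).trans ?_
  rw [Matrix.mul_apply, Fintype.sum_sum_type, sub_eq_add_neg, ← Finset.sum_neg_distrib]
  refine congrArg₂ (· + ·) ?_ ?_
  · simp only [Matrix.fromRows_apply_inl, Matrix.one_apply, mul_ite, mul_one, mul_zero,
      Finset.sum_ite_eq', Finset.mem_univ, if_true]
    rfl
  · refine Finset.sum_congr rfl fun α _ => ?_
    rw [Matrix.fromRows_apply_inr, Matrix.neg_apply, mul_neg]
    rfl

omit [Fintype μ] [DecidableEq μ] [Fintype κ] [DecidableEq κ] in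
theorem adjointMatrix_fromRows {ν : Type*} (A : Matrix κ ν (PDO D)) (B : Matrix μ ν (PDO D)) :
    adjointMatrix (Matrix.fromRows A B) =
      Matrix.fromCols (adjointMatrix A) (adjointMatrix B) := by
  ext1 i q
  cases q <;> rfl

/-- A skewadjoint matrix annihilated by `D_θ` is determined by its first block. -/
theorem SpecialForm.submatrix_eq (h : S.SpecialForm e θ p) {K : Matrix ι ι (PDO D)}
    (hK : adjointMatrix K = -K) (hθ : S.frechetMatrix θ * K = 0) :
    K.submatrix e e = Matrix.fromRows 1 (-S.frechetLeft e p) *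
      K.submatrix (e ∘ Sum.inl) (e ∘ Sum.inl) *
      Matrix.fromCols 1 (-adjointMatrix (S.frechetLeft e p)) := by
  set A := K.submatrix (e ∘ Sum.inl) (e ∘ Sum.inl) with hA
  -- As `D_θ` has the identity as its block on the last variables, its annihilating `K` expresses
  -- the last rows of `K` by the first ones. Skewadjointness then does the same for columns in `h2`.
  have h1 : K.submatrix (e ∘ Sum.inr) id =
      -(S.frechetLeft e p * K.submatrix (e ∘ Sum.inl) id) := by
    rw [h.submatrix_frechetMatrix_mul] at hθ
    exact eq_neg_of_add_eq_zero_right hθ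
  have h2 : K.submatrix id (e ∘ Sum.inr) =
      -(K.submatrix id (e ∘ Sum.inl) * adjointMatrix (S.frechetLeft e p)) := by
    have h3 := congrArg adjointMatrix h1
    rw [PDO.adjointMatrix_neg, PDO.adjointMatrix_mul] at h3
    have h4 : adjointMatrix (K.submatrix (e ∘ Sum.inl) id) = -K.submatrix id (e ∘ Sum.inl) :=
      congrArg (fun M : Matrix ι ι (PDO D) => M.submatrix id (e ∘ Sum.inl)) hK
    have h5 : adjointMatrix (K.submatrix (e ∘ Sum.inr) id) = -K.submatrix id (e ∘ Sum.inr) :=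
      congrArg (fun M : Matrix ι ι (PDO D) => M.submatrix id (e ∘ Sum.inr)) hK
    rw [h4, h5, Matrix.neg_mul, neg_neg] at h3
    rw [← h3, neg_neg]
  have hr : ∀ (α : μ) j, K (e (Sum.inr α)) j =
      -(S.frechetLeft e p * K.submatrix (e ∘ Sum.inl) id) α j :=
    fun α j => congrFun (congrFun h1 α) j
  have hc : ∀ i (α : μ), K i (e (Sum.inr α)) =
      -(K.submatrix id (e ∘ Sum.inl) * adjointMatrix (S.frechetLeft e p)) i α :=
    fun i α => congrFun (congrFun h2 i) α
  rw [Matrix.fromRows_mul, Matrix.one_mul, Matrix.fromRows_mul_fromCols]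
  simp only [Matrix.mul_one, Matrix.mul_neg, Matrix.neg_mul, neg_neg]
  ext1 q r
  rcases q with i | α <;> rcases r with j | β
  · rfl
  · exact hc _ _
  · exact hr _ _
  · rw [Matrix.fromBlocks_apply₂₂, Matrix.mul_assoc]
    refine (hr _ _).trans ?_
    rw [← Matrix.neg_apply, ← Matrix.mul_neg]
    rw [Matrix.mul_apply, Matrix.mul_apply]
    exact Finset.sum_congr rfl fun i _ => congrArg (S.frechetLeft e p α i * ·)
      (neg_eq_iff_eq_neg.2 (hc _ _))

/-- The factors `(1, -D_p)` and its adjoint relating `K` to its first block are exactly those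
relating the modified Frechet derivatives to the original ones, so the two products coincide for all
`f` and `g`. -/
theorem SpecialForm.bracket_tilde (h : S.SpecialForm e θ p) {K : Matrix ι ι (PDO D)}
    (hK : adjointMatrix K = -K) (hθ : S.frechetMatrix θ * K = 0) (f g : V) :
    (S.tilde e θ p h).bracket (K.submatrix (e ∘ Sum.inl) (e ∘ Sum.inl)) f g =
      S.bracket K f g := by
  have h1 := h.submatrix_eq hK hθ
  rw [bracket_eq_mul, bracket_eq_mul, h.frechetMatrix_tilde, h.frechetMatrix_tilde,
    PDO.adjointMatrix_mul, adjointMatrix_fromRows, PDO.adjointMatrix_one, PDO.adjointMatrix_neg]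
  have h2 : S.frechetMatrix (fun _ : Unit => g) * K *
      adjointMatrix (S.frechetMatrix fun _ : Unit => f) =
      (S.frechetMatrix fun _ : Unit => g).submatrix id e * K.submatrix e e *
      adjointMatrix ((S.frechetMatrix fun _ : Unit => f).submatrix id e) := by
    rw [Matrix.submatrix_mul_equiv]
    exact (Matrix.submatrix_mul_equiv (S.frechetMatrix (fun _ : Unit => g) * K)
      (adjointMatrix (S.frechetMatrix fun _ : Unit => f)) id e id).symm
  rw [h2, h1]
  simp only [Matrix.mul_assoc]

theorem IsPoisson.tilde {K : Matrix ι ι (PDO D)} (hK : S.IsPoisson K) (h : S.SpecialForm e θ p)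
    (hθ : S.frechetMatrix θ * K = 0) :
    (S.tilde e θ p h).IsPoisson (K.submatrix (e ∘ Sum.inl) (e ∘ Sum.inl)) where
  skewadjoint := congrArg
    (fun M : Matrix ι ι (PDO D) => M.submatrix (e ∘ Sum.inl) (e ∘ Sum.inl)) hK.skewadjoint
  rational i j := hK.rational _ _
  jacobi i j k := by
    -- The inner brackets are applied to coefficients that are arbitrary elements of `V`, so
    -- agreement of the brackets on generators alone would not suffice.
    simp only [JacobiAt, h.bracket_tilde hK.skewadjoint hθ]
    exact hK.jacobi _ _ _

omit [DecidableEq κ] in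
/-- The first block of the Dirac modification. -/
theorem SpecialForm.dirac_submatrix (h : S.SpecialForm e θ p) (hH : adjointMatrix H = -H) :
    (S.dirac H θ).submatrix (e ∘ Sum.inl) (e ∘ Sum.inl) =
      diracBlock (H.submatrix (e ∘ Sum.inl) (e ∘ Sum.inl))
        (H.submatrix (e ∘ Sum.inl) (e ∘ Sum.inr)) (S.constraintMatrix H θ)
        (S.frechetLeft e p) := by
  -- The lower left block of `H` is `-B*`; the resulting sign turns the minus of the Dirac
  -- modification into the plus of `diracBlock`.
  have h1 : (S.frechetMatrix θ * H).submatrix id (e ∘ Sum.inl) =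
      -(adjointMatrix (H.submatrix (e ∘ Sum.inl) (e ∘ Sum.inr)) -
        S.frechetLeft e p * H.submatrix (e ∘ Sum.inl) (e ∘ Sum.inl)) := by
    rw [h.submatrix_frechetMatrix_mul, neg_sub, sub_eq_add_neg]
    refine congrArg (fun M : Matrix μ κ (PDO D) =>
      S.frechetLeft e p * H.submatrix (e ∘ Sum.inl) (e ∘ Sum.inl) + M) ?_
    exact neg_eq_iff_eq_neg.1 (congrArg
      (fun M : Matrix ι ι (PDO D) => M.submatrix (e ∘ Sum.inr) (e ∘ Sum.inl)) hH).symm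
  have h2 : (H * adjointMatrix (S.frechetMatrix θ)).submatrix (e ∘ Sum.inl) id =
      H.submatrix (e ∘ Sum.inl) (e ∘ Sum.inr) +
        H.submatrix (e ∘ Sum.inl) (e ∘ Sum.inl) * adjointMatrix (S.frechetLeft e p) := by
    ext1 i α
    rw [Matrix.submatrix_apply, Matrix.mul_apply, ← e.sum_comp, Fintype.sum_sum_type, add_comm]
    refine congrArg₂ (· + ·) ?_ ?_
    · refine (Finset.sum_congr rfl fun β _ => congrArg (H _ _ * ·)
        (congrArg PDO.adjoint (h.frechet_right α β))).trans ?_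
      rw [Finset.sum_eq_single α]
      · rw [if_pos rfl, PDO.adjoint_one, mul_one]
        rfl
      · intro β _ hβ
        rw [if_neg hβ.symm, PDO.adjoint_zero, mul_zero]
      · simp
    · exact Finset.sum_congr rfl fun j _ => congrArg (H _ _ * ·)
        (congrArg PDO.adjoint (h.frechet_left α j))
  have h3 : S.dirac H θ = H - H * adjointMatrix (S.frechetMatrix θ) *
      (PDO.inverse (S.constraintMatrix H θ) * (S.frechetMatrix θ * H)) := by
    simp only [dirac, Matrix.mul_assoc]
  have h4 : (S.dirac H θ).submatrix (e ∘ Sum.inl) (e ∘ Sum.inl) =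
      H.submatrix (e ∘ Sum.inl) (e ∘ Sum.inl) -
        (H * adjointMatrix (S.frechetMatrix θ)).submatrix (e ∘ Sum.inl) id *
        (PDO.inverse (S.constraintMatrix H θ) *
          (S.frechetMatrix θ * H).submatrix id (e ∘ Sum.inl)) := by
    rw [h3]
    rfl
  rw [h4, h1, h2, diracBlock, Matrix.mul_neg, Matrix.mul_neg, sub_neg_eq_add, Matrix.mul_assoc]

omit [Fintype ι] [Fintype μ] [DecidableEq μ] [Fintype κ] [DecidableEq κ] in
theorem submatrix_eq_fromBlocks (e : κ ⊕ μ ≃ ι) (hH : adjointMatrix H = -H) :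
    H.submatrix e e = Matrix.fromBlocks (H.submatrix (e ∘ Sum.inl) (e ∘ Sum.inl))
      (H.submatrix (e ∘ Sum.inl) (e ∘ Sum.inr))
      (-adjointMatrix (H.submatrix (e ∘ Sum.inl) (e ∘ Sum.inr)))
      (H.submatrix (e ∘ Sum.inr) (e ∘ Sum.inr)) := by
  ext1 q r
  rcases q with i | α <;> rcases r with j | β
  · rfl
  · rfl
  · exact (neg_eq_iff_eq_neg.2 (congrFun (congrFun hH _) _)).symm
  · rfl

theorem IsBiPoisson.tilde {K₀ K₁ : Matrix ι ι (PDO D)} (hK : S.IsBiPoisson K₀ K₁)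
    (h : S.SpecialForm e θ p) (h₀ : S.frechetMatrix θ * K₀ = 0)
    (h₁ : S.frechetMatrix θ * K₁ = 0) :
    (S.tilde e θ p h).IsBiPoisson (K₀.submatrix (e ∘ Sum.inl) (e ∘ Sum.inl))
      (K₁.submatrix (e ∘ Sum.inl) (e ∘ Sum.inl)) :=
  ⟨hK.left.tilde h h₀, hK.right.tilde h h₁,
    hK.add.tilde h (by rw [Matrix.mul_add, h₀, h₁, add_zero])⟩

end DiffFunAlg

/-! ### Reduction to the quotient -/

namespace ThreeVar

open scoped PDO

variable {V W : Type*} [AddCommGroup V] [AddCommGroup W] (φ : V →+ W)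

/-- An additive map of the coefficients, applied coefficientwise. -/
def map : ThreeVar V →+ ThreeVar W where
  toFun X := ⟨fun a b c => φ (X.1 a b c), by
    obtain ⟨N, hN⟩ := X.2
    exact ⟨N, fun a b c h => by simp [hN a b c h]⟩⟩
  map_zero' := by
    ext
    simp
  map_add' X Y := by
    ext
    simp

theorem map_apply (X : ThreeVar V) (a b c : ℤ) : (map φ X).1 a b c = φ (X.1 a b c) := rfl

theorem map_mulRel (X : ThreeVar V) : map φ (mulRel X) = mulRel (map φ X) := by
  ext a b c
  simp [map_apply, mulRel_apply]

theorem expandMuLambda_map (X : ThreeVar V) (i j : ℤ) :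
    expandMuLambda (map φ X) i j = φ (expandMuLambda X i j) := by
  refine Eq.trans ?_ (φ.map_finsum (expandMuLambda_support X i j)).symm
  exact finsum_congr fun q => (map_zsmul φ _ _).symm

theorem expandLambdaMu_map (X : ThreeVar V) (i j : ℤ) :
    expandLambdaMu (map φ X) i j = φ (expandLambdaMu X i j) :=
  expandMuLambda_map φ (swap X) j i

theorem expandLambdaNu_map (X : ThreeVar V) (i j : ℤ) :
    expandLambdaNu (map φ X) i j = φ (expandLambdaNu X i j) := by
  refine Eq.trans ?_ (φ.map_finsum (expandLambdaNu_support X i j)).symm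
  exact finsum_congr fun q => (map_zsmul φ _ _).symm

theorem mk_sub_mk_eq_iff (X Y Z : ThreeVar V) :
    (X : TwoVar V) - (Y : TwoVar V) = (Z : TwoVar V) ↔ ∃ E, X - Y - Z = mulRel E := by
  rw [← QuotientAddGroup.mk_sub, QuotientAddGroup.eq_iff_sub_mem, AddMonoidHom.mem_range]
  exact exists_congr fun E => eq_comm

end ThreeVar

namespace DiffFunAlg

open scoped PDO

open PDO (adjointMatrix IsRationalMatrix)

variable {F V : Type*} [CommRing F] [CommRing V] [Algebra F V] {D : Derivation F V V}
  {ι κ μ : Type*} [Fintype μ] {S : DiffFunAlg D ι}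
  {θ : μ → V} {e : κ ⊕ μ ≃ ι} {p : μ → V}

omit [Fintype μ] in
theorem mk_D (f : V) : Ideal.Quotient.mk (diffIdeal D θ) (D f) =
    quotD D θ (Ideal.Quotient.mk (diffIdeal D θ) f) :=
  (quotDerivation_mk D _ f).symm

omit [Fintype μ] in
theorem reduce_eq (a : PDO D) : PDO.reduce θ a =
    PDO.mapHom (D' := quotD D θ) (Ideal.Quotient.mk (diffIdeal D θ)) mk_D a := rfl

theorem frechet_quotient (h : S.SpecialForm e θ p)
    (hI : ∀ f ∈ diffIdeal D θ, f ∈ S.leftPolynomials e → f = 0) (f : V) (i : κ) :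
    (S.quotient e θ p h hI).frechet (Ideal.Quotient.mk _ f) i =
      PDO.reduce θ ((S.tilde e θ p h).frechet f i) := by
  ext n
  change _ = Ideal.Quotient.mk _ (((S.tilde e θ p h).frechet f i).coeff n)
  rcases lt_or_ge n 0 with hn | hn
  · rw [coeff_frechet_of_neg _ _ _ hn, coeff_frechet_of_neg _ _ _ hn, map_zero]
  · obtain ⟨k, rfl⟩ := Int.eq_ofNat_of_zero_le hn
    exact quotDerivation_mk (S.tildePd e p i k) (fun f hf => map_mem_diffIdeal _
      (fun α j => by rw [h.tildePd_theta]; exact zero_mem _) hf) f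

/-- Taking cosets is a homomorphism of differential rings, so it respects composition and adjoints;
by construction it also respects the modified Frechet derivatives. -/
theorem bracket_quotient [Fintype κ] (h : S.SpecialForm e θ p)
    (hI : ∀ f ∈ diffIdeal D θ, f ∈ S.leftPolynomials e → f = 0) (A : Matrix κ κ (PDO D))
    (f g : V) :
    (S.quotient e θ p h hI).bracket (A.map (PDO.reduce θ)) (Ideal.Quotient.mk _ f)
      (Ideal.Quotient.mk _ g) = PDO.reduce θ ((S.tilde e θ p h).bracket A f g) := by
  simp only [bracket, frechet_quotient, Matrix.map_apply, reduce_eq, map_sum, map_mul,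
    PDO.mapHom_adjoint]

/-- The witnesses of the Jacobi identity and the cofactor of `ν - λ - μ` are reduced
coefficientwise, which commutes with the expansions. Rationality is an assumption because a nonzero
denominator may reduce to zero. -/
theorem IsPoisson.quotient [Fintype κ] (h : S.SpecialForm e θ p)
    (hI : ∀ f ∈ diffIdeal D θ, f ∈ S.leftPolynomials e → f = 0) {A : Matrix κ κ (PDO D)}
    (hA : (S.tilde e θ p h).IsPoisson A) (hr : IsRationalMatrix (A.map (PDO.reduce θ))) :
    (S.quotient e θ p h hI).IsPoisson (A.map (PDO.reduce θ)) := by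
  refine ⟨?_, hr, fun i j k => ?_⟩
  · ext1 i j
    have h1 : (A j i).adjoint = -A i j := congrFun (congrFun hA.skewadjoint i) j
    change (PDO.reduce θ (A j i)).adjoint = -PDO.reduce θ (A i j)
    rw [reduce_eq, ← PDO.mapHom_adjoint, h1, map_neg]
    rfl
  · obtain ⟨X, Y, Z, hX, hY, hZ, hE⟩ := hA.jacobi i j k
    obtain ⟨E, hE⟩ := (ThreeVar.mk_sub_mk_eq_iff X Y Z).1 hE
    let φ : V →+ V ⧸ diffIdeal D θ := (Ideal.Quotient.mk (diffIdeal D θ) : V →+* _)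
    have hb : ∀ f g n, ((S.quotient e θ p h hI).bracket (A.map (PDO.reduce θ))
        (Ideal.Quotient.mk _ f) (Ideal.Quotient.mk _ g)).coeff n =
        Ideal.Quotient.mk _ (((S.tilde e θ p h).bracket A f g).coeff n) := by
      intro f g n
      rw [bracket_quotient]
      rfl
    have hu : ∀ i, (S.quotient e θ p h hI).u i =
        Ideal.Quotient.mk _ ((S.tilde e θ p h).u i) := fun _ => rfl
    refine ⟨ThreeVar.map φ X, ThreeVar.map φ Y, ThreeVar.map φ Z, fun a b => ?_, fun a b => ?_,
      fun a b => ?_, (ThreeVar.mk_sub_mk_eq_iff _ _ _).2 ⟨ThreeVar.map φ E, ?_⟩⟩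
    · rw [ThreeVar.expandMuLambda_map, hX, hu, hu, hu, hb, hb]
      rfl
    · rw [ThreeVar.expandLambdaMu_map, hY, hu, hu, hu, hb, hb]
      rfl
    · rw [ThreeVar.expandLambdaNu_map, hZ, hu, hu, hu, hb, hb]
      rfl
    · rw [← ThreeVar.map_mulRel, ← hE, map_sub, map_sub]

theorem IsBiPoisson.quotient [Fintype κ] (h : S.SpecialForm e θ p)
    (hI : ∀ f ∈ diffIdeal D θ, f ∈ S.leftPolynomials e → f = 0)
    (hdom : IsDomain (V ⧸ diffIdeal D θ)) {A₀ A₁ : Matrix κ κ (PDO D)}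
    (hA : (S.tilde e θ p h).IsBiPoisson A₀ A₁)
    (h₀ : IsRationalMatrix (A₀.map (PDO.reduce θ)))
    (h₁ : IsRationalMatrix (A₁.map (PDO.reduce θ))) :
    (S.quotient e θ p h hI).IsBiPoisson (A₀.map (PDO.reduce θ)) (A₁.map (PDO.reduce θ)) := by
  have hadd : A₀.map (PDO.reduce θ) + A₁.map (PDO.reduce θ) = (A₀ + A₁).map (PDO.reduce θ) := by
    ext1 i j
    simp only [Matrix.add_apply, Matrix.map_apply, reduce_eq, map_add]
  refine ⟨hA.left.quotient h hI h₀, hA.right.quotient h hI h₁, ?_⟩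
  rw [hadd]
  -- Rationality of the sum is deduced from that of its terms over the quotient; the Ore condition
  -- behind this is where the quotient must be a domain.
  exact hA.add.quotient h hI (hadd ▸ h₀.add h₁)

end DiffFunAlg

/-! ### The proposition -/

theorem proposition7p1 {F V : Type*} [Field F] [CharZero F] [CommRing V] [IsDomain V]
    [Algebra F V] (D : Derivation F V V) {ℓ m : ℕ} (S : DiffFunAlg D (Fin ℓ))
    (H₀ H₁ : Matrix (Fin ℓ) (Fin ℓ) (PDO D)) (hH : S.IsBiPoisson H₀ H₁)
    (θ : Fin m → V) (hθ : ∀ α, S.IsCentral H₀ (θ α))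
    (hC : PDO.IsInvertible (S.constraintMatrix H₁ θ)) :
    (PDO.IsInvertible (S.constraintMatrix (H₀ + H₁) θ) ∧
      S.dirac (H₀ + H₁) θ = H₀ + S.dirac H₁ θ ∧
      S.IsBiPoisson H₀ (S.dirac H₁ θ)) ∧
    ∀ (hm : m ≤ ℓ) (p : Fin m → V) (hp : S.SpecialForm (splitLast hm) θ p)
      (Dp : Matrix (Fin m) (Fin (ℓ - m)) (PDO D)) (_ : Dp = S.frechetLeft (splitLast hm) p),
      ∃ (A₀ A₁ : Matrix (Fin (ℓ - m)) (Fin (ℓ - m)) (PDO D))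
        (B₁ : Matrix (Fin (ℓ - m)) (Fin m) (PDO D)) (D₁ : Matrix (Fin m) (Fin m) (PDO D)),
        H₀.submatrix (splitLast hm) (splitLast hm) =
          Matrix.fromRows 1 (-Dp) * A₀ * Matrix.fromCols 1 (-PDO.adjointMatrix Dp) ∧
        H₁.submatrix (splitLast hm) (splitLast hm) =
          Matrix.fromBlocks A₁ B₁ (-PDO.adjointMatrix B₁) D₁ ∧
        (S.tilde (splitLast hm) θ p hp).IsBiPoisson A₀
          (diracBlock A₁ B₁ (S.constraintMatrix H₁ θ) Dp) ∧
        ∀ hI : (∀ f ∈ diffIdeal D θ, f ∈ S.leftPolynomials (splitLast hm) → f = 0),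
          IsDomain (V ⧸ diffIdeal D θ) →
          PDO.IsRationalMatrix (A₀.map (PDO.reduce θ)) →
          PDO.IsRationalMatrix
            ((diracBlock A₁ B₁ (S.constraintMatrix H₁ θ) Dp).map (PDO.reduce θ)) →
          (S.quotient (splitLast hm) θ p hp hI).IsBiPoisson (A₀.map (PDO.reduce θ))
            ((diracBlock A₁ B₁ (S.constraintMatrix H₁ θ) Dp).map (PDO.reduce θ)) := by
  have h₀ := DiffFunAlg.frechetMatrix_mul_eq_zero hθ
  have hD := hH.dirac h₀ hC
  have h₀' := DiffFunAlg.mul_adjoint_frechetMatrix_eq_zero hH.left.skewadjoint h₀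
  refine ⟨⟨by rwa [DiffFunAlg.constraintMatrix_add h₀], DiffFunAlg.dirac_add h₀ h₀', hD⟩, ?_⟩
  rintro hm p hp Dp rfl
  -- `D_θ` annihilates both members of the pair from (a), `H₀` by centrality and the other by
  -- construction, so their first blocks form the pair of (b).
  have ht := hD.tilde hp h₀ (DiffFunAlg.frechetMatrix_mul_dirac hC)
  rw [hp.dirac_submatrix hH.right.skewadjoint] at ht
  exact ⟨_, _, _, _, hp.submatrix_eq hH.left.skewadjoint h₀,
    DiffFunAlg.submatrix_eq_fromBlocks _ hH.right.skewadjoint, ht,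
    fun hI hdom hr₀ hr₁ => ht.quotient hp hI hdom hr₀ hr₁⟩
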